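/- Let $k$ be an algebraically closed field of characteristic zero, $G$ a reductive affine algebraic group over $k$ (reductive meaning that every finite-dimensional rational $G$-module is semisimple), $W=\mathrm{Spec}(P)$ an affine $G$-scheme of finite type over $k$, and $X\subset W$ a $G$-stable closed subscheme with ideal $I\subset P$, such that $\dim_k \mathrm{Hom}^G(M,P/I)<\infty$ for every irreducible rational $G$-module $M$. Let $\mathrm{Art}$ be the category of local Artinian $k$-algebras with residue field $k$. For $A\in\mathrm{Art}$ put $P_A=A\otimes_k P$, with $G$ acting trivially on $A$, and let $D(A)$ be the set of $G$-stable ideals $Z\subset P_A$ with $P_A/Z$ flat over $A$ and with image $I$ under $P_A\to P_A\otimes_A k=P$; that is, of $G$-stable closed subschemes of $\mathrm{Spec}(A)\times W$, flat over $\mathrm{Spec}(A)$, with closed fibre $X$. Base change makes $D:\mathrm{Art}\to\mathrm{Sets}$ a functor. A small extension is an exact sequence $0\to J\to A'\to A\to 0$ with $A'\to A$ a surjection in $\mathrm{Art}$ and $\mathfrak m_{A'}J=0$. An obstruction theory for a functor $F:\mathrm{Art}\to\mathrm{Sets}$ with obstruction space $V$ consists of a finite-dimensional $k$-vector space $V$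 and, for every small extension, a map $\mathrm{ob}:F(A)\to J\otimes_k V$ such that (1) $\mathrm{ob}(\lambda)=0$ if and only if $\lambda$ lies in the image of $F(A')\to F(A)$, and (2) for every morphism of small extensions from $0\to J_1\to A'\to A\to 0$ to $0\to J_2\to B\to B'\to 0$, with induced map $f:J_1\to J_2$, the composite $F(A)\to F(B')\xrightarrow{\mathrm{ob}_2} J_2\otimes V$ equals $(f\otimes\mathrm{id})\circ\mathrm{ob}_1$. Let $\mathrm{Ext}^{1,G}_P$ be the first Ext group in the abelian category of rational $(P,G)$-modules. Then $\mathrm{Ext}^{1,G}_P(I,P/I)$ is an obstruction space for $D$. In particular, it is finite-dimensional. More precisely, there exist $G$-equivariant presentations $$(\Pi_0)\qquad P\otimes N_2\xrightarrow{v_0}P\otimes N_1\xrightarrow{u_0}P\to P/I\to 0$$ with $N_1,N_2$ finite-dimensional rational $G$-modules, and there is an obstruction theory for $D$ with obstruction space $\mathrm{Ext}^{1,G}_P(I,P/I)$ whose map $\mathrm{ob}$ is given, for every such presentation, every small extension and every $Z\in D(A)$, as follows. Choose an exact sequence $P_A\otimes N_2\xrightarrow{v}P_A\otimes N_1\xrightarrow{u}P_A\to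 P_A/Z\to0$ of $(P_A,G)$-modules restricting to $(\Pi_0)$ over $k$, and $G$-equivariant $P_{A'}$-linear lifts $u'$, $v'$ of $u$, $v$ over $A'$. The restriction of $u'\circ v'$ to $N_2$ takes values in $J\otimes P$, and its reduction $N_2\to J\otimes P/I$ is induced via $v_0$ by a unique $\eta\in J\otimes \mathrm{Hom}_P^G(\ker u_0,P/I)$; then $\mathrm{ob}(Z)\in J\otimes\mathrm{Ext}^{1,G}_P(I,P/I)$ is the image of $\eta$ under the connecting map $\mathrm{Hom}_P^G(\ker u_0,P/I)\to\mathrm{Ext}^{1,G}_P(I,P/I)$ of $0\to\ker u_0\to P\otimes N_1\to I\to0$. Such choices always exist, and the result does not depend on them. -/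

import Mathlib

open CategoryTheory CategoryTheory.Limits TensorProduct

universe u v w

/-- An affine algebraic group over `k`, in the classical language (`k` algebraically closed): a
group `G` together with a finitely generated algebra of `k`-valued functions on `G` whose `k`-algebra
homomorphisms to `k` are exactly the evaluations at the points of `G`, such that multiplication and
inversion are morphisms of affine varieties. -/
class AffineAlgebraicGroup (k : Type u) (G : Type v) [Field k] [Group G] where
  /-- the regular functions on `G` -/
  coordRing : Subalgebra k (G → k)
  fg : coordRing.FG
  eval_bijective : Function.Bijective
    (fun g : G => ((Pi.evalAlgHom k (fun _ : G => k) g).comp coordRing.val : coordRing →ₐ[k] k))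
  /-- the comultiplication takes values in `k[G] ⊗ k[G]` -/
  mul_mem : ∀ f ∈ coordRing, ∃ (n : ℕ) (a b : Fin n → G → k),
    (∀ i, a i ∈ coordRing) ∧ (∀ i, b i ∈ coordRing) ∧ ∀ x y, f (x * y) = ∑ i, a i x * b i y
  inv_mem : ∀ f ∈ coordRing, (fun x => f x⁻¹) ∈ coordRing

/-- A representation of an affine algebraic group is a rational module if every vector lies in a
finite-dimensional subrepresentation with regular matrix coefficients; equivalently, for each `x` the
orbit map is of the form `g ↦ ∑ fᵢ(g) xᵢ` for finitely many regular functions `fᵢ` and vectors `xᵢ`. -/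
def Representation.IsRational {k : Type u} {G : Type v} {M : Type w} [Field k] [Group G]
    [AffineAlgebraicGroup k G] [AddCommGroup M] [Module k M] (ρ : Representation k G M) : Prop :=
  ∀ x : M, ∃ (n : ℕ) (f : Fin n → G → k) (y : Fin n → M),
    (∀ i, f i ∈ AffineAlgebraicGroup.coordRing (k := k) (G := G)) ∧ ∀ g, ρ g x = ∑ i, f i g • y i

/-- `G` is (linearly) reductive: every finite-dimensional rational `G`-module is semisimple. -/
class IsReductiveGroup (k : Type u) (G : Type v) [Field k] [Group G]
    [AffineAlgebraicGroup k G] : Prop where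
  semisimple : ∀ (M : Type u) [AddCommGroup M] [Module k M] [Module.Finite k M]
    (ρ : Representation k G M), ρ.IsRational → ρ.IsSemisimpleRepresentation

/-- The representation of `G` on an algebra `P` on which `G` acts by `k`-algebra automorphisms. -/
def algebraRep (k : Type u) (G : Type v) (P : Type u) [Field k] [Group G] [CommRing P] [Algebra k P]
    [MulSemiringAction G P] [SMulCommClass G k P] : Representation k G P where
  toFun g := (MulSemiringAction.toAlgHom k P g).toLinearMap
  map_one' := by ext; simp
  map_mul' a b := by ext; simp [mul_smul]

/-- The affine scheme `Spec P` is a `G`-scheme: the action of `G` on `P` by algebra automorphisms is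
rational. -/
class IsAffineGScheme (k : Type u) (G : Type v) (P : Type u) [Field k] [Group G]
    [AffineAlgebraicGroup k G] [CommRing P] [Algebra k P]
    [MulSemiringAction G P] [SMulCommClass G k P] : Prop where
  rational : (algebraRep k G P).IsRational

section rational

variable {k : Type u} {G : Type v} {M N : Type w} [Field k] [Group G]
  [AffineAlgebraicGroup k G] [AddCommGroup M] [Module k M] [AddCommGroup N] [Module k N]
  {ρ : Representation k G M} {σ : Representation k G N}

theorem Representation.IsRational.of_surjective (h : ρ.IsRational) (f : M →ₗ[k] N)
    (hf : Function.Surjective f) (hc : ∀ g x, f (ρ g x) = σ g (f x)) : σ.IsRational := by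
  intro y
  obtain ⟨x, rfl⟩ := hf y
  obtain ⟨n, a, z, ha, hz⟩ := h x
  exact ⟨n, a, fun i => f (z i), ha, fun g => by rw [← hc, hz]; simp⟩

theorem Representation.IsRational.of_injective (h : σ.IsRational) (f : M →ₗ[k] N)
    (hf : Function.Injective f) (hc : ∀ g x, f (ρ g x) = σ g (f x)) : ρ.IsRational := by
  intro x
  obtain ⟨n, a, z, ha, hz⟩ := h (f x)
  obtain ⟨r, hr⟩ := f.exists_leftInverse_of_injective (LinearMap.ker_eq_bot.2 hf)
  refine ⟨n, a, fun i => r (z i), ha, fun g => ?_⟩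
  have : r (f (ρ g x)) = ρ g x := LinearMap.congr_fun hr _
  rw [← this, hc, hz]
  simp

theorem Representation.IsRational.tprod (h : ρ.IsRational) (h' : σ.IsRational) :
    (ρ.tprod σ).IsRational := by
  intro x
  induction x with
  | zero => exact ⟨0, Fin.elim0, Fin.elim0, fun i => i.elim0, by simp⟩
  | tmul x y =>
    obtain ⟨n, a, z, ha, hz⟩ := h x
    obtain ⟨m, b, t, hb, ht⟩ := h' y
    refine ⟨n * m, fun i => a (finProdFinEquiv.symm i).1 * b (finProdFinEquiv.symm i).2,
      fun i => z (finProdFinEquiv.symm i).1 ⊗ₜ t (finProdFinEquiv.symm i).2,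
      fun i => mul_mem (ha _) (hb _), fun g => ?_⟩
    rw [Equiv.sum_comp finProdFinEquiv.symm
      (fun p : Fin n × Fin m => (a p.1 * b p.2) g • (z p.1 ⊗ₜ[k] t p.2)), Fintype.sum_prod_type]
    simp only [Representation.tprod_apply, TensorProduct.map_tmul, hz, ht, TensorProduct.sum_tmul,
      TensorProduct.tmul_sum, Pi.mul_apply, TensorProduct.smul_tmul_smul]
    rw [Finset.sum_comm]
  | add x y hx hy =>
    obtain ⟨n, a, z, ha, hz⟩ := hx
    obtain ⟨m, b, t, hb, ht⟩ := hy
    refine ⟨n + m, Fin.append a b, Fin.append z t, fun i => ?_, fun g => ?_⟩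
    · induction i using Fin.addCases <;> simp [ha, hb]
    · rw [map_add, hz, ht]; simp [Fin.sum_univ_add]

theorem Representation.IsRational.prod {L : Type*} [AddCommGroup L] [Module k L]
    {τ : Representation k G L} (h : ρ.IsRational) (h' : σ.IsRational)
    (i : M →ₗ[k] L) (j : N →ₗ[k] L) (hi : ∀ g x, i (ρ g x) = τ g (i x))
    (hj : ∀ g x, j (σ g x) = τ g (j x)) (hs : ∀ z, ∃ x y, i x + j y = z) : τ.IsRational := by
  intro z
  obtain ⟨x, y, rfl⟩ := hs z
  obtain ⟨n, a, z, ha, hz⟩ := h x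
  obtain ⟨m, b, t, hb, ht⟩ := h' y
  refine ⟨n + m, Fin.append a b, Fin.append (fun l => i (z l)) (fun l => j (t l)),
    fun i => ?_, fun g => ?_⟩
  · induction i using Fin.addCases <;> simp [ha, hb]
  · rw [map_add, ← hi, ← hj, hz, ht]
    simp [Fin.sum_univ_add]

end rational

/-- A rational `(P, G)`-module: a `P`-module `M` with a rational linear action of `G` satisfying
`g (p x) = (g p) (g x)`. -/
structure EqMod (k : Type u) (G : Type v) (P : Type u) [Field k] [Group G]
    [AffineAlgebraicGroup k G] [CommRing P] [Algebra k P] [MulSemiringAction G P]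
    [SMulCommClass G k P] where
  carrier : Type u
  [addCommGroup : AddCommGroup carrier]
  [module : Module P carrier]
  [moduleBase : Module k carrier]
  [isScalarTower : IsScalarTower k P carrier]
  ρ : Representation k G carrier
  ρ_smul : ∀ (g : G) (p : P) (x : carrier), ρ g (p • x) = (g • p) • ρ g x
  rational : ρ.IsRational

namespace EqMod

variable {k : Type u} {G : Type v} {P : Type u} [Field k] [Group G]
  [AffineAlgebraicGroup k G] [CommRing P] [Algebra k P] [MulSemiringAction G P]
  [SMulCommClass G k P]

instance : CoeSort (EqMod k G P) (Type u) := ⟨carrier⟩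

attribute [instance] addCommGroup module moduleBase isScalarTower

/-- Morphisms of `(P, G)`-modules: `P`-linear `G`-equivariant maps. -/
@[ext]
structure Hom (M N : EqMod k G P) where
  toLin : M →ₗ[P] N
  comm : ∀ (g : G) (x : M), toLin (M.ρ g x) = N.ρ g (toLin x)

instance : Category (EqMod k G P) where
  Hom M N := Hom M N
  id M := ⟨LinearMap.id, fun _ _ => rfl⟩
  comp f g := ⟨g.toLin.comp f.toLin, fun a x => by simp [f.comm, g.comm]⟩

@[ext]
theorem hom_ext {M N : EqMod k G P} {f g : M ⟶ N} (h : ∀ x, f.toLin x = g.toLin x) : f = g :=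
  Hom.ext (LinearMap.ext h)

@[simp] theorem id_toLin (M : EqMod k G P) : Hom.toLin (𝟙 M) = LinearMap.id := rfl

@[simp] theorem comp_toLin {M N L : EqMod k G P} (f : M ⟶ N) (g : N ⟶ L) :
    (f ≫ g).toLin = g.toLin.comp f.toLin := rfl

/-- Build a morphism. -/
def mkHom {M N : EqMod k G P} (f : M →ₗ[P] N)
    (h : ∀ (g : G) (x : M), f (M.ρ g x) = N.ρ g (f x)) : M ⟶ N := Hom.mk f h

@[simp] theorem mkHom_toLin {M N : EqMod k G P} (f : M →ₗ[P] N)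
    (h : ∀ (g : G) (x : M), f (M.ρ g x) = N.ρ g (f x)) : (mkHom f h).toLin = f := rfl

section additive

variable (M N : EqMod k G P)

instance : Zero (M ⟶ N) := ⟨mkHom 0 (by simp)⟩
instance : Add (M ⟶ N) := ⟨fun f g => mkHom (f.toLin + g.toLin) (by simp [f.comm, g.comm])⟩
instance : Neg (M ⟶ N) := ⟨fun f => mkHom (-f.toLin) (by simp [f.comm])⟩
instance : Sub (M ⟶ N) := ⟨fun f g => mkHom (f.toLin - g.toLin) (by simp [f.comm, g.comm])⟩
instance : SMul k (M ⟶ N) := ⟨fun c f => mkHom (c • f.toLin) (by simp [f.comm])⟩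
instance : SMul ℕ (M ⟶ N) := ⟨fun c f => mkHom (c • f.toLin) (by simp [f.comm])⟩
instance : SMul ℤ (M ⟶ N) := ⟨fun c f => mkHom (c • f.toLin) (by simp [f.comm])⟩

instance : AddCommGroup (M ⟶ N) :=
  Function.Injective.addCommGroup (fun f : M ⟶ N => f.toLin) (fun _ _ h => Hom.ext h)
    rfl (fun _ _ => rfl) (fun _ => rfl) (fun _ _ => rfl) (fun _ _ => rfl) (fun _ _ => rfl)

/-- The underlying linear map, as an additive map. -/
def toLinAddHom : (M ⟶ N) →+ (M →ₗ[P] N) where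
  toFun f := f.toLin
  map_zero' := rfl
  map_add' _ _ := rfl

instance : Module k (M ⟶ N) :=
  Function.Injective.module k (toLinAddHom M N) (fun _ _ h => Hom.ext h) (fun _ _ => rfl)

end additive

@[simp] theorem zero_toLin (M N : EqMod k G P) : (0 : M ⟶ N).toLin = 0 := rfl
@[simp] theorem add_toLin {M N : EqMod k G P} (f g : M ⟶ N) :
    (f + g).toLin = f.toLin + g.toLin := rfl
@[simp] theorem smul_toLin {M N : EqMod k G P} (c : k) (f : M ⟶ N) :
    (c • f).toLin = c • f.toLin := rfl

instance : Preadditive (EqMod k G P) where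
  add_comp _ _ _ f f' g := by ext; simp
  comp_add _ _ _ f g g' := by ext; simp

instance : Linear k (EqMod k G P) where
  smul_comp _ _ _ r f g := by
    ext x
    simp
  comp_smul _ _ _ f r g := by ext x; simp

/-- A `G`-stable submodule as a `(P, G)`-module. -/
def ofSub (M : EqMod k G P) (S : Submodule P M) (h : ∀ (g : G), ∀ x ∈ S, M.ρ g x ∈ S) :
    EqMod k G P where
  carrier := S
  ρ := { toFun := fun g => (M.ρ g).restrict (p := S.restrictScalars k) (q := S.restrictScalars k)
            (h g)
         map_one' := LinearMap.ext fun x => Subtype.ext (by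
          change M.ρ 1 x = x
          simp)
         map_mul' := fun a b => LinearMap.ext fun x => Subtype.ext (by
          change M.ρ (a * b) x = M.ρ a (M.ρ b x)
          simp) }
  ρ_smul g p x := Subtype.ext (M.ρ_smul g p x)
  rational := M.rational.of_injective (S.subtype.restrictScalars k) S.injective_subtype
    (fun _ _ => rfl)

/-- The inclusion of a `G`-stable submodule. -/
def ofSubι (M : EqMod k G P) (S : Submodule P M) (h : ∀ (g : G), ∀ x ∈ S, M.ρ g x ∈ S) :
    ofSub M S h ⟶ M := mkHom S.subtype (fun _ _ => rfl)

/-- The quotient by a `G`-stable submodule as a `(P, G)`-module. -/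
def ofQuot (M : EqMod k G P) (S : Submodule P M) (h : ∀ (g : G), ∀ x ∈ S, M.ρ g x ∈ S) :
    EqMod k G P where
  carrier := M ⧸ S
  ρ := { toFun := fun g => (S.restrictScalars k).mapQ (S.restrictScalars k) (M.ρ g) (h g)
         map_one' := LinearMap.ext fun x => by
          obtain ⟨x, rfl⟩ := Submodule.Quotient.mk_surjective _ x
          change Submodule.Quotient.mk (M.ρ 1 x) = Submodule.Quotient.mk x
          simp
         map_mul' := fun a b => LinearMap.ext fun x => by
          obtain ⟨x, rfl⟩ := Submodule.Quotient.mk_surjective _ x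
          change Submodule.Quotient.mk (M.ρ (a * b) x) = Submodule.Quotient.mk (M.ρ a (M.ρ b x))
          simp }
  ρ_smul g p x := by
    obtain ⟨x, rfl⟩ := Submodule.Quotient.mk_surjective _ x
    exact congrArg (Submodule.Quotient.mk (p := S)) (M.ρ_smul g p x)
  rational := M.rational.of_surjective (S.mkQ.restrictScalars k) S.mkQ_surjective
    (fun _ _ => rfl)

/-- The projection to the quotient by a `G`-stable submodule. -/
def ofQuotπ (M : EqMod k G P) (S : Submodule P M) (h : ∀ (g : G), ∀ x ∈ S, M.ρ g x ∈ S) :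
    M ⟶ ofQuot M S h := mkHom S.mkQ (fun _ _ => rfl)

section abelian

variable {M N : EqMod k G P} (f : M ⟶ N)

/-- The kernel of a morphism. -/
def ker : EqMod k G P := ofSub M (LinearMap.ker f.toLin) (fun g x hx => by
  rw [LinearMap.mem_ker] at hx ⊢
  rw [f.comm, hx, map_zero])

/-- The inclusion of the kernel. -/
def kerι : ker f ⟶ M := ofSubι M _ _

theorem kerι_comp : kerι f ≫ f = 0 := by
  ext x; exact x.2

/-- `ker f` is a categorical kernel. -/
def kerIsLimit : IsLimit (KernelFork.ofι (kerι f) (kerι_comp f)) :=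
  KernelFork.IsLimit.ofι _ _
    (fun {L} g hg => mkHom (g.toLin.codRestrict _ (fun x => by
        simpa using LinearMap.congr_fun (congrArg Hom.toLin hg) x))
      (fun a x => Subtype.ext (g.comm a x)))
    (fun g hg => rfl)
    (fun g hg m hm => by
      ext x
      exact Subtype.ext (LinearMap.congr_fun (congrArg Hom.toLin hm) x))

/-- The cokernel of a morphism. -/
def coker : EqMod k G P := ofQuot N (LinearMap.range f.toLin) (by
  rintro g _ ⟨x, rfl⟩
  exact ⟨M.ρ g x, f.comm g x⟩)

/-- The projection to the cokernel. -/
def cokerπ : N ⟶ coker f := ofQuotπ N _ _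

theorem comp_cokerπ : f ≫ cokerπ f = 0 := by
  ext x; exact (Submodule.Quotient.mk_eq_zero _).2 ⟨x, rfl⟩

/-- Morphisms out of a quotient. -/
def quotDesc {L : EqMod k G P} (S : Submodule P N) (h : ∀ (g : G), ∀ x ∈ S, N.ρ g x ∈ S)
    (g : N ⟶ L) (hg : S ≤ LinearMap.ker g.toLin) : ofQuot N S h ⟶ L :=
  mkHom (M := ofQuot N S h) (S.liftQ g.toLin hg) (fun a x => by
    obtain ⟨x, rfl⟩ := Submodule.Quotient.mk_surjective _ x
    exact g.comm a x)

/-- `coker f` is a categorical cokernel. -/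
def cokerIsColimit : IsColimit (CokernelCofork.ofπ (cokerπ f) (comp_cokerπ f)) :=
  CokernelCofork.IsColimit.ofπ _ _
    (fun {L} g hg => quotDesc _ _ g (by
      rintro _ ⟨x, rfl⟩
      simpa using LinearMap.congr_fun (congrArg Hom.toLin hg) x))
    (fun g hg => rfl)
    (fun g hg m hm => by
      ext x
      obtain ⟨x, rfl⟩ := Submodule.Quotient.mk_surjective _ x
      exact LinearMap.congr_fun (congrArg Hom.toLin hm) x)

instance : HasKernels (EqMod k G P) := ⟨fun f => ⟨⟨⟨_, kerIsLimit f⟩⟩⟩⟩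
instance : HasCokernels (EqMod k G P) := ⟨fun f => ⟨⟨⟨_, cokerIsColimit f⟩⟩⟩⟩

theorem injective_of_mono [Mono f] : Function.Injective f.toLin := by
  rw [← LinearMap.ker_eq_bot, eq_bot_iff]
  intro x hx
  have h : kerι f = 0 := by rw [← cancel_mono f, kerι_comp, zero_comp]
  exact LinearMap.congr_fun (congrArg Hom.toLin h) ⟨x, hx⟩

theorem surjective_of_epi [Epi f] : Function.Surjective f.toLin := by
  intro y
  have h : cokerπ f = 0 := by rw [← cancel_epi f, comp_cokerπ, comp_zero]
  exact (Submodule.Quotient.mk_eq_zero _).1 (LinearMap.congr_fun (congrArg Hom.toLin h) y)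

theorem mono_of_injective (hf : Function.Injective f.toLin) : Mono f :=
  ⟨fun g h e => by
    ext x
    exact hf (LinearMap.congr_fun (congrArg Hom.toLin e) x)⟩

theorem epi_of_surjective (hf : Function.Surjective f.toLin) : Epi f :=
  ⟨fun g h e => by
    ext x
    obtain ⟨x, rfl⟩ := hf x
    exact LinearMap.congr_fun (congrArg Hom.toLin e) x⟩

/-- An injective morphism is the kernel of its cokernel. -/
@[reducible] noncomputable def normalMono (hf : Function.Injective f.toLin) : NormalMono f where
  Z := coker f
  g := cokerπ f
  w := comp_cokerπ f
  isLimit := KernelFork.IsLimit.ofι _ _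
    (fun {L} g hg => mkHom ((LinearEquiv.ofInjective f.toLin hf).symm.toLinearMap.comp
        (g.toLin.codRestrict (LinearMap.range f.toLin) (fun x =>
          (Submodule.Quotient.mk_eq_zero _).1
            (LinearMap.congr_fun (congrArg Hom.toLin hg) x))))
      (fun a x => hf (by
        rw [f.comm]
        have key : ∀ y, f.toLin ((LinearEquiv.ofInjective f.toLin hf).symm y) = y := fun y =>
          congrArg Subtype.val ((LinearEquiv.ofInjective f.toLin hf).apply_symm_apply y)
        simp only [LinearMap.comp_apply, LinearEquiv.coe_coe, key]
        exact g.comm a x)))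
    (fun g hg => by
      ext x
      exact congrArg Subtype.val ((LinearEquiv.ofInjective f.toLin hf).apply_symm_apply _))
    (fun g hg m hm => by
      ext x
      apply hf
      refine (LinearMap.congr_fun (congrArg Hom.toLin hm) x).trans ?_
      exact (congrArg Subtype.val
        ((LinearEquiv.ofInjective f.toLin hf).apply_symm_apply ⟨g.toLin x, _⟩)).symm)

/-- A surjective morphism is the cokernel of its kernel. -/
@[reducible] noncomputable def normalEpi (hf : Function.Surjective f.toLin) : NormalEpi f where
  W := ker f
  g := kerι f
  w := kerι_comp f
  isColimit := CokernelCofork.IsColimit.ofπ _ _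
    (fun {L} g hg =>
      have hle : LinearMap.ker f.toLin ≤ LinearMap.ker g.toLin := fun x hx =>
        LinearMap.congr_fun (congrArg Hom.toLin hg) ⟨x, hx⟩
      have key : ∀ x, ((LinearMap.ker f.toLin).liftQ g.toLin hle).comp
          (f.toLin.quotKerEquivOfSurjective hf).symm.toLinearMap (f.toLin x) = g.toLin x :=
        fun x => by
          have : (f.toLin.quotKerEquivOfSurjective hf).symm (f.toLin x) =
              Submodule.Quotient.mk x := by
            rw [LinearEquiv.symm_apply_eq]; rfl
          simp only [LinearMap.comp_apply, LinearEquiv.coe_coe, this]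
          rfl
      mkHom (((LinearMap.ker f.toLin).liftQ g.toLin hle).comp
        (f.toLin.quotKerEquivOfSurjective hf).symm.toLinearMap)
      (fun a x => by
        obtain ⟨x, rfl⟩ := hf x
        rw [← f.comm, key, key, g.comm]))
    (fun g hg => by
      ext x
      have : (f.toLin.quotKerEquivOfSurjective hf).symm (f.toLin x) =
          Submodule.Quotient.mk x := by
        rw [LinearEquiv.symm_apply_eq]; rfl
      simp only [comp_toLin, mkHom_toLin, LinearMap.comp_apply, LinearEquiv.coe_coe, this]
      rfl)
    (fun g hg m hm => by
      have := epi_of_surjective f hf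
      rw [← cancel_epi f, hm]
      ext x
      have : (f.toLin.quotKerEquivOfSurjective hf).symm (f.toLin x) =
          Submodule.Quotient.mk x := by
        rw [LinearEquiv.symm_apply_eq]; rfl
      simp only [comp_toLin, mkHom_toLin, LinearMap.comp_apply, LinearEquiv.coe_coe, this]
      rfl)

/-- The direct sum of two `(P, G)`-modules. -/
def sum (M N : EqMod k G P) : EqMod k G P where
  carrier := M × N
  ρ := { toFun := fun g => (M.ρ g).prodMap (N.ρ g)
         map_one' := by ext <;> simp
         map_mul' := fun a b => by ext <;> simp }
  ρ_smul g p x := Prod.ext (M.ρ_smul g p x.1) (N.ρ_smul g p x.2)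
  rational := M.rational.prod N.rational (LinearMap.inl k M N) (LinearMap.inr k M N)
    (by intros; simp) (by intros; simp) (fun z => ⟨z.1, z.2, by simp⟩)

instance : HasBinaryProducts (EqMod k G P) :=
  @hasBinaryProducts_of_hasLimit_pair _ _ (fun {M N} => ⟨⟨⟨BinaryFan.mk (P := sum M N)
    (mkHom (M := sum M N) (LinearMap.fst P M N) (fun _ _ => rfl))
    (mkHom (M := sum M N) (LinearMap.snd P M N) (fun _ _ => rfl)),
    BinaryFan.isLimitMk
      (fun s => mkHom (N := sum M N) (LinearMap.prod (Hom.toLin s.fst) (Hom.toLin s.snd))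
        (fun a x => Prod.ext (Hom.comm s.fst a x) (Hom.comm s.snd a x)))
      (fun s => rfl) (fun s => rfl)
      (fun s m h₁ h₂ => by
        ext x
        exact Prod.ext (LinearMap.congr_fun (congrArg Hom.toLin h₁) x)
          (LinearMap.congr_fun (congrArg Hom.toLin h₂) x))⟩⟩⟩)

/-- The zero object. -/
def zeroObj : EqMod k G P where
  carrier := PUnit
  ρ := 1
  ρ_smul _ _ _ := rfl
  rational _ := ⟨0, Fin.elim0, Fin.elim0, fun i => i.elim0, fun _ => rfl⟩

theorem isZero_zeroObj : IsZero (zeroObj : EqMod k G P) where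
  unique_to N := ⟨⟨⟨0⟩, fun f => by
    ext x; rw [show x = 0 from rfl, map_zero, map_zero]⟩⟩
  unique_from N := ⟨⟨⟨0⟩, fun f => by ext x; rfl⟩⟩

instance : HasZeroObject (EqMod k G P) := ⟨⟨_, isZero_zeroObj⟩⟩

instance : HasFiniteProducts (EqMod k G P) :=
  haveI : HasTerminal (EqMod k G P) := HasZeroObject.hasTerminal
  hasFiniteProducts_of_has_binary_and_terminal

noncomputable instance : Abelian (EqMod k G P) where
  normalMonoOfMono f _ := ⟨normalMono f (injective_of_mono f)⟩
  normalEpiOfEpi f _ := ⟨normalEpi f (surjective_of_epi f)⟩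

/-- The short exact sequence `0 → ker f → M → N → 0` of a surjective morphism. -/
theorem shortExact_ker (hf : Function.Surjective f.toLin) :
    (ShortComplex.mk (kerι f) f (kerι_comp f)).ShortExact where
  exact := ShortComplex.exact_of_f_is_kernel _ (kerIsLimit f)
  mono_f := mono_of_injective _ Subtype.val_injective
  epi_g := epi_of_surjective _ hf

instance : HasExt.{max v (u + 1)} (EqMod k G P) := HasExt.standard _

/-- The class in `Ext¹(N, ker f)` of the extension `0 → ker f → M → N → 0`. -/
noncomputable def kerExtClass (hf : Function.Surjective f.toLin) : Abelian.Ext N (ker f) 1 :=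
  (shortExact_ker f hf).extClass

/-- The connecting map `Hom(ker f, L) → Ext¹(N, L)` of `0 → ker f → M → N → 0`: the Yoneda product
with the class of this extension. -/
noncomputable def connecting (hf : Function.Surjective f.toLin) (L : EqMod k G P) :
    (ker f ⟶ L) →ₗ[k] Abelian.Ext N L 1 where
  toFun κ := (kerExtClass f hf).comp (Abelian.Ext.mk₀ κ) (add_zero 1)
  map_add' κ κ' := by simp [Abelian.Ext.mk₀_add]
  map_smul' c κ := by simp [Abelian.Ext.mk₀_smul]

end abelian

end EqMod

/-! ### Artinian algebras, deformation functors and obstruction theories -/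

/-- The category of local Artinian `k`-algebras with residue field `k`. -/
structure Art (k : Type u) [Field k] where
  carrier : Type u
  [commRing : CommRing carrier]
  [algebra : Algebra k carrier]
  [isLocalRing : IsLocalRing carrier]
  [isArtinianRing : IsArtinianRing carrier]
  residue_bijective : Function.Bijective (algebraMap k (IsLocalRing.ResidueField carrier))

namespace Art

variable {k : Type u} [Field k]

instance : CoeSort (Art k) (Type u) := ⟨carrier⟩

attribute [instance] commRing algebra isLocalRing isArtinianRing

/-- Morphisms are `k`-algebra homomorphisms; these are automatically local. -/
@[ext]
structure Hom (A B : Art k) where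
  alg : A →ₐ[k] B

instance : Category (Art k) where
  Hom A B := Hom A B
  id A := ⟨AlgHom.id k A⟩
  comp f g := ⟨g.alg.comp f.alg⟩

@[simp] theorem id_alg (A : Art k) : Hom.alg (𝟙 A) = AlgHom.id k A := rfl

@[simp] theorem comp_alg {A B C : Art k} (f : A ⟶ B) (g : B ⟶ C) :
    (f ≫ g).alg = g.alg.comp f.alg := rfl

/-- The augmentation `A → A / 𝔪_A = k`. -/
noncomputable def aug (A : Art k) : A →ₐ[k] k :=
  ((AlgEquiv.ofBijective (Algebra.ofId k (IsLocalRing.ResidueField A))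
    A.residue_bijective).symm : IsLocalRing.ResidueField A →ₐ[k] k).comp
      (IsScalarTower.toAlgHom k A (IsLocalRing.ResidueField A))

theorem algHom_eq_aug (A : Art k) (f : A →ₐ[k] k) : f = A.aug := by
  have hmax : ∀ g : A →ₐ[k] k, RingHom.ker g = IsLocalRing.maximalIdeal A := fun g =>
    IsLocalRing.eq_maximalIdeal (RingHom.ker_isMaximal_of_surjective g
      (fun c => ⟨algebraMap k A c, by simp⟩))
  ext a
  have h : a - algebraMap k A (A.aug a) ∈ RingHom.ker A.aug := by
    simp [RingHom.mem_ker]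
  rw [hmax, ← hmax f, RingHom.mem_ker, map_sub, sub_eq_zero, AlgHom.commutes] at h
  exact h

theorem aug_comp {A B : Art k} (φ : A ⟶ B) : B.aug.comp φ.alg = A.aug := algHom_eq_aug _ _

/-- The kernel of a morphism, as a `k`-vector space. -/
def kernel {A' A : Art k} (φ : A' ⟶ A) : Submodule k A' := LinearMap.ker φ.alg.toLinearMap

/-- `φ : A' → A` is a small extension: it is surjective and its kernel `J` satisfies
`𝔪_{A'} J = 0`. -/
structure IsSmallExtension {A' A : Art k} (φ : A' ⟶ A) : Prop where
  surjective : Function.Surjective φ.alg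
  mul_eq_zero : ∀ m ∈ IsLocalRing.maximalIdeal A', ∀ j ∈ kernel φ, m * j = 0

/-- The map on kernels induced by a commutative square. -/
def kernelMap {A' A B' B : Art k} (φ : A' ⟶ A) (ψ : B' ⟶ B) (α : A' ⟶ B') (β : A ⟶ B)
    (h : φ ≫ β = α ≫ ψ) : kernel φ →ₗ[k] kernel ψ :=
  α.alg.toLinearMap.restrict (fun x hx => by
    have h1 : β.alg (φ.alg x) = ψ.alg (α.alg x) := DFunLike.congr_fun (congrArg Hom.alg h) x
    have h2 : φ.alg x = 0 := hx
    change ψ.alg (α.alg x) = 0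
    rw [← h1, h2, map_zero])

end Art

/-- An obstruction theory for a covariant functor `F : Art → Sets` with obstruction space `V`: a
finite-dimensional space `V` with, for every small extension `0 → J → A' → A → 0`, a map
`F(A) → J ⊗ V` whose zero locus is the image of `F(A')`, compatibly with morphisms of small
extensions. -/
structure ObstructionTheory {k : Type u} [Field k] (F : Art k ⥤ Type u) (V : Type w)
    [AddCommGroup V] [Module k V] where
  finite : Module.Finite k V
  ob : ∀ {A' A : Art k} (φ : A' ⟶ A), Art.IsSmallExtension φ → F.obj A → Art.kernel φ ⊗[k] V
  exact : ∀ {A' A : Art k} (φ : A' ⟶ A) (hφ : Art.IsSmallExtension φ) (z : F.obj A),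
    ob φ hφ z = 0 ↔ ∃ z' : F.obj A', F.map φ z' = z
  natural : ∀ {A' A B' B : Art k} (φ : A' ⟶ A) (hφ : Art.IsSmallExtension φ)
    (ψ : B' ⟶ B) (hψ : Art.IsSmallExtension ψ) (α : A' ⟶ B') (β : A ⟶ B)
    (h : φ ≫ β = α ≫ ψ) (z : F.obj A),
    ob ψ hψ (F.map β z) = (Art.kernelMap φ ψ α β h).rTensor V (ob φ hφ z)

section setup

variable {k : Type u} {G : Type v} {P : Type u} [Field k] [Group G]
  [CommRing P] [Algebra k P] [MulSemiringAction G P]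
  [SMulCommClass G k P]

/-- The action of `g` on `P_A = A ⊗ P`, trivial on `A`. -/
noncomputable def actOn (A : Art k) (g : G) : A ⊗[k] P →ₐ[A] A ⊗[k] P :=
  Algebra.TensorProduct.map (AlgHom.id A A) (MulSemiringAction.toAlgHom k P g)

/-- The base change `P_A → P_B` along `A → B`. -/
noncomputable def baseMap (P : Type u) [CommRing P] [Algebra k P] {A B : Art k} (φ : A ⟶ B) :
    A ⊗[k] P →ₐ[k] B ⊗[k] P :=
  Algebra.TensorProduct.map φ.alg (AlgHom.id k P)

/-- The restriction `P_A → P` to the closed point. -/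
noncomputable def fibreMap (P : Type u) [CommRing P] [Algebra k P] (A : Art k) :
    A ⊗[k] P →ₐ[k] P :=
  Algebra.TensorProduct.lift ((Algebra.ofId k P).comp A.aug) (AlgHom.id k P)
    (fun _ _ => Commute.all _ _)

/-- The ideal `I` of `P` is `G`-stable. -/
def Ideal.IsGStable (G : Type v) {P : Type u} [Group G] [CommRing P] [MulSemiringAction G P]
    (I : Ideal P) : Prop := ∀ (g : G), ∀ x ∈ I, g • x ∈ I

/-- The ideals `Z` of `P_A` defining a `G`-stable closed subscheme of `Spec A × Spec P`, flat over
`Spec A`, whose fibre over the closed point is the subscheme defined by `I`. -/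
structure IsDeformation (G : Type v) [Group G] [MulSemiringAction G P]
    [SMulCommClass G k P] (I : Ideal P) (A : Art k) (Z : Ideal (A ⊗[k] P)) : Prop where
  stable : ∀ (g : G), ∀ x ∈ Z, actOn A g x ∈ Z
  flat : Module.Flat A ((A ⊗[k] P) ⧸ Z)
  fibre : Z.map (fibreMap P A) = I

theorem fibreMap_comp_baseMap {A B : Art k} (φ : A ⟶ B) :
    (fibreMap P B).comp (baseMap P φ) = fibreMap P A := by
  ext x
  · simp [fibreMap, baseMap, ← Art.aug_comp φ]
  · simp [fibreMap, baseMap]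

theorem actOn_baseMap {A B : Art k} (φ : A ⟶ B) (g : G) (x : A ⊗[k] P) :
    actOn B g (baseMap P φ x) = baseMap P φ (actOn A g x) := by
  induction x with
  | zero => simp
  | tmul a p => simp [actOn, baseMap]
  | add x y hx hy => simp [hx, hy]

theorem flat_map {A B : Art k} (φ : A ⟶ B) (Z : Ideal (A ⊗[k] P))
    (h : Module.Flat A ((A ⊗[k] P) ⧸ Z)) :
    Module.Flat B ((B ⊗[k] P) ⧸ Z.map (baseMap P φ)) := by
  let _ : Algebra A B := φ.alg.toRingHom.toAlgebra
  have : IsScalarTower k A B := IsScalarTower.of_algebraMap_eq' φ.alg.comp_algebraMap.symm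
  let e : B ⊗[A] (A ⊗[k] P) ≃ₐ[B] B ⊗[k] P := Algebra.TensorProduct.cancelBaseChange k A B B P
  let e₁ := Algebra.TensorProduct.tensorQuotientEquiv (R := A) (T := A ⊗[k] P) B B Z
  have key : (Z.map (Algebra.TensorProduct.includeRight (R := A) (A := B))).map
      (e : B ⊗[A] (A ⊗[k] P) →+* B ⊗[k] P) = Z.map (baseMap P φ) := by
    change (Z.map (Algebra.TensorProduct.includeRight (R := A) (A := B) :
      A ⊗[k] P →ₐ[A] B ⊗[A] (A ⊗[k] P)).toRingHom).map
        (e : B ⊗[A] (A ⊗[k] P) →+* B ⊗[k] P) = Z.map (baseMap P φ).toRingHom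
    rw [Ideal.map_map]
    have hr : ((e : B ⊗[A] (A ⊗[k] P) →+* B ⊗[k] P).comp
        (Algebra.TensorProduct.includeRight (R := A) (A := B) :
          A ⊗[k] P →ₐ[A] B ⊗[A] (A ⊗[k] P)).toRingHom) = (baseMap P φ).toRingHom := by
      ext x
      · simp only [e, baseMap, RingHom.coe_comp, Function.comp_apply]
        simp [Algebra.smul_def, RingHom.algebraMap_toAlgebra]
      · simp only [e, baseMap, RingHom.coe_comp, Function.comp_apply]
        simp
    exact congrArg (fun f => Z.map f) hr
  let e₂ := Ideal.quotientEquivAlg _ _ e key.symm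
  exact Module.Flat.of_linearEquiv (e₁.trans e₂).symm.toLinearEquiv

theorem IsDeformation.map {I : Ideal P} {A B : Art k} (φ : A ⟶ B) {Z : Ideal (A ⊗[k] P)}
    (h : IsDeformation G I A Z) : IsDeformation G I B (Z.map (baseMap P φ)) where
  stable g := by
    change Z.map (baseMap P φ) ≤ (Z.map (baseMap P φ)).comap (actOn B g)
    rw [Ideal.map_le_iff_le_comap]
    intro x hx
    change actOn B g (baseMap P φ x) ∈ Z.map (baseMap P φ)
    rw [actOn_baseMap]
    exact Ideal.mem_map_of_mem _ (h.stable g x hx)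
  flat := flat_map φ Z h.flat
  fibre := by
    rw [← h.fibre, ← fibreMap_comp_baseMap φ, Ideal.map_mapₐ]

/-- The functor of infinitesimal `G`-stable embedded deformations of `X = Spec (P / I)` in
`W = Spec P`. -/
noncomputable def deformationFunctor (k : Type u) (G : Type v) {P : Type u} [Field k] [Group G]
    [CommRing P] [Algebra k P] [MulSemiringAction G P] [SMulCommClass G k P] (I : Ideal P) :
    Art k ⥤ Type u where
  obj A := {Z : Ideal (A ⊗[k] P) // IsDeformation G I A Z}
  map φ := ↾fun Z => ⟨Z.1.map (baseMap P φ), Z.2.map φ⟩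
  map_id A := by
    refine ConcreteCategory.hom_ext _ _ fun Z => Subtype.ext ?_
    have : (baseMap P (𝟙 A) : A ⊗[k] P →ₐ[k] A ⊗[k] P) = AlgHom.id k _ := by
      simp [baseMap]
    change Z.1.map (baseMap P (𝟙 A)) = Z.1
    rw [this]
    exact Ideal.map_id _
  map_comp f g := by
    refine ConcreteCategory.hom_ext _ _ fun Z => Subtype.ext ?_
    have : baseMap P (f ≫ g) = (baseMap P g).comp (baseMap P f) := by
      ext <;> simp [baseMap]
    change Z.1.map (baseMap P (f ≫ g)) = (Z.1.map (baseMap P f)).map (baseMap P g)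
    rw [this, Ideal.map_mapₐ]

end setup

section presentations

variable {k : Type u} {G : Type v} {P : Type u} [Field k] [Group G]
  [AffineAlgebraicGroup k G] [CommRing P] [Algebra k P] [MulSemiringAction G P]
  [SMulCommClass G k P] [IsAffineGScheme k G P]

/-- `P` as a `(P, G)`-module. -/
def regularObj (k : Type u) (G : Type v) (P : Type u) [Field k] [Group G]
    [AffineAlgebraicGroup k G] [CommRing P] [Algebra k P] [MulSemiringAction G P]
    [SMulCommClass G k P] [IsAffineGScheme k G P] : EqMod k G P where
  carrier := P
  ρ := algebraRep k G P
  ρ_smul g p x := smul_mul' g p x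
  rational := IsAffineGScheme.rational

/-- A `G`-stable ideal `I` as a `(P, G)`-module. -/
def idealObj (k : Type u) {G : Type v} {P : Type u} [Field k] [Group G]
    [AffineAlgebraicGroup k G] [CommRing P] [Algebra k P] [MulSemiringAction G P]
    [SMulCommClass G k P] [IsAffineGScheme k G P] (I : Ideal P) (hI : I.IsGStable G) :
    EqMod k G P := (regularObj k G P).ofSub I hI

/-- The quotient `P / I` by a `G`-stable ideal as a `(P, G)`-module. -/
def quotObj (k : Type u) {G : Type v} {P : Type u} [Field k] [Group G]
    [AffineAlgebraicGroup k G] [CommRing P] [Algebra k P] [MulSemiringAction G P]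
    [SMulCommClass G k P] [IsAffineGScheme k G P] (I : Ideal P) (hI : I.IsGStable G) :
    EqMod k G P := (regularObj k G P).ofQuot I hI

/-- The free `(P, G)`-module `P ⊗ N` on a rational `G`-module `N`, with diagonal action. -/
noncomputable def freeObj (P : Type u) [CommRing P] [Algebra k P] [MulSemiringAction G P]
    [SMulCommClass G k P] [IsAffineGScheme k G P] {N : Type u} [AddCommGroup N] [Module k N]
    (σ : Representation k G N) (hσ : σ.IsRational) : EqMod k G P where
  carrier := P ⊗[k] N
  ρ := (algebraRep k G P).tprod σ
  ρ_smul g p x := by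
    induction x with
    | zero => simp
    | tmul q n => simp [TensorProduct.smul_tmul', algebraRep]
    | add x y hx hy => rw [smul_add, map_add, map_add, hx, hy, smul_add]
  rational := IsAffineGScheme.rational.tprod hσ

/-- The multiplicity spaces `Hom^G(M, P / I)` of all irreducible rational `G`-modules `M` are
finite-dimensional. -/
def HasFiniteMultiplicities (k : Type u) {G : Type v} {P : Type u} [Field k] [Group G]
    [AffineAlgebraicGroup k G] [CommRing P] [Algebra k P] [MulSemiringAction G P]
    [SMulCommClass G k P] [IsAffineGScheme k G P] (I : Ideal P) (hI : I.IsGStable G) : Prop :=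
  ∀ (M : Type u) [AddCommGroup M] [Module k M] [Module.Finite k M] (ρ : Representation k G M),
    ρ.IsRational → ρ.IsIrreducible → Module.Finite k (ρ.IntertwiningMap (quotObj k I hI).ρ)

/-- A `G`-equivariant presentation `P ⊗ N₂ → P ⊗ N₁ → P → P / I → 0` of `P / I`, with `N₁` and `N₂`
finite-dimensional rational `G`-modules; the map `P ⊗ N₁ → P` is recorded as a surjection onto `I`. -/
structure EqPresentation (k : Type u) {G : Type v} {P : Type u} [Field k] [Group G]
    [AffineAlgebraicGroup k G] [CommRing P] [Algebra k P] [MulSemiringAction G P]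
    [SMulCommClass G k P] [IsAffineGScheme k G P] (I : Ideal P) (hI : I.IsGStable G) where
  N₁ : Type u
  N₂ : Type u
  [addCommGroup₁ : AddCommGroup N₁]
  [addCommGroup₂ : AddCommGroup N₂]
  [module₁ : Module k N₁]
  [module₂ : Module k N₂]
  [finite₁ : Module.Finite k N₁]
  [finite₂ : Module.Finite k N₂]
  σ₁ : Representation k G N₁
  σ₂ : Representation k G N₂
  rational₁ : σ₁.IsRational
  rational₂ : σ₂.IsRational
  u₀ : freeObj P σ₁ rational₁ ⟶ idealObj k I hI
  v₀ : freeObj P σ₂ rational₂ ⟶ freeObj P σ₁ rational₁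
  surjective : Function.Surjective u₀.toLin
  exact : Function.Exact v₀.toLin u₀.toLin

namespace EqPresentation

attribute [instance] addCommGroup₁ addCommGroup₂ module₁ module₂ finite₁ finite₂

variable {I : Ideal P} {hI : I.IsGStable G} (R₀ : EqPresentation k I hI)

/-- The action of `g` on `P_A ⊗ N`. -/
noncomputable def freeAct (P : Type u) [CommRing P] [Algebra k P] [MulSemiringAction G P]
    [SMulCommClass G k P] (A : Art k) {N : Type u} [AddCommGroup N] [Module k N]
    (σ : Representation k G N) (g : G) : (A ⊗[k] P) ⊗[k] N →ₗ[k] (A ⊗[k] P) ⊗[k] N :=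
  TensorProduct.map ((actOn A g).toLinearMap.restrictScalars k) (σ g)

/-- `P_A ⊗ N₂ → P_A ⊗ N₁ → P_A → P_A / Z → 0` is an exact sequence of `(P_A, G)`-modules which
restricts over the closed point of `Spec A` to the given presentation of `P / I`. -/
structure IsFamilyPresentation (A : Art k) (Z : Ideal (A ⊗[k] P))
    (f : (A ⊗[k] P) ⊗[k] R₀.N₁ →ₗ[A ⊗[k] P] A ⊗[k] P)
    (h : (A ⊗[k] P) ⊗[k] R₀.N₂ →ₗ[A ⊗[k] P] (A ⊗[k] P) ⊗[k] R₀.N₁) : Prop where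
  equivariant₁ : ∀ (g : G) x, f (freeAct P A R₀.σ₁ g x) = actOn A g (f x)
  equivariant₂ : ∀ (g : G) x, h (freeAct P A R₀.σ₂ g x) = freeAct P A R₀.σ₁ g (h x)
  range_eq : LinearMap.range f = Z
  exact : Function.Exact h f
  fibre₁ : ∀ x, fibreMap P A (f x) =
    I.subtype (R₀.u₀.toLin ((fibreMap P A).toLinearMap.rTensor R₀.N₁ x))
  fibre₂ : ∀ x, (fibreMap P A).toLinearMap.rTensor R₀.N₁ (h x) =
    R₀.v₀.toLin ((fibreMap P A).toLinearMap.rTensor R₀.N₂ x)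

/-- The equivariant maps `P_{A'} ⊗ N₂ → P_{A'} ⊗ N₁ → P_{A'}` (whose composition need not vanish)
lift given maps over `A` along `A' → A`. -/
structure IsLift {A' A : Art k} (φ : A' ⟶ A)
    (f : (A ⊗[k] P) ⊗[k] R₀.N₁ →ₗ[A ⊗[k] P] A ⊗[k] P)
    (h : (A ⊗[k] P) ⊗[k] R₀.N₂ →ₗ[A ⊗[k] P] (A ⊗[k] P) ⊗[k] R₀.N₁)
    (f' : (A' ⊗[k] P) ⊗[k] R₀.N₁ →ₗ[A' ⊗[k] P] A' ⊗[k] P)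
    (h' : (A' ⊗[k] P) ⊗[k] R₀.N₂ →ₗ[A' ⊗[k] P] (A' ⊗[k] P) ⊗[k] R₀.N₁) : Prop where
  equivariant₁ : ∀ (g : G) x, f' (freeAct P A' R₀.σ₁ g x) = actOn A' g (f' x)
  equivariant₂ : ∀ (g : G) x, h' (freeAct P A' R₀.σ₂ g x) = freeAct P A' R₀.σ₁ g (h' x)
  lift₁ : ∀ x, baseMap P φ (f' x) = f ((baseMap P φ).toLinearMap.rTensor R₀.N₁ x)
  lift₂ : ∀ x, (baseMap P φ).toLinearMap.rTensor R₀.N₁ (h' x) =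
    h ((baseMap P φ).toLinearMap.rTensor R₀.N₂ x)

/-- The module of relations `K = ker (P ⊗ N₁ → I)`. -/
noncomputable def relObj : EqMod k G P := EqMod.ker R₀.u₀

/-- The relation in `K` defined by an element of `N₂`. -/
noncomputable def rel (n : R₀.N₂) : R₀.relObj :=
  ⟨R₀.v₀.toLin ((1 : P) ⊗ₜ[k] n), (R₀.exact _).2 ⟨_, rfl⟩⟩

/-- Evaluation of morphisms `K → P / I` at the relation defined by `n ∈ N₂`. -/
noncomputable def evalRel (n : R₀.N₂) : (R₀.relObj ⟶ quotObj k I hI) →ₗ[k] P ⧸ I where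
  toFun κ := κ.toLin (R₀.rel n)
  map_add' _ _ := rfl
  map_smul' _ _ := rfl

/-- The connecting map `Hom_P^G(K, P / I) → Ext^{1,G}_P(I, P / I)` of the short exact sequence
`0 → K → P ⊗ N₁ → I → 0`. -/
noncomputable def connecting : (R₀.relObj ⟶ quotObj k I hI) →ₗ[k]
    Abelian.Ext (idealObj k I hI) (quotObj k I hI) 1 :=
  EqMod.connecting R₀.u₀ R₀.surjective _

/-- `η ∈ J ⊗ Hom_P^G(K, P / I)` is the obstruction cocycle of a lift `(f', h')` of a presentation
along `0 → J → A' → A → 0`: the composition `f' ∘ h'` takes values in `J ⊗ P ⊆ P_{A'}`, and its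
reduction `N₂ → J ⊗ P / I` is obtained from `η` by evaluating at the relations defined by the elements
of `N₂`. -/
def IsObstructionCocycle {A' A : Art k} (φ : A' ⟶ A)
    (f' : (A' ⊗[k] P) ⊗[k] R₀.N₁ →ₗ[A' ⊗[k] P] A' ⊗[k] P)
    (h' : (A' ⊗[k] P) ⊗[k] R₀.N₂ →ₗ[A' ⊗[k] P] (A' ⊗[k] P) ⊗[k] R₀.N₁)
    (η : Art.kernel φ ⊗[k] (R₀.relObj ⟶ quotObj k I hI)) : Prop :=
  ∀ n : R₀.N₂, ∃ y : Art.kernel φ ⊗[k] P,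
    (Art.kernel φ).subtype.rTensor P y = f' (h' (1 ⊗ₜ[k] n)) ∧
    (Ideal.Quotient.mkₐ k I).toLinearMap.lTensor (Art.kernel φ) y =
      (R₀.evalRel n).lTensor (Art.kernel φ) η

/-- `e ∈ J ⊗ Ext^{1,G}_P(I, P / I)` is the class obtained from the deformation `Z` over `A` by lifting
presentations: `P_A / Z` has equivariant presentations `(f, h)` restricting to the given presentation
of `P / I`; every such presentation has equivariant lifts `(f', h')` to `A'`; every such lift has a
unique obstruction cocycle, and the connecting map sends it to `e`. -/
structure IsObstructionClass {A' A : Art k} (φ : A' ⟶ A) (Z : Ideal (A ⊗[k] P))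
    (e : Art.kernel φ ⊗[k] Abelian.Ext (idealObj k I hI) (quotObj k I hI) 1) : Prop where
  exists_presentation : ∃ f h, R₀.IsFamilyPresentation A Z f h
  exists_lift : ∀ f h, R₀.IsFamilyPresentation A Z f h → ∃ f' h', R₀.IsLift φ f h f' h'
  class_eq : ∀ f h f' h', R₀.IsFamilyPresentation A Z f h → R₀.IsLift φ f h f' h' →
    ∃ η, (∀ η', R₀.IsObstructionCocycle φ f' h' η' ↔ η' = η) ∧
      R₀.connecting.lTensor (Art.kernel φ) η = e

end EqPresentation

end presentations

/-! ### Rational modules of a reductive group: equivariant lifting and finiteness of Hom. -/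

section reps

variable {k : Type u} {G : Type v} [Field k] [Group G] [AffineAlgebraicGroup k G]

/-! The obstruction is built without choosing a presentation. Let `0 → J → A' → A → 0` be small and
`Z ∈ D(A)`. Let `Z̃` be the preimage of `Z` in `P_{A'}` (`thickObj`), a `(P, G)`-module through `P →
P_{A'}`. Reduction modulo `𝔪_{A'}` maps `Z̃` onto `I`. Flatness gives `Z ∩ 𝔪_A P_A = 𝔪_A Z`, so the
kernel of `Z̃ → I` is `J ⊗ P + 𝔪_{A'} Z̃`. There is exactly one map from this kernel to `J ⊗ P/I`
that is the projection on `J ⊗ P` and zero on `𝔪_{A'} Z̃`; it is `P`-linear and equivariant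
(`thickClass`). The obstruction is its image under the connecting map of `0 → ker → Z̃ → I → 0`.

That this map is well defined is seen through trivializations. By flatness `P_A/Z` is isomorphic to
`A ⊗ P/I` as an `A`-module, and the projection `P_A → A ⊗ P/I` lifts to an `A'`-linear `q' : P_{A'}
→ A' ⊗ P/I`. The map `q'` sends `Z̃` into `J ⊗ P/I`, is the projection on `J ⊗ P`, and kills `𝔪_{A'}
Z̃` because `𝔪_{A'} J = 0`.

The obstruction vanishes iff the canonical map extends to a morphism `Θ : Z̃ → J ⊗ P/I`
(`obstruction_eq_zero_iff`). A lift `Z'` of `Z` satisfies `Z̃ = Z' + J ⊗ P`, and a trivialization of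
`Z'` restricts to such a `Θ`; conversely `ker Θ` is a lift. Compatibility with morphisms of small
extensions holds because `Z̃`, the kernel and the canonical map are all functorial
(`obstruction_natural`).

For the explicit recipe, lifts `u'`, `v'` define a morphism `P ⊗ N₁ → Z̃` over `I`, hence `ker u₀ →
ker (Z̃ → I)`. Pulling the canonical map back along it gives `η` (`quotEval_cocycle`), and
naturality of the connecting map gives the class, which therefore depends on no choice.

Reductivity enters through `IsReductiveGroup.exists_lift`. It yields equivariant presentations and
lifts, and projectivity of `P ⊗ N`. By projectivity `Ext¹(I, P/I)` is a quotient of `Hom(ker u₀,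
P/I)`, which embeds in `Hom^G(N₂, P/I)` and so is finite-dimensional. -/

theorem Representation.IsRational.subrep {M : Type w} [AddCommGroup M] [Module k M]
    {ρ : Representation k G M} (h : ρ.IsRational) (S : Subrepresentation ρ) :
    S.toRepresentation.IsRational :=
  h.of_injective S.toSubmodule.subtype S.toSubmodule.injective_subtype (fun _ _ => rfl)

/-- Finitely many vectors of a rational module lie in a finite-dimensional subrepresentation. -/
theorem Representation.IsRational.exists_finite_subrep {M : Type w} [AddCommGroup M] [Module k M]
    {ρ : Representation k G M} (h : ρ.IsRational) {s : Set M} (hs : s.Finite) :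
    ∃ W : Subrepresentation ρ, Module.Finite k W.toSubmodule ∧ s ⊆ W := by
  let T : Set M := ⋃ g : G, (ρ g) '' s
  refine ⟨⟨Submodule.span k T, fun g x hx => ?_⟩, ?_, fun x hx => ?_⟩
  · have : Submodule.span k T ≤ (Submodule.span k T).comap (ρ g) := by
      rw [Submodule.span_le]
      intro y hy
      obtain ⟨g', x, hx, rfl⟩ := Set.mem_iUnion.1 hy
      refine Submodule.subset_span (Set.mem_iUnion.2 ⟨g * g', x, hx, ?_⟩)
      simp
    exact this hx
  · choose n f y _ hy using h
    let S : Set M := ⋃ x ∈ s, Set.range (y x)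
    have hS : S.Finite := hs.biUnion fun x _ => Set.finite_range _
    have : FiniteDimensional k (Submodule.span k S) := FiniteDimensional.span_of_finite k hS
    refine Submodule.finiteDimensional_of_le (S₂ := Submodule.span k S) ?_
    rw [Submodule.span_le]
    intro z hz
    obtain ⟨g, x, hx, rfl⟩ := Set.mem_iUnion.1 hz
    rw [hy]
    exact Submodule.sum_mem _ fun i _ => Submodule.smul_mem _ _
      (Submodule.subset_span (Set.mem_biUnion hx ⟨i, rfl⟩))
  · exact Submodule.subset_span (Set.mem_iUnion.2 ⟨1, x, hx, by simp⟩)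

/-- Equivariant maps from a finite-dimensional rational module of a reductive group lift along
equivariant maps of rational modules. -/
theorem IsReductiveGroup.exists_lift [IsReductiveGroup k G] {N M L : Type u}
    [AddCommGroup N] [Module k N] [Module.Finite k N] [AddCommGroup M] [Module k M]
    [AddCommGroup L] [Module k L] {σ : Representation k G N} {ρ : Representation k G M}
    {τ : Representation k G L} (hσ : σ.IsRational) (hρ : ρ.IsRational)
    (f : M →ₗ[k] L) (hf : ∀ a x, f (ρ a x) = τ a (f x)) (S : Subrepresentation ρ)
    (g : N →ₗ[k] L) (hg : ∀ a x, g (σ a x) = τ a (g x)) (hS : ∀ n, ∃ x ∈ S, f x = g n) :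
    ∃ g' : N →ₗ[k] M, (∀ a x, g' (σ a x) = ρ a (g' x)) ∧ (∀ n, g' n ∈ S) ∧
      ∀ n, f (g' n) = g n := by
  let b := Module.finBasis k N
  choose x hxS hx using hS
  obtain ⟨W₀, hW₀, hxW⟩ := hρ.exists_finite_subrep (Set.finite_range fun i => x (b i))
  let W : Subrepresentation ρ := W₀ ⊓ S
  have : Module.Finite k W.toSubmodule := Submodule.finiteDimensional_inf_left _ _
  let π := σ.prod W.toRepresentation
  have hπ : π.IsRational := hσ.prod (hρ.subrep W) (LinearMap.inl k N W.toSubmodule)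
    (LinearMap.inr k N W.toSubmodule) (by intros; simp [π]) (by intros; simp [π])
    (fun z => ⟨z.1, z.2, by simp⟩)
  have hss := IsReductiveGroup.semisimple _ π hπ
  -- The fibre product of `N` and `W` over `L` maps onto `N` with kernel `K`. Intersecting it with a
  -- complement `C` of `K` leaves a subspace `E` projecting bijectively to `N`, that is, the graph
  -- of the desired lift.
  let K : Subrepresentation π :=
    { toSubmodule := LinearMap.ker (LinearMap.fst k N W.toSubmodule) ⊓
        LinearMap.ker (f ∘ₗ W.toSubmodule.subtype ∘ₗ LinearMap.snd k N W.toSubmodule)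
      apply_mem_toSubmodule := by
        rintro a ⟨n, w⟩ ⟨h1, h2⟩
        simp only [SetLike.mem_coe, LinearMap.mem_ker, LinearMap.fst_apply, LinearMap.comp_apply,
          LinearMap.snd_apply, Submodule.subtype_apply] at h1 h2
        subst h1
        refine ⟨?_, ?_⟩
        · simp [π]
        · change f (ρ a w) = 0
          rw [hf, h2, map_zero] }
  obtain ⟨C, hC⟩ := hss.exists_isCompl K
  have hdisj : ∀ z, z ∈ K → z ∈ C → z = 0 := fun z hK hC' => by
    have : z ∈ K ⊓ C := ⟨hK, hC'⟩
    rw [hC.inf_eq_bot] at this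
    exact (Submodule.mem_bot k).1 this
  have hsup : ∀ z, ∃ a ∈ K, ∃ c ∈ C, a + c = z := fun z => by
    have : z ∈ (K ⊔ C).toSubmodule := by
      rw [hC.sup_eq_top]; exact Submodule.mem_top
    exact Submodule.mem_sup.1 this
  let E : Submodule k (N × W.toSubmodule) := C.toSubmodule ⊓
    LinearMap.ker (f ∘ₗ W.toSubmodule.subtype ∘ₗ LinearMap.snd k N W.toSubmodule -
      g ∘ₗ LinearMap.fst k N W.toSubmodule)
  have hE : ∀ z, z ∈ E ↔ z ∈ C ∧ f z.2 = g z.1 := fun z => by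
    simp only [E, Submodule.mem_inf, LinearMap.mem_ker, LinearMap.sub_apply, sub_eq_zero]
    rfl
  let e : E →ₗ[k] N := LinearMap.fst k N W.toSubmodule ∘ₗ E.subtype
  have he : Function.Bijective e := by
    constructor
    · rw [← LinearMap.ker_eq_bot, eq_bot_iff]
      rintro ⟨z, hz⟩ h0
      have h0 : z.1 = 0 := h0
      obtain ⟨h1, h2⟩ := (hE z).1 hz
      refine Subtype.ext (hdisj z ⟨h0, ?_⟩ h1)
      change f z.2 = 0
      rw [h2, h0, map_zero]
    · rw [← LinearMap.range_eq_top, eq_top_iff, ← b.span_eq, Submodule.span_le]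
      rintro _ ⟨i, rfl⟩
      obtain ⟨a, ha, c, hc, hac⟩ := hsup (b i, ⟨x (b i), hxW ⟨i, rfl⟩, hxS _⟩)
      have h1 : a.1 = 0 := ha.1
      have h2 : f a.2 = 0 := ha.2
      have h3 : c.1 = b i := by simpa [h1] using congrArg Prod.fst hac
      have h4 : f a.2 + f c.2 = f (x (b i)) := by
        rw [← map_add]
        exact congrArg (fun z => f (Prod.snd z).1) hac
      refine ⟨⟨c, (hE c).2 ⟨hc, ?_⟩⟩, h3⟩
      rw [h3, ← hx, ← h4, h2, zero_add]
  let e' := LinearEquiv.ofBijective e he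
  have hfst : ∀ n, (e'.symm n).1.1 = n := fun n => e'.apply_symm_apply n
  refine ⟨W.toSubmodule.subtype ∘ₗ LinearMap.snd k N W.toSubmodule ∘ₗ E.subtype ∘ₗ
    e'.symm.toLinearMap, fun a n => ?_, fun n => (e'.symm n).1.2.2.2, fun n => ?_⟩
  · have hmem : π a (e'.symm n).1 ∈ E := by
      obtain ⟨h1, h2⟩ := (hE _).1 (e'.symm n).2
      refine (hE _).2 ⟨C.apply_mem_toSubmodule a h1, ?_⟩
      change f (ρ a (e'.symm n).1.2) = g (σ a (e'.symm n).1.1)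
      rw [hf, hg, h2]
    have : e'.symm (σ a n) = ⟨_, hmem⟩ := by
      rw [LinearEquiv.symm_apply_eq]
      change σ a n = σ a (e'.symm n).1.1
      rw [hfst]
    change ((e'.symm (σ a n)).1.2 : M) = ρ a (e'.symm n).1.2
    rw [this]
    rfl
  · have := ((hE _).1 (e'.symm n).2).2
    rw [hfst] at this
    exact this

/-- A finite-dimensional rational module of a reductive group has only finite-dimensional spaces of
homomorphisms to a module in which all multiplicities are finite. -/
theorem IsReductiveGroup.finite_intertwiningMap [IsReductiveGroup k G] {L : Type u}
    [AddCommGroup L] [Module k L] (τ : Representation k G L)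
    (hτ : ∀ (M : Type u) [AddCommGroup M] [Module k M] [Module.Finite k M]
      (ρ : Representation k G M), ρ.IsRational → ρ.IsIrreducible →
        Module.Finite k (ρ.IntertwiningMap τ)) (n : ℕ) :
    ∀ (N : Type u) [AddCommGroup N] [Module k N] [Module.Finite k N]
      (σ : Representation k G N), σ.IsRational → Module.finrank k N = n →
        Module.Finite k (σ.IntertwiningMap τ) := by
  induction n using Nat.strong_induction_on with
  | _ n ih =>
    intro N _ _ _ σ hσ hn
    by_cases hirr : σ.IsIrreducible
    · exact hτ N σ hσ hirr
    -- The zero module is not irreducible, so it needs its own case.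
    by_cases hN : Subsingleton N
    · have : Subsingleton (σ.IntertwiningMap τ) := ⟨fun f g => by
        apply Representation.IntertwiningMap.ext
        ext x
        rw [Subsingleton.elim x 0, map_zero, map_zero]⟩
      infer_instance
    have hnt : Nontrivial (Subrepresentation σ) := by
      rw [not_subsingleton_iff_nontrivial] at hN
      refine ⟨⊥, ⊤, fun h => bot_ne_top (α := Submodule k N) ?_⟩
      exact congrArg Subrepresentation.toSubmodule h
    have : ∃ S : Subrepresentation σ, S ≠ ⊥ ∧ S ≠ ⊤ := by
      by_contra! h
      exact hirr ⟨fun S => or_iff_not_imp_left.2 (h S)⟩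
    obtain ⟨S, hS, hS'⟩ := this
    have hss := IsReductiveGroup.semisimple _ σ hσ
    -- `N = S ⊕ C` with both summands proper, and a homomorphism is determined by its two
    -- restrictions.
    obtain ⟨C, hC⟩ := hss.exists_isCompl S
    have hlt : ∀ D : Subrepresentation σ, D ≠ ⊤ → Module.finrank k D.toSubmodule < n := by
      intro D hD
      rw [← hn]
      refine Submodule.finrank_lt fun h => hD (Subrepresentation.toSubmodule_injective h)
    have hC' : C ≠ ⊤ := by
      rintro rfl
      exact hS (by simpa using hC.inf_eq_bot)
    have i1 := ih _ (hlt S hS') S.toSubmodule S.toRepresentation (hσ.subrep S) rfl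
    have i2 := ih _ (hlt C hC') C.toSubmodule C.toRepresentation (hσ.subrep C) rfl
    let res : ∀ D : Subrepresentation σ,
        σ.IntertwiningMap τ →ₗ[k] D.toRepresentation.IntertwiningMap τ := fun D =>
      { toFun := fun f => ⟨f.toLinearMap ∘ₗ D.toSubmodule.subtype, fun g => by
          ext x
          exact Representation.IntertwiningMap.isIntertwining _ _ f g x.1⟩
        map_add' := fun f g => rfl
        map_smul' := fun c f => rfl }
    refine Module.Finite.of_injective ((res S).prod (res C)) ?_
    rw [← LinearMap.ker_eq_bot, eq_bot_iff]
    intro f hf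
    have h1 : res S f = 0 := congrArg Prod.fst hf
    have h2 : res C f = 0 := congrArg Prod.snd hf
    rw [Submodule.mem_bot]
    apply Representation.IntertwiningMap.ext
    ext x
    have hx : x ∈ (S ⊔ C).toSubmodule := by
      rw [hC.sup_eq_top]; exact Submodule.mem_top
    obtain ⟨a, ha, c, hc, rfl⟩ := Submodule.mem_sup.1 hx
    have h3 : f a = 0 := DFunLike.congr_fun h1 (⟨a, ha⟩ : S.toSubmodule)
    have h4 : f c = 0 := DFunLike.congr_fun h2 (⟨c, hc⟩ : C.toSubmodule)
    change f (a + c) = 0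
    rw [map_add, h3, h4, add_zero]

end reps

/-! ### Elements of `J ⊗ Hom(M, L)` as morphisms `M → J ⊗ L`; the connecting map. -/

namespace EqMod

variable {k : Type u} {G : Type v} {P : Type u} [Field k] [Group G]
  [AffineAlgebraicGroup k G] [CommRing P] [Algebra k P] [MulSemiringAction G P]
  [SMulCommClass G k P]

/-- Evaluation of morphisms at an element. -/
def evalAt {M : EqMod k G P} (L : EqMod k G P) (x : M) : (M ⟶ L) →ₗ[k] L where
  toFun f := f.toLin x
  map_add' _ _ := rfl
  map_smul' _ _ := rfl

theorem evalAt_apply {M L : EqMod k G P} (x : M) (f : M ⟶ L) : evalAt L x f = f.toLin x := rfl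

theorem evalAt_add {M L : EqMod k G P} (x y : M) :
    evalAt L (x + y) = evalAt L x + evalAt L y := by
  ext f
  exact map_add f.toLin x y

theorem evalAt_smul {M L : EqMod k G P} (p : P) (x : M) :
    evalAt L (p • x) = (Algebra.lsmul k k L p) ∘ₗ evalAt L x := by
  ext f
  exact map_smul f.toLin p x

theorem evalAt_ρ {M L : EqMod k G P} (g : G) (x : M) :
    evalAt L (M.ρ g x) = (L.ρ g) ∘ₗ evalAt L x := by
  ext f
  exact f.comm g x

theorem evalAt_comp {M N : EqMod k G P} (L : EqMod k G P) (f : M ⟶ N) (x : M) :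
    evalAt L x ∘ₗ Linear.leftComp k L f = evalAt L (f.toLin x) := rfl

section tensor

variable {J : Type u} [AddCommGroup J] [Module k J]

/-- Evaluation of elements of `J ⊗ Hom(M, L)`, viewed as morphisms from `M` to `J ⊗ L`. -/
noncomputable def tensorEval {M L : EqMod k G P} (Θ : J ⊗[k] (M ⟶ L)) (x : M) :
    J ⊗[k] L.carrier := (evalAt L x).lTensor J Θ

theorem tensorEval_add {M L : EqMod k G P} (Θ : J ⊗[k] (M ⟶ L)) (x y : M) :
    tensorEval Θ (x + y) = tensorEval Θ x + tensorEval Θ y := by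
  rw [tensorEval, evalAt_add, LinearMap.lTensor_add]; rfl

theorem tensorEval_smul {M L : EqMod k G P} (Θ : J ⊗[k] (M ⟶ L)) (p : P) (x : M) :
    tensorEval Θ (p • x) = (Algebra.lsmul k k L p).lTensor J (tensorEval Θ x) := by
  rw [tensorEval, evalAt_smul, LinearMap.lTensor_comp]; rfl

theorem tensorEval_ρ {M L : EqMod k G P} (Θ : J ⊗[k] (M ⟶ L)) (g : G) (x : M) :
    tensorEval Θ (M.ρ g x) = (L.ρ g).lTensor J (tensorEval Θ x) := by
  rw [tensorEval, evalAt_ρ, LinearMap.lTensor_comp]; rfl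

theorem tensorEval_zero {M L : EqMod k G P} (Θ : J ⊗[k] (M ⟶ L)) :
    tensorEval Θ 0 = 0 := by
  have := tensorEval_smul Θ 0 0
  rwa [zero_smul, map_zero, LinearMap.lTensor_zero] at this

/-- `tensorEval` as a linear map. -/
noncomputable def tensorEvalLin {M L : EqMod k G P} (Θ : J ⊗[k] (M ⟶ L)) :
    M.carrier →ₗ[k] J ⊗[k] L.carrier where
  toFun := tensorEval Θ
  map_add' := tensorEval_add Θ
  map_smul' c x := by
    rw [← algebraMap_smul P c x, tensorEval_smul]
    have : Algebra.lsmul k k L.carrier (algebraMap k P c) = c • LinearMap.id := by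
      ext x; simp
    rw [this, LinearMap.lTensor_smul]
    simp

theorem tensorEval_leftComp {M N L : EqMod k G P} (f : M ⟶ N) (Θ : J ⊗[k] (N ⟶ L)) (x : M) :
    tensorEval ((Linear.leftComp k L f).lTensor J Θ) x = tensorEval Θ (f.toLin x) := by
  rw [tensorEval, tensorEval, ← LinearMap.comp_apply, ← LinearMap.lTensor_comp, evalAt_comp]

theorem tensorEval_rTensor {M L : EqMod k G P} {J' : Type u} [AddCommGroup J'] [Module k J']
    (f : J →ₗ[k] J') (Θ : J ⊗[k] (M ⟶ L)) (x : M) :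
    tensorEval (f.rTensor _ Θ) x = f.rTensor _ (tensorEval Θ x) := by
  rw [tensorEval, tensorEval, ← LinearMap.comp_apply, ← LinearMap.comp_apply,
    LinearMap.lTensor_comp_rTensor, LinearMap.rTensor_comp_lTensor]

theorem _root_.TensorProduct.equivFinsuppOfBasisLeft_lTensor {ι V W : Type*} [AddCommGroup V]
    [Module k V] [AddCommGroup W] [Module k W] [DecidableEq ι] (b : Module.Basis ι k J)
    (f : V →ₗ[k] W) (t : J ⊗[k] V) (i : ι) :
    TensorProduct.equivFinsuppOfBasisLeft b (f.lTensor J t) i =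
      f (TensorProduct.equivFinsuppOfBasisLeft b t i) := by
  induction t with
  | zero => simp
  | tmul x y => simp
  | add x y hx hy => simp [hx, hy]

/-- In a basis of `J`, the coordinates of an evaluation are the evaluations of the coordinates,
which are morphisms `M → L`. No finiteness of `J` is needed here. -/
theorem tensorEval_injective {M L : EqMod k G P} {Θ Θ' : J ⊗[k] (M ⟶ L)}
    (h : ∀ x, tensorEval Θ x = tensorEval Θ' x) : Θ = Θ' := by
  classical
  let b := Module.Basis.ofVectorSpace k J
  apply (TensorProduct.equivFinsuppOfBasisLeft b).injective
  refine Finsupp.ext fun i => hom_ext fun x => ?_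
  have := congrArg (fun t => TensorProduct.equivFinsuppOfBasisLeft b t i) (h x)
  simpa only [tensorEval, TensorProduct.equivFinsuppOfBasisLeft_lTensor, evalAt_apply] using this

/-- If `J` is finite-dimensional, every equivariant `P`-linear map `M → J ⊗ L` comes from
`J ⊗ Hom(M, L)`. -/
theorem exists_tensorEval_eq [Module.Finite k J] {M L : EqMod k G P}
    (g : M.carrier →ₗ[k] J ⊗[k] L.carrier)
    (hP : ∀ (p : P) x, g (p • x) = (Algebra.lsmul k k L p).lTensor J (g x))
    (hG : ∀ a x, g (M.ρ a x) = (L.ρ a).lTensor J (g x)) :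
    ∃ Θ : J ⊗[k] (M ⟶ L), ∀ x, tensorEval Θ x = g x := by
  classical
  let b := Module.finBasis k J
  let e := TensorProduct.equivFinsuppOfBasisLeft (N := L.carrier) b
  -- The coordinates of `g` in a basis of `J` are morphisms `M → L`; finiteness of the basis allows
  -- them to be summed up.
  let h : Fin (Module.finrank k J) → (M ⟶ L) := fun i => mkHom
    { toFun := fun x => e (g x) i
      map_add' := fun x y => by simp
      map_smul' := fun p x => by
        simp only [e, hP, TensorProduct.equivFinsuppOfBasisLeft_lTensor]; rfl }
    (fun a x => by
      change e (g (M.ρ a x)) i = L.ρ a (e (g x) i)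
      simp only [e, hG, TensorProduct.equivFinsuppOfBasisLeft_lTensor])
  refine ⟨∑ i, b i ⊗ₜ h i, fun x => ?_⟩
  rw [← e.symm_apply_apply (g x), TensorProduct.equivFinsuppOfBasisLeft_symm_apply,
    Finsupp.sum_fintype _ _ (by simp), tensorEval, map_sum]
  rfl

end tensor

section connecting

variable {M N : EqMod k G P} {f : M ⟶ N}

/-- The contravariant long exact sequence, with `Ext⁰` identified with `Hom`. -/
theorem connecting_eq_zero_iff (hf : Function.Surjective f.toLin) {L : EqMod k G P}
    (κ : ker f ⟶ L) : connecting f hf L κ = 0 ↔ ∃ ψ : M ⟶ L, kerι f ≫ ψ = κ := by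
  constructor
  · intro h
    obtain ⟨x, hx⟩ := Abelian.Ext.contravariant_sequence_exact₁ (shortExact_ker f hf) L
      (Abelian.Ext.mk₀ κ) (add_zero 1) h
    obtain ⟨ψ, rfl⟩ := (Abelian.Ext.mk₀_bijective _ _).2 x
    refine ⟨ψ, (Abelian.Ext.mk₀_bijective _ _).1 ?_⟩
    rw [← hx, Abelian.Ext.mk₀_comp_mk₀]
  · rintro ⟨ψ, rfl⟩
    change (shortExact_ker f hf).extClass.comp (Abelian.Ext.mk₀ (kerι f ≫ ψ)) (add_zero 1) = 0
    rw [← Abelian.Ext.mk₀_comp_mk₀]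
    exact (shortExact_ker f hf).extClass_comp_assoc _

theorem connecting_exact (hf : Function.Surjective f.toLin) (L : EqMod k G P) :
    Function.Exact (Linear.leftComp k L (kerι f)) (connecting f hf L) :=
  fun κ => connecting_eq_zero_iff hf κ

/-- The next term of the long exact sequence is `Ext¹(M, L)`, which is zero. -/
theorem connecting_surjective (hf : Function.Surjective f.toLin) (L : EqMod k G P)
    [Projective M] : Function.Surjective (connecting f hf L) := fun x => by
  obtain ⟨y, hy⟩ := Abelian.Ext.contravariant_sequence_exact₃ (shortExact_ker f hf) L x
    (Abelian.Ext.eq_zero_of_projective _) (add_zero 1)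
  obtain ⟨κ, rfl⟩ := (Abelian.Ext.mk₀_bijective _ _).2 y
  exact ⟨κ, hy⟩

/-- The map on kernels induced by a morphism over `N`. -/
def kerMap {M' : EqMod k G P} {f' : M' ⟶ N} (F : M ⟶ M') (h : F ≫ f' = f) : ker f ⟶ ker f' :=
  (kerIsLimit f').lift (KernelFork.ofι (kerι f ≫ F) (by rw [Category.assoc, h, kerι_comp]))

/-- `F` is a morphism of extensions that is the identity on `N`, so it pushes one extension class to
the other. This serves twice: to compare two small extensions, and to compare `Z̃` with a
presentation. -/
theorem connecting_kerMap {M' : EqMod k G P} {f' : M' ⟶ N} (hf : Function.Surjective f.toLin)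
    (hf' : Function.Surjective f'.toLin) (F : M ⟶ M') (h : F ≫ f' = f) (L : EqMod k G P)
    (κ : ker f' ⟶ L) : connecting f hf L (kerMap F h ≫ κ) = connecting f' hf' L κ := by
  have := ShortComplex.ShortExact.extClass_naturality (shortExact_ker f hf)
    (shortExact_ker f' hf')
    { τ₁ := kerMap F h, τ₂ := F, τ₃ := 𝟙 N, comm₁₂ := rfl, comm₂₃ := by simp [h] }
  change (shortExact_ker f hf).extClass.comp (Abelian.Ext.mk₀ (kerMap F h ≫ κ)) (add_zero 1) =
    (shortExact_ker f' hf').extClass.comp (Abelian.Ext.mk₀ κ) (add_zero 1)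
  rw [← Abelian.Ext.mk₀_comp_mk₀, ← Abelian.Ext.comp_assoc (a₁₂ := 1) _ _ _ (add_zero 1)
    (add_zero 0) (by lia)]
  refine (congrArg (fun e => e.comp (Abelian.Ext.mk₀ κ) (add_zero 1)) this).trans ?_
  rw [Abelian.Ext.mk₀_id_comp]

end connecting

end EqMod

/-! ### Free `(P, G)`-modules, presentations, and finiteness of `Ext¹(I, P/I)`. -/

section free

open EqMod

variable {k : Type u} {G : Type v} {P : Type u} [Field k] [Group G]
  [AffineAlgebraicGroup k G] [CommRing P] [Algebra k P] [MulSemiringAction G P]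
  [SMulCommClass G k P] [IsAffineGScheme k G P]

/-- The morphism from the free object on `N` defined by an equivariant map from `N`. -/
noncomputable def freeHom {N : Type u} [AddCommGroup N] [Module k N] {σ : Representation k G N}
    (hσ : σ.IsRational) {M : EqMod k G P} (g : N →ₗ[k] M.carrier)
    (hg : ∀ a n, g (σ a n) = M.ρ a (g n)) : freeObj P σ hσ ⟶ M :=
  mkHom (M := freeObj P σ hσ) (g.liftBaseChange P) (fun a x => by
    have key : ∀ x : P ⊗[k] N, g.liftBaseChange P (((algebraRep k G P).tprod σ) a x) =
        M.ρ a (g.liftBaseChange P x) := fun x => by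
      induction x with
      | zero => simp
      | tmul p n =>
        simp only [Representation.tprod_apply, TensorProduct.map_tmul,
          LinearMap.liftBaseChange_tmul, hg, M.ρ_smul]
        rfl
      | add x y hx hy => rw [map_add, map_add, hx, hy, map_add, map_add]
    exact key x)

/-- Pure tensors in a free object. -/
def freeMk {N : Type u} [AddCommGroup N] [Module k N] {σ : Representation k G N}
    (hσ : σ.IsRational) (p : P) (n : N) : (freeObj P σ hσ).carrier := p ⊗ₜ[k] n

theorem freeHom_mk {N : Type u} [AddCommGroup N] [Module k N] {σ : Representation k G N}
    (hσ : σ.IsRational) {M : EqMod k G P} (g : N →ₗ[k] M.carrier)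
    (hg : ∀ a n, g (σ a n) = M.ρ a (g n)) (p : P) (n : N) :
    (freeHom hσ g hg).toLin (freeMk hσ p n) = p • g n :=
  LinearMap.liftBaseChange_tmul ..

theorem freeObj_ρ_mk {N : Type u} [AddCommGroup N] [Module k N] {σ : Representation k G N}
    (hσ : σ.IsRational) (a : G) (p : P) (n : N) :
    (freeObj P σ hσ).ρ a (freeMk hσ p n) = freeMk hσ (a • p) (σ a n) := by
  change ((algebraRep k G P).tprod σ) a (p ⊗ₜ n) = (a • p) ⊗ₜ σ a n
  simp [algebraRep]

/-- The inclusion of `N` in the free object on `N`. -/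
noncomputable def freeIncl {N : Type u} [AddCommGroup N] [Module k N] {σ : Representation k G N}
    (hσ : σ.IsRational) : N →ₗ[k] (freeObj P σ hσ).carrier := TensorProduct.mk k P N 1

theorem freeObj_span {N : Type u} [AddCommGroup N] [Module k N] {σ : Representation k G N}
    (hσ : σ.IsRational) :
    Submodule.span P (Set.range (freeMk hσ (1 : P))) = ⊤ := by
  rw [eq_top_iff]
  rintro (x : P ⊗[k] N) -
  induction x with
  | zero => exact Submodule.zero_mem _
  | tmul p n =>
    have : p ⊗ₜ[k] n = p • freeMk hσ (1 : P) n := by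
      change _ = p • ((1 : P) ⊗ₜ[k] n)
      rw [TensorProduct.smul_tmul', smul_eq_mul, mul_one]
    rw [this]
    exact Submodule.smul_mem _ _ (Submodule.subset_span ⟨n, rfl⟩)
  | add x y hx hy => exact Submodule.add_mem _ hx hy

theorem freeObj_hom_ext {N : Type u} [AddCommGroup N] [Module k N] {σ : Representation k G N}
    {hσ : σ.IsRational} {M : EqMod k G P} {f g : freeObj P σ hσ ⟶ M}
    (h : ∀ n : N, f.toLin (freeMk hσ 1 n) = g.toLin (freeMk hσ 1 n)) : f = g :=
  EqMod.Hom.ext (LinearMap.ext_on_range (freeObj_span hσ) h)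

/-- Morphisms out of `P ⊗ N` are equivariant maps out of `N`, and these lift along surjections by
reductivity. -/
instance freeObj_projective [IsReductiveGroup k G] {N : Type u} [AddCommGroup N] [Module k N]
    [Module.Finite k N] {σ : Representation k G N} (hσ : σ.IsRational) :
    Projective (freeObj P σ hσ) where
  factors {L M} f e he := by
    obtain ⟨g', h1, -, h2⟩ := IsReductiveGroup.exists_lift hσ L.rational
      (e.toLin.restrictScalars k) e.comm ⊤ (f.toLin.restrictScalars k ∘ₗ freeIncl hσ)
      (fun a n => by
        change f.toLin (freeMk hσ 1 (σ a n)) = M.ρ a (f.toLin (freeMk hσ 1 n))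
        rw [← f.comm, freeObj_ρ_mk, smul_one]) (fun n => by
        obtain ⟨x, hx⟩ := surjective_of_epi e (f.toLin (freeMk hσ 1 n))
        exact ⟨x, Submodule.mem_top, hx⟩)
    refine ⟨freeHom hσ g' h1, freeObj_hom_ext fun n => ?_⟩
    change e.toLin ((freeHom hσ g' h1).toLin _) = _
    rw [freeHom_mk, one_smul]
    exact h2 n

/-- A finitely generated `(P, G)`-module is a quotient of a free one of finite rank. -/
theorem EqMod.exists_free_surjective (M : EqMod k G P) [Module.Finite P M.carrier] :
    ∃ (N : Type u) (_ : AddCommGroup N) (_ : Module k N) (_ : Module.Finite k N)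
      (σ : Representation k G N) (hσ : σ.IsRational) (f : freeObj P σ hσ ⟶ M),
      Function.Surjective f.toLin := by
  obtain ⟨s, hs⟩ := Module.Finite.fg_top (R := P) (M := M.carrier)
  obtain ⟨W, hW, hsW⟩ := M.rational.exists_finite_subrep s.finite_toSet
  refine ⟨W.toSubmodule, inferInstance, inferInstance, hW, W.toRepresentation,
    M.rational.subrep W, freeHom _ W.toSubmodule.subtype (fun _ _ => rfl), ?_⟩
  rw [← LinearMap.range_eq_top, eq_top_iff, ← hs, Submodule.span_le]
  intro x hx
  exact ⟨freeMk _ (1 : P) (⟨x, hsW hx⟩ : W.toSubmodule),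
    (freeHom_mk _ _ _ _ _).trans (one_smul _ _)⟩

theorem exists_eqPresentation [IsNoetherianRing P] (I : Ideal P) (hI : I.IsGStable G) :
    Nonempty (EqPresentation k I hI) := by
  have : Module.Finite P (idealObj k I hI).carrier := inferInstanceAs (Module.Finite P I)
  obtain ⟨N₁, _, _, _, σ₁, h₁, u₀, hu₀⟩ := (idealObj k I hI).exists_free_surjective
  have : IsNoetherian P (freeObj P σ₁ h₁).carrier := inferInstanceAs (IsNoetherian P (P ⊗[k] N₁))
  have : Module.Finite P (EqMod.ker u₀).carrier :=
    inferInstanceAs (Module.Finite P (LinearMap.ker u₀.toLin))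
  obtain ⟨N₂, _, _, _, σ₂, h₂, w, hw⟩ := (EqMod.ker u₀).exists_free_surjective
  exact ⟨{ N₁ := N₁, N₂ := N₂, σ₁ := σ₁, σ₂ := σ₂, rational₁ := h₁, rational₂ := h₂, u₀ := u₀
           v₀ := w ≫ kerι u₀
           surjective := hu₀
           exact := fun x => ⟨fun hx => (hw ⟨x, hx⟩).imp fun y hy => congrArg Subtype.val hy, by
            rintro ⟨y, rfl⟩
            exact (w.toLin y).2⟩ }⟩

namespace EqPresentation

variable {I : Ideal P} {hI : I.IsGStable G} (R₀ : EqPresentation k I hI)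

/-- This makes a morphism out of `K` determined by its values on the relations coming from `N₂`; the
uniqueness of `η` and the finiteness of `Hom(K, P/I)` rest on it. -/
theorem span_rel : Submodule.span P (Set.range R₀.rel) = ⊤ := by
  let v : (freeObj P R₀.σ₂ R₀.rational₂).carrier →ₗ[P] R₀.relObj.carrier :=
    R₀.v₀.toLin.codRestrict (LinearMap.ker R₀.u₀.toLin) (fun y => (R₀.exact _).2 ⟨y, rfl⟩)
  have hv : Function.Surjective v := fun x => by
    obtain ⟨y, hy⟩ := (R₀.exact x.1).1 x.2
    exact ⟨y, Subtype.ext hy⟩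
  rw [← LinearMap.range_eq_top.2 hv, LinearMap.range_eq_map, ← freeObj_span,
    Submodule.map_span, ← Set.range_comp]
  rfl

/-- Evaluation at the generating relations embeds this space in `Hom^G(N₂, P/I)`. -/
theorem hom_finite [IsReductiveGroup k G] (hX : HasFiniteMultiplicities k I hI) :
    Module.Finite k (R₀.relObj ⟶ quotObj k I hI) := by
  have : Module.Finite k (R₀.σ₂.IntertwiningMap (quotObj k I hI).ρ) :=
    IsReductiveGroup.finite_intertwiningMap _ hX _ R₀.N₂ R₀.σ₂ R₀.rational₂ rfl
  let f : (R₀.relObj ⟶ quotObj k I hI) →ₗ[k] R₀.σ₂.IntertwiningMap (quotObj k I hI).ρ :=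
    { toFun := fun κ => ⟨{ toFun := fun n => κ.toLin (R₀.rel n)
                           map_add' := fun x y => by
                            rw [← map_add]
                            congr 1
                            apply Subtype.ext
                            change R₀.v₀.toLin ((1 : P) ⊗ₜ[k] (x + y)) = _
                            rw [TensorProduct.tmul_add]
                            exact map_add R₀.v₀.toLin _ _
                           map_smul' := fun c x => by
                            refine Eq.trans ?_ ((κ.toLin.restrictScalars k).map_smul c (R₀.rel x))
                            change κ.toLin _ = κ.toLin _
                            congr 1
                            apply Subtype.ext
                            change R₀.v₀.toLin ((1 : P) ⊗ₜ[k] (c • x)) = _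
                            rw [TensorProduct.tmul_smul]
                            exact (R₀.v₀.toLin.restrictScalars k).map_smul _ _ },
          fun g => by
            ext n
            change κ.toLin (R₀.rel (R₀.σ₂ g n)) = (quotObj k I hI).ρ g (κ.toLin (R₀.rel n))
            rw [← κ.comm]
            congr 1
            apply Subtype.ext
            refine Eq.trans ?_ (R₀.v₀.comm g (freeMk R₀.rational₂ 1 n))
            rw [freeObj_ρ_mk, smul_one]
            rfl⟩
      map_add' := fun _ _ => rfl
      map_smul' := fun _ _ => rfl }
  refine Module.Finite.of_injective f fun κ κ' h => EqMod.Hom.ext ?_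
  exact LinearMap.ext_on_range R₀.span_rel fun n => DFunLike.congr_fun h n

theorem ext_finite (R₀ : EqPresentation k I hI) [IsReductiveGroup k G] (hX : HasFiniteMultiplicities k I hI) :
    Module.Finite k (Abelian.Ext (idealObj k I hI) (quotObj k I hI) 1) :=
  have := R₀.hom_finite hX
  Module.Finite.of_surjective R₀.connecting (connecting_surjective R₀.surjective _)

end EqPresentation

end free

/-! ### Nakayama's lemma for nilpotent ideals, and intersections under flatness. -/

/-- Iterating the hypothesis gives `S ≤ N ⊔ 𝔞ⁿ S` for every `n`. Nilpotence replaces finite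
generation, which matters because `P` is usually not finite over `k`. -/
theorem Submodule.le_of_le_sup_smul_of_isNilpotent {R M : Type*} [CommRing R] [AddCommGroup M]
    [Module R M] {𝔞 : Ideal R} (h𝔞 : IsNilpotent 𝔞) {N S : Submodule R M}
    (h : S ≤ N ⊔ 𝔞 • S) : S ≤ N := by
  have key : ∀ n : ℕ, S ≤ N ⊔ 𝔞 ^ n • S := fun n => by
    induction n with
    | zero => simp
    | succ n ih =>
      refine ih.trans (sup_le le_sup_left ?_)
      refine (Submodule.smul_mono le_rfl h).trans ?_
      rw [Submodule.smul_sup, ← Submodule.mul_smul, ← pow_succ]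
      exact sup_le_sup_right Submodule.smul_le_right _
  obtain ⟨n, hn⟩ := h𝔞
  simpa [hn] using key n

/-- If `M / N` is flat, then `N ∩ 𝔞 M = 𝔞 N`. -/
theorem Module.Flat.mem_smul_of_mem {R M : Type*} [CommRing R] [AddCommGroup M] [Module R M]
    (N : Submodule R M) [Module.Flat R (M ⧸ N)] (𝔞 : Ideal R) {x : M} (hx : x ∈ N)
    (hx' : x ∈ 𝔞 • (⊤ : Submodule R M)) : x ∈ 𝔞 • N := by
  rw [← Submodule.span_univ, ← Set.range_id,
    Submodule.mem_ideal_smul_span_iff_exists_sum] at hx'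
  obtain ⟨s, hs, rfl⟩ := hx'
  have h0 : ∑ i : s.support, s i • N.mkQ i = 0 := by
    rw [Finset.sum_coe_sort s.support (fun i => s i • N.mkQ i)]
    simp only [← map_smul, ← map_sum]
    exact (Submodule.Quotient.mk_eq_zero N).2 hx
  -- The equational criterion expresses the classes in `M / N` through elements `y j` whose
  -- coefficients are annihilated by the relation. Subtracting lifts `z j` of the `y j` leaves the
  -- sum unchanged and moves each vector into `N`.
  obtain ⟨l, a, y, hy, ha⟩ := Module.Flat.isTrivialRelation_of_sum_smul_eq_zero h0
  choose z hz using fun j => N.mkQ_surjective (y j)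
  have hN : ∀ i : s.support, (i : M) - ∑ j, a i j • z j ∈ N := fun i => by
    have hi : N.mkQ (i : M) = ∑ j, a i j • y j := hy i
    rw [← Submodule.Quotient.mk_eq_zero, ← Submodule.mkQ_apply, map_sub, hi, sub_eq_zero, map_sum]
    simp [← hz]
  have : (s.sum fun i c => c • id i) = ∑ i : s.support, s i • ((i : M) - ∑ j, a i j • z j) := by
    simp only [smul_sub, Finset.sum_sub_distrib, Finset.smul_sum, smul_smul]
    rw [Finset.sum_comm]
    simp only [← Finset.sum_smul, ha, zero_smul, Finset.sum_const_zero, sub_zero]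
    exact (Finset.sum_coe_sort s.support (fun i => s i • i)).symm
  rw [this]
  exact Submodule.sum_mem _ fun i _ => Submodule.smul_mem_smul (hs i) (hN i)

/-! ### Reduction to the residue field and base change along small extensions. -/

namespace Art

variable {k : Type u} [Field k]

theorem isNilpotent_maximalIdeal (A : Art k) : IsNilpotent (IsLocalRing.maximalIdeal A) := by
  rw [← IsLocalRing.jacobson_eq_maximalIdeal (⊥ : Ideal A) bot_ne_top]
  exact IsArtinianRing.isNilpotent_jacobson_bot

theorem mem_maximalIdeal_iff {A : Art k} {a : A} :
    a ∈ IsLocalRing.maximalIdeal A ↔ A.aug a = 0 := by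
  have : RingHom.ker A.aug = IsLocalRing.maximalIdeal A :=
    IsLocalRing.eq_maximalIdeal (RingHom.ker_isMaximal_of_surjective A.aug
      (fun c => ⟨algebraMap k A c, by simp⟩))
  rw [← this, RingHom.mem_ker]

theorem sub_aug_mem {A : Art k} (a : A) :
    a - algebraMap k A (A.aug a) ∈ IsLocalRing.maximalIdeal A := by
  rw [mem_maximalIdeal_iff]
  simp

theorem aug_apply {A B : Art k} (φ : A ⟶ B) (a : A) : B.aug (φ.alg a) = A.aug a :=
  DFunLike.congr_fun (aug_comp φ) a

section fibre

variable (A : Art k) (L : Type u) [AddCommGroup L] [Module k L]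

/-- The reduction `A ⊗ L → L` modulo the maximal ideal. -/
noncomputable def fib : A ⊗[k] L →ₗ[k] L :=
  (TensorProduct.lid k L).toLinearMap ∘ₗ A.aug.toLinearMap.rTensor L

variable {L}

@[simp] theorem fib_tmul (a : A) (l : L) : A.fib L (a ⊗ₜ l) = A.aug a • l := by
  simp [fib]

variable {A}

theorem fib_smul (a : A) (x : A ⊗[k] L) : A.fib L (a • x) = A.aug a • A.fib L x := by
  induction x with
  | zero => simp
  | tmul b l => rw [TensorProduct.smul_tmul']; simp [mul_smul]
  | add x y hx hy => simp [hx, hy]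

theorem sub_fib_mem (x : A ⊗[k] L) :
    x - 1 ⊗ₜ A.fib L x ∈ IsLocalRing.maximalIdeal A • (⊤ : Submodule A (A ⊗[k] L)) := by
  induction x with
  | zero => simp
  | tmul b l =>
    have : b ⊗ₜ[k] l - 1 ⊗ₜ A.fib L (b ⊗ₜ[k] l) = (b - algebraMap k A (A.aug b)) •
        ((1 : A) ⊗ₜ[k] l) := by
      rw [TensorProduct.smul_tmul', sub_smul, TensorProduct.sub_tmul, fib_tmul,
        TensorProduct.tmul_smul, TensorProduct.smul_tmul', smul_eq_mul, mul_one,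
        algebraMap_smul]
    rw [this]
    exact Submodule.smul_mem_smul (sub_aug_mem b) Submodule.mem_top
  | add x y hx hy =>
    rw [map_add, TensorProduct.tmul_add, add_sub_add_comm]
    exact Submodule.add_mem _ hx hy

theorem fib_eq_zero_iff {x : A ⊗[k] L} :
    A.fib L x = 0 ↔ x ∈ IsLocalRing.maximalIdeal A • (⊤ : Submodule A (A ⊗[k] L)) := by
  constructor
  · intro h
    simpa [h] using sub_fib_mem x
  · intro h
    induction h using Submodule.smul_induction_on' with
    | smul a ha x hx => rw [fib_smul, mem_maximalIdeal_iff.1 ha, zero_smul]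
    | add x _ y _ hx hy => rw [map_add, hx, hy, add_zero]

theorem fibreMap_eq_fib {P : Type u} [CommRing P] [Algebra k P] (x : A ⊗[k] P) :
    fibreMap P A x = A.fib P x := by
  induction x with
  | zero => simp
  | tmul a p => simp [fibreMap, Algebra.smul_def]
  | add x y hx hy => simp [hx, hy]

theorem fib_lTensor {L' : Type u} [AddCommGroup L'] [Module k L'] (f : L →ₗ[k] L')
    (x : A ⊗[k] L) : A.fib L' (f.lTensor A x) = f (A.fib L x) := by
  induction x with
  | zero => simp
  | tmul a p => simp
  | add x y hx hy => simp [hx, hy]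

end fibre

section baseChange

variable {A' A : Art k} (φ : A' ⟶ A) (L : Type u) [AddCommGroup L] [Module k L]

/-- The base change `A' ⊗ L → A ⊗ L`. -/
noncomputable def bc : A' ⊗[k] L →ₗ[k] A ⊗[k] L := φ.alg.toLinearMap.rTensor L

/-- The inclusion `J ⊗ L → A' ⊗ L`, where `J` is the kernel of `A' → A`. -/
noncomputable def kerIncl : kernel φ ⊗[k] L →ₗ[k] A' ⊗[k] L := (kernel φ).subtype.rTensor L

variable {φ L}

@[simp] theorem bc_tmul (a : A') (l : L) : bc φ L (a ⊗ₜ l) = φ.alg a ⊗ₜ l := rfl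

@[simp] theorem kerIncl_tmul (j : kernel φ) (l : L) : kerIncl φ L (j ⊗ₜ l) = (j : A') ⊗ₜ l := rfl

theorem bc_smul (a : A') (x : A' ⊗[k] L) : bc φ L (a • x) = φ.alg a • bc φ L x := by
  induction x with
  | zero => simp
  | tmul b l => rw [TensorProduct.smul_tmul', bc_tmul, bc_tmul, TensorProduct.smul_tmul']; simp
  | add x y hx hy => simp [hx, hy]

theorem fib_bc (x : A' ⊗[k] L) : A.fib L (bc φ L x) = A'.fib L x := by
  induction x with
  | zero => simp
  | tmul b l => simp [aug_apply]
  | add x y hx hy => simp [hx, hy]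

theorem bc_lTensor {L' : Type u} [AddCommGroup L'] [Module k L'] (f : L →ₗ[k] L')
    (x : A' ⊗[k] L) : bc φ L' (f.lTensor A' x) = f.lTensor A (bc φ L x) := by
  induction x with
  | zero => simp
  | tmul a p => simp
  | add x y hx hy => simp [hx, hy]

theorem kerIncl_lTensor {L' : Type u} [AddCommGroup L'] [Module k L'] (f : L →ₗ[k] L')
    (x : kernel φ ⊗[k] L) : kerIncl φ L' (f.lTensor _ x) = f.lTensor A' (kerIncl φ L x) := by
  induction x with
  | zero => simp
  | tmul a p => simp
  | add x y hx hy => simp [hx, hy]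

theorem baseMap_eq_bc {P : Type u} [CommRing P] [Algebra k P] (x : A' ⊗[k] P) :
    baseMap P φ x = bc φ P x := by
  induction x with
  | zero => simp
  | tmul a p => simp [baseMap]
  | add x y hx hy => simp [hx, hy]

theorem kerIncl_injective : Function.Injective (kerIncl φ L) :=
  Module.Flat.rTensor_preserves_injective_linearMap _ (kernel φ).injective_subtype

namespace IsSmallExtension

theorem bc_surjective (hφ : IsSmallExtension φ) : Function.Surjective (bc φ L) :=
  LinearMap.rTensor_surjective _ hφ.surjective

theorem bc_eq_zero_iff (hφ : IsSmallExtension φ) {x : A' ⊗[k] L} : bc φ L x = 0 ↔ ∃ y, kerIncl φ L y = x :=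
  rTensor_exact L (f := (kernel φ).subtype) (g := φ.alg.toLinearMap)
    (LinearMap.exact_subtype_ker_map _) hφ.surjective x

/-- Since `𝔪_{A'} J = 0`, the algebra `A'` acts on `J` through its residue field. -/
theorem mul_kernel (hφ : IsSmallExtension φ) (a : A') (j : kernel φ) : a * j = A'.aug a • (j : A') := by
  have := hφ.mul_eq_zero _ (sub_aug_mem a) _ j.2
  rwa [sub_mul, sub_eq_zero, ← Algebra.smul_def] at this

theorem kernel_smul (hφ : IsSmallExtension φ) (j : kernel φ) (x : A' ⊗[k] L) :
    (j : A') • x = kerIncl φ L (j ⊗ₜ A'.fib L x) := by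
  induction x with
  | zero => simp
  | tmul b l =>
    rw [TensorProduct.smul_tmul', smul_eq_mul, mul_comm, hφ.mul_kernel, fib_tmul,
      TensorProduct.tmul_smul, map_smul, kerIncl_tmul, TensorProduct.smul_tmul']
  | add x y hx hy => rw [smul_add, hx, hy, map_add, TensorProduct.tmul_add, map_add]

theorem smul_kerIncl (hφ : IsSmallExtension φ) (a : A') (y : kernel φ ⊗[k] L) :
    a • kerIncl φ L y = A'.aug a • kerIncl φ L y := by
  induction y with
  | zero => simp
  | tmul j l =>
    rw [kerIncl_tmul, TensorProduct.smul_tmul', smul_eq_mul, hφ.mul_kernel,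
      TensorProduct.smul_tmul']
  | add x y hx hy => rw [map_add, smul_add, smul_add, hx, hy]

theorem fib_kerIncl (hφ : IsSmallExtension φ) (y : kernel φ ⊗[k] L) :
    A'.fib L (kerIncl φ L y) = 0 := by
  rw [← fib_bc (φ := φ), hφ.bc_eq_zero_iff.2 ⟨y, rfl⟩, map_zero]

/-- An `A'`-linear map `A' ⊗ M → A' ⊗ L` restricts to the reduction of it on `J ⊗ M → J ⊗ L`. -/
theorem apply_kerIncl (hφ : IsSmallExtension φ) {M : Type u} [AddCommGroup M] [Module k M] (q : A' ⊗[k] M →ₗ[A'] A' ⊗[k] L)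
    (r : M →ₗ[k] L) (hq : ∀ x, A'.fib L (q x) = r (A'.fib M x)) (y : kernel φ ⊗[k] M) :
    q (kerIncl φ M y) = kerIncl φ L (r.lTensor _ y) := by
  induction y with
  | zero => simp
  | tmul j l =>
    have : kerIncl φ M (j ⊗ₜ l) = (j : A') • (1 : A') ⊗ₜ[k] l := by
      rw [TensorProduct.smul_tmul', smul_eq_mul, mul_one, kerIncl_tmul]
    rw [this, map_smul, hφ.kernel_smul, hq]
    simp
  | add x y hx hy => simp [hx, hy]

theorem exists_mem_maximalIdeal (hφ : IsSmallExtension φ) {a : A} (ha : a ∈ IsLocalRing.maximalIdeal A) :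
    ∃ a' ∈ IsLocalRing.maximalIdeal A', φ.alg a' = a := by
  obtain ⟨a', rfl⟩ := hφ.surjective a
  exact ⟨a', by rwa [mem_maximalIdeal_iff, aug_apply, ← mem_maximalIdeal_iff] at *, rfl⟩

/-- `J` is a finitely generated ideal on which `A'` acts through `k`, so ideal generators already
span it over `k`. -/
theorem finite_kernel (hφ : IsSmallExtension φ) : Module.Finite k (kernel φ) := by
  have hN : IsNoetherianRing A' := inferInstance
  obtain ⟨s, hs⟩ := hN.noetherian (RingHom.ker φ.alg)
  have hle : kernel φ ≤ Submodule.span k (s : Set A') := by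
    intro x hx
    replace hx : x ∈ Submodule.span A' (s : Set A') := by rw [hs]; exact hx
    induction hx using Submodule.span_induction with
    | mem x h => exact Submodule.subset_span h
    | zero => exact Submodule.zero_mem _
    | add x y _ _ h1 h2 => exact Submodule.add_mem _ h1 h2
    | smul a x hx h =>
      rw [hs] at hx
      rw [smul_eq_mul, hφ.mul_kernel a ⟨x, hx⟩]
      exact Submodule.smul_mem _ _ h
  have : FiniteDimensional k (Submodule.span k (s : Set A')) :=
    FiniteDimensional.span_finset k s
  exact Submodule.finiteDimensional_of_le hle

end IsSmallExtension

end baseChange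

end Art

/-! ### Linear lifts, and trivializations of flat families. -/

open Art EqMod

section lifts

variable {k : Type u} [Field k] {A' A : Art k} {φ : A' ⟶ A} {M L : Type u} [AddCommGroup M]
  [Module k M] [AddCommGroup L] [Module k L]

theorem Art.linear_compat {q' : A' ⊗[k] M →ₗ[A'] A' ⊗[k] L} {q : A ⊗[k] M →ₗ[A] A ⊗[k] L}
    (h : ∀ m, bc φ L (q' (1 ⊗ₜ m)) = q (1 ⊗ₜ m)) (x : A' ⊗[k] M) :
    bc φ L (q' x) = q (bc φ M x) := by
  induction x with
  | zero => simp
  | tmul a m =>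
    have h1 : a ⊗ₜ[k] m = a • (1 : A') ⊗ₜ[k] m := by
      rw [TensorProduct.smul_tmul', smul_eq_mul, mul_one]
    have h2 : φ.alg a ⊗ₜ[k] m = φ.alg a • (1 : A) ⊗ₜ[k] m := by
      rw [TensorProduct.smul_tmul', smul_eq_mul, mul_one]
    rw [bc_tmul, h2, h1, map_smul q', bc_smul, h, map_smul q]
  | add x y hx hy => simp [hx, hy]

/-- The values on `1 ⊗ m` can be lifted `k`-linearly and extended by scalars. Any `P`-linearity or
equivariance of `q` may be lost. -/
theorem Art.IsSmallExtension.exists_linear_lift (hφ : IsSmallExtension φ)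
    (q : A ⊗[k] M →ₗ[A] A ⊗[k] L) :
    ∃ q' : A' ⊗[k] M →ₗ[A'] A' ⊗[k] L, ∀ x, bc φ L (q' x) = q (bc φ M x) := by
  obtain ⟨r, hr⟩ := Module.projective_lifting_property (bc φ L)
    ((q.restrictScalars k) ∘ₗ TensorProduct.mk k A M 1) hφ.bc_surjective
  refine ⟨r.liftBaseChange A', linear_compat fun m => ?_⟩
  rw [LinearMap.liftBaseChange_tmul, one_smul]
  exact LinearMap.congr_fun hr m

end lifts

section trivializations

variable {k : Type u} {P : Type u} [Field k] [CommRing P] [Algebra k P] {I : Ideal P} {A : Art k}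
  {Z : Ideal (A ⊗[k] P)}

/-- `q` identifies `P_A / Z` with `A ⊗ P / I`, compatibly with the reduction to `P / I`. -/
structure IsTrivialization (Z : Ideal (A ⊗[k] P)) (q : A ⊗[k] P →ₗ[A] A ⊗[k] (P ⧸ I)) : Prop where
  ker : ∀ x, q x = 0 ↔ x ∈ Z
  fib : ∀ x, A.fib _ (q x) = Ideal.Quotient.mk I (A.fib P x)

theorem IsTrivialization.surjective {q : A ⊗[k] P →ₗ[A] A ⊗[k] (P ⧸ I)}
    (h : IsTrivialization Z q) : Function.Surjective q := by
  rw [← LinearMap.range_eq_top, eq_top_iff]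
  refine Submodule.le_of_le_sup_smul_of_isNilpotent A.isNilpotent_maximalIdeal fun y _ => ?_
  obtain ⟨p, hp⟩ := Ideal.Quotient.mk_surjective (A.fib _ y)
  refine Submodule.mem_sup.2 ⟨q (1 ⊗ₜ p), ⟨_, rfl⟩, y - q (1 ⊗ₜ p), ?_, by abel⟩
  rw [← fib_eq_zero_iff, map_sub, h.fib, fib_tmul, map_one, one_smul, hp, sub_self]

/-- The quotient is isomorphic to the free `A`-module `A ⊗ P/I`. With `IsTrivialization.fibre`, this
is how an ideal constructed as a kernel is recognized as a deformation. -/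
theorem IsTrivialization.flat {q : A ⊗[k] P →ₗ[A] A ⊗[k] (P ⧸ I)}
    (h : IsTrivialization Z q) : Module.Flat A ((A ⊗[k] P) ⧸ Z) := by
  have hk : LinearMap.ker q = Z.restrictScalars A := Submodule.ext h.ker
  exact Module.Flat.of_linearEquiv (((Submodule.Quotient.restrictScalarsEquiv A Z).symm.trans
    (Submodule.quotEquivOfEq _ _ hk.symm)).trans (q.quotKerEquivOfSurjective h.surjective))

theorem fibreMap_surjective : Function.Surjective (fibreMap P A) := fun p =>
  ⟨1 ⊗ₜ p, by simp [fibreMap]⟩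

theorem IsTrivialization.fibre {q : A ⊗[k] P →ₗ[A] A ⊗[k] (P ⧸ I)}
    (h : IsTrivialization Z q) : Z.map (fibreMap P A) = I := by
  refine le_antisymm (Ideal.map_le_iff_le_comap.2 fun z hz => ?_) fun p hp => ?_
  · change fibreMap P A z ∈ I
    rw [fibreMap_eq_fib, ← Ideal.Quotient.eq_zero_iff_mem, ← h.fib, (h.ker z).2 hz, map_zero]
  -- For `p ∈ I` the value `q (1 ⊗ p)` lies in `𝔪 (A ⊗ P/I) = q (𝔪 P_A)`, so `1 ⊗ p` can be
  -- corrected by an element of `𝔪 P_A` to lie in `Z` without changing its reduction.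
  · have h1 : q (1 ⊗ₜ p) ∈ IsLocalRing.maximalIdeal A • (⊤ : Submodule A (A ⊗[k] (P ⧸ I))) := by
      rw [← fib_eq_zero_iff, h.fib, fib_tmul, map_one, one_smul]
      exact Ideal.Quotient.eq_zero_iff_mem.2 hp
    rw [← LinearMap.range_eq_top.2 h.surjective, LinearMap.range_eq_map,
      ← Submodule.map_smul''] at h1
    obtain ⟨w, hw, hqw⟩ := h1
    have hz : (1 : A) ⊗ₜ p - w ∈ Z := by rw [← h.ker, map_sub, hqw, sub_self]
    have : fibreMap P A ((1 : A) ⊗ₜ p - w) = p := by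
      rw [fibreMap_eq_fib, map_sub, fib_eq_zero_iff.2 hw, fib_tmul, map_one, one_smul, sub_zero]
    rw [← this]
    exact Ideal.mem_map_of_mem _ hz

theorem exists_mem_fib_eq (hZ : Z.map (fibreMap P A) = I) {p : P} (hp : p ∈ I) :
    ∃ z ∈ Z, A.fib P z = p := by
  rw [← hZ, Ideal.mem_map_iff_of_surjective _ fibreMap_surjective] at hp
  obtain ⟨z, hz, rfl⟩ := hp
  exact ⟨z, hz, (fibreMap_eq_fib z).symm⟩

theorem fib_mem (hZ : Z.map (fibreMap P A) = I) {z : A ⊗[k] P} (hz : z ∈ Z) : A.fib P z ∈ I := by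
  rw [← fibreMap_eq_fib, ← hZ]
  exact Ideal.mem_map_of_mem _ hz

/-- A `k`-linear section `s` of `P → P/I` induces `θ : A ⊗ P/I → P_A/Z`, an isomorphism modulo `𝔪`.
It is surjective by Nakayama and injective by flatness; `q` is the projection followed by `θ⁻¹`. -/
theorem exists_isTrivialization (hflat : Module.Flat A ((A ⊗[k] P) ⧸ Z))
    (hZ : Z.map (fibreMap P A) = I) :
    ∃ q : A ⊗[k] P →ₗ[A] A ⊗[k] (P ⧸ I), IsTrivialization Z q := by
  let mkI : P →ₗ[k] P ⧸ I := (Ideal.Quotient.mkₐ k I).toLinearMap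
  obtain ⟨s, hs⟩ := mkI.exists_rightInverse_of_surjective
    (LinearMap.range_eq_top.2 Ideal.Quotient.mk_surjective)
  have hs : ∀ x, Ideal.Quotient.mk I (s x) = x := fun x => LinearMap.congr_fun hs x
  let ψ : A ⊗[k] P →ₗ[A] (A ⊗[k] P) ⧸ Z := (Ideal.Quotient.mkₐ A Z).toLinearMap
  have hψ : ∀ x, ψ x = 0 ↔ x ∈ Z := fun x => Ideal.Quotient.eq_zero_iff_mem
  have hψs : Function.Surjective ψ := Ideal.Quotient.mk_surjective
  let θ : A ⊗[k] (P ⧸ I) →ₗ[A] (A ⊗[k] P) ⧸ Z := ψ ∘ₗ s.baseChange A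
  have hfs : ∀ x, A.fib P (s.baseChange A x) = s (A.fib _ x) := fun x => by
    rw [LinearMap.baseChange_eq_ltensor, fib_lTensor]
  have hmψ : ∀ w ∈ IsLocalRing.maximalIdeal A • (⊤ : Submodule A (A ⊗[k] P)),
      ψ w ∈ IsLocalRing.maximalIdeal A • (⊤ : Submodule A ((A ⊗[k] P) ⧸ Z)) := fun w hw => by
    rw [← LinearMap.range_eq_top.2 hψs, LinearMap.range_eq_map, ← Submodule.map_smul'']
    exact ⟨w, hw, rfl⟩
  have hsurj : Function.Surjective θ := by
    rw [← LinearMap.range_eq_top, eq_top_iff]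
    refine Submodule.le_of_le_sup_smul_of_isNilpotent A.isNilpotent_maximalIdeal fun y _ => ?_
    obtain ⟨x, rfl⟩ := hψs y
    let y₀ : A ⊗[k] (P ⧸ I) := 1 ⊗ₜ Ideal.Quotient.mk I (A.fib P x)
    refine Submodule.mem_sup.2 ⟨θ y₀, ⟨_, rfl⟩, ψ x - θ y₀, ?_, by abel⟩
    have hp : A.fib P x - A.fib P (s.baseChange A y₀) ∈ I := by
      rw [hfs, ← Ideal.Quotient.eq_zero_iff_mem, map_sub, hs]
      simp [y₀]
    obtain ⟨z, hz, hzp⟩ := exists_mem_fib_eq hZ hp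
    have : ψ x - θ y₀ = ψ (x - s.baseChange A y₀ - z) := by
      rw [map_sub, map_sub, (hψ z).2 hz, sub_zero]
      rfl
    rw [this]
    apply hmψ
    rw [← fib_eq_zero_iff, map_sub, map_sub, hzp, sub_self]
  have hfib : ∀ y x, θ y = ψ x → A.fib _ y = Ideal.Quotient.mk I (A.fib P x) := fun y x h => by
    have h1 : s.baseChange A y - x ∈ Z := by
      rw [← hψ, map_sub, sub_eq_zero]
      exact h
    have h2 := fib_mem hZ h1
    rwa [map_sub, hfs, ← Ideal.Quotient.eq_zero_iff_mem, map_sub, hs, sub_eq_zero] at h2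
  have hinj : Function.Injective θ := by
    rw [← LinearMap.ker_eq_bot, eq_bot_iff]
    -- By flatness `ker θ ∩ 𝔪 (A ⊗ P/I) = 𝔪 ker θ`. Elements of `ker θ` reduce to zero, so `ker θ =
    -- 𝔪 ker θ`, which forces `ker θ = 0`.
    have : Module.Flat A ((A ⊗[k] (P ⧸ I)) ⧸ LinearMap.ker θ) :=
      Module.Flat.of_linearEquiv (θ.quotKerEquivOfSurjective hsurj)
    refine Submodule.le_of_le_sup_smul_of_isNilpotent A.isNilpotent_maximalIdeal fun y hy => ?_
    rw [bot_sup_eq]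
    refine Module.Flat.mem_smul_of_mem _ _ hy ?_
    rw [← fib_eq_zero_iff, hfib y 0 (by rw [map_zero]; exact hy), map_zero, map_zero]
  let e := LinearEquiv.ofBijective θ ⟨hinj, hsurj⟩
  refine ⟨e.symm.toLinearMap ∘ₗ ψ, fun x => ?_, fun x => ?_⟩
  · rw [← hψ]
    simp
  · exact hfib _ _ (e.apply_symm_apply (ψ x))

end trivializations

/-! ### The preimage `Z̃` of a deformation under a small extension. -/

section thickening

variable {k : Type u} {P : Type u} [Field k] [CommRing P] [Algebra k P] {A' A : Art k}

/-- The preimage of `Z ⊆ P_A` in `P_{A'}`. -/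
noncomputable abbrev thickening (φ : A' ⟶ A) (Z : Ideal (A ⊗[k] P)) : Ideal (A' ⊗[k] P) :=
  Z.comap (baseMap P φ)

variable {φ : A' ⟶ A} {Z : Ideal (A ⊗[k] P)}

theorem mem_thickening {x : A' ⊗[k] P} : x ∈ thickening φ Z ↔ bc φ P x ∈ Z := by
  rw [Ideal.mem_comap, baseMap_eq_bc]

theorem kerIncl_mem_thickening (hφ : IsSmallExtension φ) (y : kernel φ ⊗[k] P) :
    kerIncl φ P y ∈ thickening φ Z := by
  rw [mem_thickening, hφ.bc_eq_zero_iff.2 ⟨y, rfl⟩]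
  exact Z.zero_mem

/-- By flatness, the elements of the preimage of `Z` with vanishing reduction lie in
`J ⊗ P + 𝔪 · Z`. -/
theorem mem_thickening_of_fib_eq_zero (hφ : IsSmallExtension φ)
    (hflat : Module.Flat A ((A ⊗[k] P) ⧸ Z)) {x : A' ⊗[k] P} (hx : x ∈ thickening φ Z)
    (h0 : A'.fib P x = 0) :
    ∃ y : kernel φ ⊗[k] P, ∃ w ∈ IsLocalRing.maximalIdeal A' • (thickening φ Z).restrictScalars A',
      kerIncl φ P y + w = x := by
  have : Module.Flat A ((A ⊗[k] P) ⧸ Z.restrictScalars A) :=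
    Module.Flat.of_linearEquiv (Submodule.Quotient.restrictScalarsEquiv A Z)
  -- The image of `x` lies in `Z ∩ 𝔪_A P_A = 𝔪_A Z`. It lifts to some `w ∈ 𝔪_{A'} Z̃`, and `x - w`
  -- dies in `P_A`, so it lies in `J ⊗ P`.
  have h1 : bc φ P x ∈ IsLocalRing.maximalIdeal A • Z.restrictScalars A :=
    Module.Flat.mem_smul_of_mem _ _ (mem_thickening.1 hx) (by
      rw [← fib_eq_zero_iff, fib_bc, h0])
  have h2 : ∀ z ∈ IsLocalRing.maximalIdeal A • Z.restrictScalars A,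
      ∃ w ∈ IsLocalRing.maximalIdeal A' • (thickening φ Z).restrictScalars A', bc φ P w = z := by
    intro z hz
    induction hz using Submodule.smul_induction_on' with
    | smul a ha z hz =>
      obtain ⟨a', ha', rfl⟩ := hφ.exists_mem_maximalIdeal ha
      obtain ⟨z', rfl⟩ := hφ.bc_surjective z
      exact ⟨a' • z', Submodule.smul_mem_smul ha' (mem_thickening.2 hz), bc_smul _ _⟩
    | add z _ z' _ h h' =>
      obtain ⟨w, hw, rfl⟩ := h
      obtain ⟨w', hw', rfl⟩ := h'
      exact ⟨w + w', Submodule.add_mem _ hw hw', map_add _ _ _⟩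
  obtain ⟨w, hw, hwx⟩ := h2 _ h1
  obtain ⟨y, hy⟩ := (hφ.bc_eq_zero_iff (x := x - w)).1 (by rw [map_sub, hwx, sub_self])
  exact ⟨y, w, hw, by rw [hy, sub_add_cancel]⟩

/-- Additive properties of elements of the preimage of `Z` with vanishing reduction can be checked
on `J ⊗ P` and on products with elements of the maximal ideal. -/
theorem thickening_induction (hφ : IsSmallExtension φ)
    (hflat : Module.Flat A ((A ⊗[k] P) ⧸ Z)) {p : A' ⊗[k] P → Prop}
    (hJ : ∀ y : kernel φ ⊗[k] P, p (kerIncl φ P y))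
    (hm : ∀ a ∈ IsLocalRing.maximalIdeal A', ∀ z ∈ thickening φ Z, p (a • z))
    (hadd : ∀ x ∈ thickening φ Z, ∀ y ∈ thickening φ Z, A'.fib P x = 0 → A'.fib P y = 0 →
      p x → p y → p (x + y))
    {x : A' ⊗[k] P} (hx : x ∈ thickening φ Z) (h0 : A'.fib P x = 0) : p x := by
  obtain ⟨y, w, hw, rfl⟩ := mem_thickening_of_fib_eq_zero hφ hflat hx h0
  have hle : IsLocalRing.maximalIdeal A' • (thickening φ Z).restrictScalars A' ≤
      (thickening φ Z).restrictScalars A' := Submodule.smul_le_right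
  have hfw : ∀ w ∈ IsLocalRing.maximalIdeal A' • (thickening φ Z).restrictScalars A',
      A'.fib P w = 0 := fun w hw => fib_eq_zero_iff.2 (Submodule.smul_mono le_rfl le_top hw)
  refine hadd _ (kerIncl_mem_thickening hφ y) _ (hle hw) (hφ.fib_kerIncl y) (hfw w hw) (hJ y) ?_
  clear hx h0
  induction hw using Submodule.smul_induction_on' with
  | smul a ha z hz => exact hm a ha z hz
  | add z hz z' hz' h h' => exact hadd _ (hle hz) _ (hle hz') (hfw _ hz) (hfw _ hz') h h'

/-- Such a `q'` is an auxiliary choice: on `Z̃` it takes values in `J ⊗ P/I`, and its restriction to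
the kernel of `Z̃ → I` turns out to be canonical. -/
theorem exists_trivialization_lift {I : Ideal P} (hφ : IsSmallExtension φ)
    (hflat : Module.Flat A ((A ⊗[k] P) ⧸ Z)) (hZ : Z.map (fibreMap P A) = I) :
    ∃ q' : A' ⊗[k] P →ₗ[A'] A' ⊗[k] (P ⧸ I), (∀ x, bc φ _ (q' x) = 0 ↔ x ∈ thickening φ Z) ∧
      ∀ x, A'.fib _ (q' x) = Ideal.Quotient.mk I (A'.fib P x) := by
  obtain ⟨q, hq⟩ := exists_isTrivialization hflat hZ
  obtain ⟨q', hq'⟩ := hφ.exists_linear_lift q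
  refine ⟨q', fun x => ?_, fun x => ?_⟩
  · rw [hq', hq.ker, mem_thickening]
  · rw [← fib_bc (φ := φ), hq', hq.fib, fib_bc]

end thickening

section operators

variable {k : Type u} {P : Type u} [Field k] [CommRing P] [Algebra k P] {A' A : Art k} {φ : A' ⟶ A}

theorem Art.lTensor_smul {L L' : Type u} [AddCommGroup L] [Module k L] [AddCommGroup L']
    [Module k L'] (T : L →ₗ[k] L') (a : A') (x : A' ⊗[k] L) :
    T.lTensor A' (a • x) = a • T.lTensor A' x :=
  map_smul (T.baseChange A') a x

theorem Art.tmul_mul_eq_lTensor (p : P) (x : A' ⊗[k] P) :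
    (1 : A') ⊗ₜ[k] p * x = (Algebra.lsmul k k P p).lTensor A' x := by
  induction x with
  | zero => simp
  | tmul a q => simp
  | add x y hx hy => rw [mul_add, hx, hy, map_add]

/-- The projection `P → P / I`, as a `k`-linear map. -/
noncomputable abbrev mkLin (k : Type u) {P : Type u} [Field k] [CommRing P] [Algebra k P]
    (I : Ideal P) : P →ₗ[k] P ⧸ I := (Ideal.Quotient.mkₐ k I).toLinearMap

variable {I : Ideal P} {Z : Ideal (A ⊗[k] P)} {q' : A' ⊗[k] P →ₗ[A'] A' ⊗[k] (P ⧸ I)}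

theorem exists_kernel_reduction (hφ : IsSmallExtension φ)
    (hq : ∀ x ∈ thickening φ Z, bc φ _ (q' x) = 0) :
    ∃ r : (thickening φ Z).restrictScalars k →ₗ[k] kernel φ ⊗[k] (P ⧸ I),
      ∀ x, kerIncl φ _ (r x) = q' x.1 := by
  let e := LinearEquiv.ofInjective (kerIncl φ (P ⧸ I)) kerIncl_injective
  refine ⟨e.symm.toLinearMap ∘ₗ LinearMap.codRestrict _
    (q'.restrictScalars k ∘ₗ ((thickening φ Z).restrictScalars k).subtype)
    (fun x => (hφ.bc_eq_zero_iff.1 (hq x.1 x.2))), fun x => ?_⟩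
  exact congrArg Subtype.val (e.apply_symm_apply _)

theorem smul_eq_zero_of_bc_eq_zero {L : Type u} [AddCommGroup L] [Module k L]
    (hφ : IsSmallExtension φ) {x : A' ⊗[k] L} (hx : bc φ L x = 0) {a : A'}
    (ha : a ∈ IsLocalRing.maximalIdeal A') : a • x = 0 := by
  obtain ⟨y, rfl⟩ := hφ.bc_eq_zero_iff.1 hx
  rw [hφ.smul_kerIncl, mem_maximalIdeal_iff.1 ha, zero_smul]

/-- Although `q'` need not commute with `T` in general, on `J ⊗ P` it is the projection to `J ⊗ P/I`
and on `𝔪_{A'} Z̃` it is zero, and both are compatible with `T`. Taking for `T` multiplication by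
`p` and the action of `g` makes the restricted map `P`-linear and equivariant. -/
theorem map_lTensor_of_fib_eq_zero (hφ : IsSmallExtension φ)
    (hflat : Module.Flat A ((A ⊗[k] P) ⧸ Z))
    (hq : ∀ x ∈ thickening φ Z, bc φ _ (q' x) = 0)
    (hfib : ∀ x, A'.fib _ (q' x) = mkLin k I (A'.fib P x))
    (T : P →ₗ[k] P) (T' : P ⧸ I →ₗ[k] P ⧸ I) (hT : ∀ p, mkLin k I (T p) = T' (mkLin k I p))
    (hTZ : ∀ x ∈ thickening φ Z, T.lTensor A' x ∈ thickening φ Z) {x : A' ⊗[k] P}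
    (hx : x ∈ thickening φ Z) (h0 : A'.fib P x = 0) :
    q' (T.lTensor A' x) = T'.lTensor A' (q' x) := by
  refine thickening_induction hφ hflat
    (p := fun x => q' (T.lTensor A' x) = T'.lTensor A' (q' x))
    (fun y => ?_) (fun a ha z hz => ?_) (fun x _ y _ _ _ hx hy => ?_) hx h0
  · rw [← kerIncl_lTensor, hφ.apply_kerIncl q' _ hfib, hφ.apply_kerIncl q' _ hfib,
      ← kerIncl_lTensor]
    congr 1
    rw [← LinearMap.comp_apply, ← LinearMap.lTensor_comp, ← LinearMap.comp_apply,
      ← LinearMap.lTensor_comp]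
    congr 2
    exact LinearMap.ext hT
  · rw [lTensor_smul, map_smul, smul_eq_zero_of_bc_eq_zero hφ (hq _ (hTZ z hz)) ha, map_smul,
      smul_eq_zero_of_bc_eq_zero hφ (hq _ hz) ha, map_zero]
  · rw [map_add, map_add, map_add, map_add, hx, hy]

end operators

section equivariance

variable {k : Type u} {G : Type v} {P : Type u} [Field k] [Group G] [CommRing P] [Algebra k P]
  [MulSemiringAction G P] [SMulCommClass G k P] {I : Ideal P} {A' A : Art k} {φ : A' ⟶ A}
  {Z : Ideal (A ⊗[k] P)}

theorem actOn_eq_lTensor (A : Art k) (g : G) (x : A ⊗[k] P) :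
    actOn A g x = (algebraRep k G P g).lTensor A x := by
  induction x with
  | zero => simp
  | tmul a q => simp [actOn, algebraRep]
  | add x y hx hy => rw [map_add, hx, hy, map_add]

theorem actOn_mem_thickening (hZ : IsDeformation G I A Z) (g : G) {x : A' ⊗[k] P}
    (hx : x ∈ thickening φ Z) : actOn A' g x ∈ thickening φ Z := by
  change baseMap P φ (actOn A' g x) ∈ Z
  rw [← actOn_baseMap]
  exact hZ.stable g _ hx

theorem fib_mem_of_mem_thickening (hZ : IsDeformation G I A Z) {x : A' ⊗[k] P}
    (hx : x ∈ thickening φ Z) : A'.fib P x ∈ I := by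
  rw [← fib_bc (φ := φ)]
  exact fib_mem hZ.fibre (mem_thickening.1 hx)

end equivariance

/-! ### `P_A` and `Z̃` as `(P, G)`-modules, and the surjection `Z̃ → I`. -/

section objects

variable {k : Type u} {G : Type v} {P : Type u} [Field k] [Group G]
  [AffineAlgebraicGroup k G] [CommRing P] [Algebra k P] [MulSemiringAction G P]
  [SMulCommClass G k P] [IsAffineGScheme k G P]

/-- The algebra `P_A = A ⊗ P` as a `(P, G)`-module. -/
noncomputable def famObj (G : Type v) (P : Type u) [Group G]
    [AffineAlgebraicGroup k G] [CommRing P] [Algebra k P] [MulSemiringAction G P]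
    [SMulCommClass G k P] [IsAffineGScheme k G P] (A : Art k) : EqMod k G P where
  carrier := A ⊗[k] P
  module := Module.compHom _ (Algebra.TensorProduct.includeRight : P →ₐ[k] A ⊗[k] P).toRingHom
  isScalarTower :=
    let _ : Module P (A ⊗[k] P) :=
      Module.compHom _ (Algebra.TensorProduct.includeRight : P →ₐ[k] A ⊗[k] P).toRingHom
    ⟨fun c p x => by
      change (1 : A) ⊗ₜ[k] (c • p) * x = c • ((1 : A) ⊗ₜ[k] p * x)
      rw [TensorProduct.tmul_smul, smul_mul_assoc]⟩
  ρ :=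
    { toFun := fun g => (actOn A g).toLinearMap.restrictScalars k
      map_one' := LinearMap.ext fun x => by
        change actOn A 1 x = x
        rw [actOn_eq_lTensor, map_one]
        exact LinearMap.lTensor_id_apply _ _ _
      map_mul' := fun g h => LinearMap.ext fun x => by
        change actOn A (g * h) x = actOn A g (actOn A h x)
        rw [actOn_eq_lTensor, actOn_eq_lTensor, actOn_eq_lTensor, map_mul]
        exact LinearMap.congr_fun (LinearMap.lTensor_mul A _ _) x }
  ρ_smul g p x := by
    change actOn A g ((1 : A) ⊗ₜ[k] p * x) = (1 : A) ⊗ₜ[k] (g • p) * actOn A g x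
    rw [map_mul]
    simp [actOn]
  rational := by
    have h1 : (1 : Representation k G A).IsRational := fun x =>
      ⟨1, fun _ _ => 1, fun _ => x, fun _ => one_mem _, fun g => by simp⟩
    exact (h1.tprod (IsAffineGScheme.rational (P := P))).of_injective LinearMap.id
      (fun _ _ h => h) (fun g x => by
        change actOn A g x = TensorProduct.map _ _ x
        rw [actOn_eq_lTensor]
        rfl)

variable {I : Ideal P} {hI : I.IsGStable G} {A' A : Art k} {φ : A' ⟶ A} {Z : Ideal (A ⊗[k] P)}

/-- The preimage of `Z` in `P_{A'}` as a `(P, G)`-module. -/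
noncomputable def thickObj (φ : A' ⟶ A) (hZ : IsDeformation G I A Z) : EqMod k G P :=
  ofSub (famObj G P A')
    { carrier := (thickening φ Z : Set (A' ⊗[k] P))
      add_mem' := (thickening φ Z).add_mem
      zero_mem' := (thickening φ Z).zero_mem
      smul_mem' := fun p _ hx => (thickening φ Z).mul_mem_left ((1 : A') ⊗ₜ[k] p) hx }
    (fun g _ hx => actOn_mem_thickening hZ g hx)

/-- The underlying element of `P_{A'}`. -/
def thickObj.val {hZ : IsDeformation G I A Z} (x : (thickObj φ hZ).carrier) : A' ⊗[k] P := x.1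

/-- The element of `thickObj φ hZ` defined by an element of `P_{A'}`. -/
def thickObj.mk (hZ : IsDeformation G I A Z) (x : A' ⊗[k] P) (hx : x ∈ thickening φ Z) :
    (thickObj φ hZ).carrier := ⟨x, hx⟩

theorem thickObj.val_mem {hZ : IsDeformation G I A Z} (x : (thickObj φ hZ).carrier) :
    x.val ∈ thickening φ Z := x.2

theorem thickObj.val_smul {hZ : IsDeformation G I A Z} (p : P) (x : (thickObj φ hZ).carrier) :
    thickObj.val (p • x) = (1 : A') ⊗ₜ[k] p * thickObj.val x := rfl

theorem thickObj.val_ρ {hZ : IsDeformation G I A Z} (g : G) (x : (thickObj φ hZ).carrier) :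
    thickObj.val ((thickObj φ hZ).ρ g x) = actOn A' g (thickObj.val x) := rfl

/-- The reduction of the preimage of `Z` to `I`. -/
noncomputable def thickπ (hI : I.IsGStable G) (φ : A' ⟶ A) (hZ : IsDeformation G I A Z) :
    thickObj φ hZ ⟶ idealObj k I hI :=
  EqMod.mkHom (M := thickObj φ hZ) (N := idealObj k I hI)
    { toFun := fun x => ⟨A'.fib P (thickObj.val x), fib_mem_of_mem_thickening hZ x.2⟩
      map_add' := fun x y => Subtype.ext (map_add (A'.fib P) _ _)
      map_smul' := fun p x => Subtype.ext (by
        change A'.fib P ((1 : A') ⊗ₜ[k] p * thickObj.val x) = p * A'.fib P (thickObj.val x)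
        rw [← fibreMap_eq_fib, map_mul, fibreMap_eq_fib, fibreMap_eq_fib, fib_tmul, map_one,
          one_smul]) }
    (fun g x => Subtype.ext (by
      change A'.fib P (actOn A' g (thickObj.val x)) = algebraRep k G P g (A'.fib P (thickObj.val x))
      rw [actOn_eq_lTensor, fib_lTensor]))

theorem thickπ_surjective (hφ : IsSmallExtension φ) (hZ : IsDeformation G I A Z) :
    Function.Surjective (thickπ hI φ hZ).toLin := by
  rintro ⟨p, hp⟩
  obtain ⟨z, hz, hzp⟩ := exists_mem_fib_eq hZ.fibre hp
  obtain ⟨x, rfl⟩ := hφ.bc_surjective z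
  exact ⟨thickObj.mk hZ x (mem_thickening.2 hz), Subtype.ext (by rwa [fib_bc] at hzp)⟩

end objects

/-! ### Evaluation in `J ⊗ Hom(M, P/I)`. -/

section quotEval

variable {k : Type u} {G : Type v} {P : Type u} [Field k] [Group G]
  [AffineAlgebraicGroup k G] [CommRing P] [Algebra k P] [MulSemiringAction G P]
  [SMulCommClass G k P] [IsAffineGScheme k G P] {I : Ideal P} {hI : I.IsGStable G}
  {J : Type u} [AddCommGroup J] [Module k J] {M N : EqMod k G P}

/-- The action of `G` on `P / I`. -/
def quotAct (k : Type u) {G : Type v} {P : Type u} [Field k] [Group G]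
    [AffineAlgebraicGroup k G] [CommRing P] [Algebra k P] [MulSemiringAction G P]
    [SMulCommClass G k P] [IsAffineGScheme k G P] {I : Ideal P} (hI : I.IsGStable G) (g : G) :
    P ⧸ I →ₗ[k] P ⧸ I := (quotObj k I hI).ρ g

/-- Evaluation of elements of `J ⊗ Hom(M, P / I)`. -/
noncomputable def quotEval (Θ : J ⊗[k] (M ⟶ quotObj k I hI)) (x : M.carrier) : J ⊗[k] (P ⧸ I) :=
  tensorEval Θ x

theorem quotEval_add (Θ : J ⊗[k] (M ⟶ quotObj k I hI)) (x y : M.carrier) :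
    quotEval Θ (x + y) = quotEval Θ x + quotEval Θ y := tensorEval_add Θ x y

theorem quotEval_smul (Θ : J ⊗[k] (M ⟶ quotObj k I hI)) (p : P) (x : M.carrier) :
    quotEval Θ (p • x) = (Algebra.lsmul k k (P ⧸ I) p).lTensor J (quotEval Θ x) :=
  tensorEval_smul Θ p x

theorem quotEval_ρ (Θ : J ⊗[k] (M ⟶ quotObj k I hI)) (g : G) (x : M.carrier) :
    quotEval Θ (M.ρ g x) = (quotAct k hI g).lTensor J (quotEval Θ x) :=
  tensorEval_ρ Θ g x

theorem quotEval_leftComp (f : M ⟶ N) (Θ : J ⊗[k] (N ⟶ quotObj k I hI)) (x : M.carrier) :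
    quotEval ((Linear.leftComp k (quotObj k I hI) f).lTensor J Θ) x = quotEval Θ (f.toLin x) :=
  tensorEval_leftComp f Θ x

theorem quotEval_rTensor {J' : Type u} [AddCommGroup J'] [Module k J'] (f : J →ₗ[k] J')
    (Θ : J ⊗[k] (M ⟶ quotObj k I hI)) (x : M.carrier) :
    quotEval (f.rTensor _ Θ) x = f.rTensor _ (quotEval Θ x) :=
  tensorEval_rTensor f Θ x

theorem quotEval_injective {Θ Θ' : J ⊗[k] (M ⟶ quotObj k I hI)}
    (h : ∀ x, quotEval Θ x = quotEval Θ' x) : Θ = Θ' :=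
  tensorEval_injective h

theorem exists_quotEval_eq [Module.Finite k J] (g : M.carrier →ₗ[k] J ⊗[k] (P ⧸ I))
    (hP : ∀ (p : P) x, g (p • x) = (Algebra.lsmul k k (P ⧸ I) p).lTensor J (g x))
    (hG : ∀ a x, g (M.ρ a x) = (quotAct k hI a).lTensor J (g x)) :
    ∃ Θ : J ⊗[k] (M ⟶ quotObj k I hI), ∀ x, quotEval Θ x = g x :=
  exists_tensorEval_eq (L := quotObj k I hI) g hP hG

/-- Evaluation as a linear map. -/
noncomputable def quotEvalLin (Θ : J ⊗[k] (M ⟶ quotObj k I hI)) :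
    M.carrier →ₗ[k] J ⊗[k] (P ⧸ I) := tensorEvalLin Θ

end quotEval

theorem LinearMap.exists_comp_eq_of_ker_le {k V W X : Type*} [Field k] [AddCommGroup V]
    [Module k V] [AddCommGroup W] [Module k W] [AddCommGroup X] [Module k X] (F : V →ₗ[k] W)
    (D : V →ₗ[k] X) (h : ∀ v, F v = 0 → D v = 0) : ∃ τ : W →ₗ[k] X, ∀ v, τ (F v) = D v := by
  obtain ⟨s, hs⟩ := F.rangeRestrict.exists_rightInverse_of_surjective F.range_rangeRestrict
  obtain ⟨τ, hτ⟩ := (D ∘ₗ s).exists_extend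
  refine ⟨τ, fun v => ?_⟩
  have h1 : τ (F v) = D (s (F.rangeRestrict v)) := LinearMap.congr_fun hτ (F.rangeRestrict v)
  rw [h1, ← sub_eq_zero, ← map_sub]
  apply h
  rw [map_sub, sub_eq_zero]
  exact congrArg Subtype.val (LinearMap.congr_fun hs (F.rangeRestrict v))

/-! ### The canonical class on the kernel of `Z̃ → I`, and the obstruction. -/

section thickClass

variable {k : Type u} {G : Type v} {P : Type u} [Field k] [Group G]
  [AffineAlgebraicGroup k G] [CommRing P] [Algebra k P] [MulSemiringAction G P]
  [SMulCommClass G k P] [IsAffineGScheme k G P]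
  {I : Ideal P} {hI : I.IsGStable G} {A' A : Art k} {φ : A' ⟶ A} {Z : Ideal (A ⊗[k] P)}
  {hZ : IsDeformation G I A Z}

/-- The underlying element of `P_{A'}` of an element of the kernel of `thickπ`. -/
def thickπ.val (x : (EqMod.ker (thickπ hI φ hZ)).carrier) : A' ⊗[k] P := thickObj.val x.1

theorem thickπ.val_mem (x : (EqMod.ker (thickπ hI φ hZ)).carrier) :
    thickπ.val x ∈ thickening φ Z := x.1.2

theorem thickπ.fib_val (x : (EqMod.ker (thickπ hI φ hZ)).carrier) :
    A'.fib P (thickπ.val x) = 0 := congrArg Subtype.val x.2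

/-- The element of the kernel of `thickπ` defined by an element of `P_{A'}`. -/
def thickπ.mk (hI : I.IsGStable G) (hZ : IsDeformation G I A Z) (x : A' ⊗[k] P)
    (hx : x ∈ thickening φ Z) (h0 : A'.fib P x = 0) : (EqMod.ker (thickπ hI φ hZ)).carrier :=
  ⟨thickObj.mk hZ x hx, Subtype.ext h0⟩

theorem thickπ.val_injective {x y : (EqMod.ker (thickπ hI φ hZ)).carrier}
    (h : thickπ.val x = thickπ.val y) : x = y := Subtype.ext (Subtype.ext h)

/-- The product of the maximal ideal with the preimage of `Z` in `P_{A'}`. -/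
noncomputable abbrev maxSmulThickening (φ : A' ⟶ A) (Z : Ideal (A ⊗[k] P)) :
    Submodule A' (A' ⊗[k] P) :=
  IsLocalRing.maximalIdeal A' • (thickening φ Z).restrictScalars A'

theorem maxSmulThickening_le : maxSmulThickening φ Z ≤ (thickening φ Z).restrictScalars A' :=
  Submodule.smul_le_right

theorem fib_eq_zero_of_mem_maxSmulThickening {w : A' ⊗[k] P} (hw : w ∈ maxSmulThickening φ Z) :
    A'.fib P w = 0 := fib_eq_zero_iff.2 (Submodule.smul_mono le_rfl le_top hw)

/-- The element of `J ⊗ Hom(ker (thickπ), P / I)` which is the projection on `J ⊗ P` and vanishes on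
the product of the maximal ideal with the preimage of `Z`. -/
structure IsThickClass (Λ : kernel φ ⊗[k] (EqMod.ker (thickπ hI φ hZ) ⟶ quotObj k I hI)) :
    Prop where
  kerIncl : ∀ x y, thickπ.val x = kerIncl φ P y → quotEval Λ x = (mkLin k I).lTensor _ y
  smul : ∀ x, thickπ.val x ∈ maxSmulThickening φ Z → quotEval Λ x = 0

/-- The kernel of `Z̃ → I` is the sum of `J ⊗ P` and `𝔪_{A'} Z̃`. The coefficient space is arbitrary
so that naturality can use the kernel of another small extension. -/
theorem thickClass_ext (hφ : IsSmallExtension φ) {J : Type u} [AddCommGroup J] [Module k J]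
    {Θ Θ' : J ⊗[k] (EqMod.ker (thickπ hI φ hZ) ⟶ quotObj k I hI)}
    (h1 : ∀ x y, thickπ.val x = kerIncl φ P y → quotEval Θ x = quotEval Θ' x)
    (h2 : ∀ x, thickπ.val x ∈ maxSmulThickening φ Z → quotEval Θ x = quotEval Θ' x) :
    Θ = Θ' := by
  refine quotEval_injective fun x => ?_
  obtain ⟨y, w, hw, hx⟩ := mem_thickening_of_fib_eq_zero hφ hZ.flat (thickπ.val_mem x)
    (thickπ.fib_val x)
  have : x = thickπ.mk hI hZ _ (kerIncl_mem_thickening hφ y) (hφ.fib_kerIncl y) +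
      thickπ.mk hI hZ w (maxSmulThickening_le hw) (fib_eq_zero_of_mem_maxSmulThickening hw) :=
    thickπ.val_injective hx.symm
  rw [this, quotEval_add, quotEval_add, h1 _ y rfl]
  exact congrArg _ (h2 (thickπ.mk hI hZ w _ _) hw)

theorem IsThickClass.unique (hφ : IsSmallExtension φ)
    {Λ Λ' : kernel φ ⊗[k] (EqMod.ker (thickπ hI φ hZ) ⟶ quotObj k I hI)}
    (h : IsThickClass Λ) (h' : IsThickClass Λ') : Λ = Λ' :=
  thickClass_ext hφ (fun x y hx => by rw [h.kerIncl x y hx, h'.kerIncl x y hx])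
    (fun x hx => by rw [h.smul x hx, h'.smul x hx])

section trivialized

variable {q' : A' ⊗[k] P →ₗ[A'] A' ⊗[k] (P ⧸ I)}

theorem apply_eq_zero_of_mem_maxSmulThickening (hφ : IsSmallExtension φ)
    (hq : ∀ x ∈ thickening φ Z, bc φ _ (q' x) = 0) {w : A' ⊗[k] P}
    (hw : w ∈ maxSmulThickening φ Z) : q' w = 0 := by
  induction hw using Submodule.smul_induction_on' with
  | smul a ha z hz => rw [map_smul, smul_eq_zero_of_bc_eq_zero hφ (hq _ hz) ha]
  | add z _ z' _ h h' => rw [map_add, h, h', add_zero]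

/-- Together with `IsThickClass.unique`, this shows that the class induced by `q'` does not depend
on `q'`. -/
theorem IsThickClass.of_kerIncl_quotEval (hφ : IsSmallExtension φ)
    (hq : ∀ x ∈ thickening φ Z, bc φ _ (q' x) = 0)
    (hfib : ∀ x, A'.fib _ (q' x) = mkLin k I (A'.fib P x))
    {Λ : kernel φ ⊗[k] (EqMod.ker (thickπ hI φ hZ) ⟶ quotObj k I hI)}
    (h : ∀ x, Art.kerIncl φ _ (quotEval Λ x) = q' (thickπ.val x)) : IsThickClass Λ where
  kerIncl x y hx := kerIncl_injective (by rw [h, hx, hφ.apply_kerIncl q' _ hfib])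
  smul x hx := kerIncl_injective (by
    rw [h, apply_eq_zero_of_mem_maxSmulThickening hφ hq hx, map_zero])

theorem exists_isThickClass_of_lift (hφ : IsSmallExtension φ)
    (hq : ∀ x ∈ thickening φ Z, bc φ _ (q' x) = 0)
    (hfib : ∀ x, A'.fib _ (q' x) = mkLin k I (A'.fib P x)) (hI : I.IsGStable G)
    (hZ : IsDeformation G I A Z) :
    ∃ Λ : kernel φ ⊗[k] (EqMod.ker (thickπ hI φ hZ) ⟶ quotObj k I hI),
      ∀ x, kerIncl φ _ (quotEval Λ x) = q' (thickπ.val x) := by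
  have := hφ.finite_kernel
  obtain ⟨r, hr⟩ := exists_kernel_reduction hφ hq
  let g : (EqMod.ker (thickπ hI φ hZ)).carrier →ₗ[k] kernel φ ⊗[k] (P ⧸ I) :=
    { toFun := fun x => r ⟨thickπ.val x, thickπ.val_mem x⟩
      map_add' := fun x y => map_add r ⟨thickπ.val x, thickπ.val_mem x⟩
        ⟨thickπ.val y, thickπ.val_mem y⟩
      map_smul' := fun c x => map_smul r c ⟨thickπ.val x, thickπ.val_mem x⟩ }
  have hg : ∀ x, kerIncl φ _ (g x) = q' (thickπ.val x) := fun x => hr _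
  obtain ⟨Λ, hΛ⟩ := exists_quotEval_eq (hI := hI) g
    (fun p x => kerIncl_injective (by
      rw [hg, kerIncl_lTensor, hg]
      have : thickπ.val (p • x) = (Algebra.lsmul k k P p).lTensor A' (thickπ.val x) :=
        tmul_mul_eq_lTensor p _
      rw [this]
      exact map_lTensor_of_fib_eq_zero hφ hZ.flat hq hfib _ _ (fun _ => rfl)
        (fun x hx => by rw [← tmul_mul_eq_lTensor]; exact Ideal.mul_mem_left _ _ hx)
        (thickπ.val_mem x) (thickπ.fib_val x)))
    (fun a x => kerIncl_injective (by
      rw [hg, kerIncl_lTensor, hg]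
      have : thickπ.val ((EqMod.ker (thickπ hI φ hZ)).ρ a x) =
          (algebraRep k G P a).lTensor A' (thickπ.val x) := actOn_eq_lTensor A' a _
      rw [this]
      exact map_lTensor_of_fib_eq_zero hφ hZ.flat hq hfib _ _ (fun _ => rfl)
        (fun x hx => by rw [← actOn_eq_lTensor]; exact actOn_mem_thickening hZ a hx)
        (thickπ.val_mem x) (thickπ.fib_val x)))
  exact ⟨Λ, fun x => by rw [hΛ, hg]⟩

end trivialized

theorem exists_isThickClass (hφ : IsSmallExtension φ) (hI : I.IsGStable G)
    (hZ : IsDeformation G I A Z) :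
    ∃ Λ : kernel φ ⊗[k] (EqMod.ker (thickπ hI φ hZ) ⟶ quotObj k I hI), IsThickClass Λ := by
  obtain ⟨q', hq, hfib⟩ := exists_trivialization_lift hφ hZ.flat hZ.fibre
  obtain ⟨Λ, hΛ⟩ := exists_isThickClass_of_lift hφ (fun x hx => (hq x).2 hx) hfib hI hZ
  exact ⟨Λ, .of_kerIncl_quotEval hφ (fun x hx => (hq x).2 hx) hfib hΛ⟩

/-- The element characterized by `IsThickClass`. -/
noncomputable def thickClass (hφ : IsSmallExtension φ) (hI : I.IsGStable G)
    (hZ : IsDeformation G I A Z) :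
    kernel φ ⊗[k] (EqMod.ker (thickπ hI φ hZ) ⟶ quotObj k I hI) :=
  (exists_isThickClass hφ hI hZ).choose

theorem thickClass_spec (hφ : IsSmallExtension φ) (hI : I.IsGStable G)
    (hZ : IsDeformation G I A Z) : IsThickClass (thickClass hφ hI hZ) :=
  (exists_isThickClass hφ hI hZ).choose_spec

/-- The obstruction to lifting a deformation along a small extension. -/
noncomputable def obstruction (hφ : IsSmallExtension φ) (hI : I.IsGStable G)
    (hZ : IsDeformation G I A Z) :
    kernel φ ⊗[k] Abelian.Ext (idealObj k I hI) (quotObj k I hI) 1 :=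
  (EqMod.connecting (thickπ hI φ hZ) (thickπ_surjective hφ hZ) (quotObj k I hI)).lTensor
    (kernel φ) (thickClass hφ hI hZ)

/-- The obstruction may be computed on any cover of `I` that maps to `Z̃` over `I`. -/
theorem connecting_kerMap_lTensor {M : EqMod k G P} {f : M ⟶ idealObj k I hI}
    (hφ : IsSmallExtension φ) (hf : Function.Surjective f.toLin) (F : M ⟶ thickObj φ hZ)
    (h : F ≫ thickπ hI φ hZ = f) :
    (EqMod.connecting f hf (quotObj k I hI)).lTensor (kernel φ)
      ((Linear.leftComp k (quotObj k I hI) (kerMap F h)).lTensor (kernel φ)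
        (thickClass hφ hI hZ)) = obstruction hφ hI hZ := by
  rw [obstruction, ← LinearMap.comp_apply, ← LinearMap.lTensor_comp]
  congr 2
  ext κ
  exact connecting_kerMap hf _ F h _ κ

/-- A trivialization `q'` of `Z'` kills `Z'` and is the projection on `J ⊗ P`. As `Z̃ = Z' + J ⊗ P`,
it is `P`-linear and equivariant on all of `Z̃`, so it extends the canonical class, and the
connecting map kills classes that extend. -/
theorem obstruction_eq_zero_of_lift (hφ : IsSmallExtension φ) (hI : I.IsGStable G)
    (hZ : IsDeformation G I A Z) {Z' : Ideal (A' ⊗[k] P)} (hZ' : IsDeformation G I A' Z')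
    (hmap : Z'.map (baseMap P φ) = Z) : obstruction hφ hI hZ = 0 := by
  have := hφ.finite_kernel
  obtain ⟨q', hq'⟩ := exists_isTrivialization hZ'.flat hZ'.fibre
  have hfib : ∀ x, A'.fib _ (q' x) = mkLin k I (A'.fib P x) := hq'.fib
  have hdec : ∀ x ∈ thickening φ Z, ∃ z ∈ Z', ∃ y, z + kerIncl φ P y = x := by
    intro x hx
    have hs : Function.Surjective (baseMap P φ) := fun y => by
      obtain ⟨x, rfl⟩ := hφ.bc_surjective y
      exact ⟨x, baseMap_eq_bc x⟩
    rw [Ideal.mem_comap, ← hmap, Ideal.mem_map_iff_of_surjective _ hs] at hx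
    obtain ⟨z, hz, hzx⟩ := hx
    obtain ⟨y, hy⟩ := (hφ.bc_eq_zero_iff (x := x - z)).1 (by
      rw [map_sub, ← baseMap_eq_bc, ← baseMap_eq_bc, hzx, sub_self])
    exact ⟨z, hz, y, by rw [hy]; abel⟩
  have hval : ∀ z ∈ Z', ∀ y, q' (z + kerIncl φ P y) = kerIncl φ _ ((mkLin k I).lTensor _ y) :=
    fun z hz y => by rw [map_add, (hq'.ker z).2 hz, zero_add, hφ.apply_kerIncl q' _ hfib]
  have hq : ∀ x ∈ thickening φ Z, bc φ _ (q' x) = 0 := fun x hx => by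
    obtain ⟨z, hz, y, rfl⟩ := hdec x hx
    rw [hval z hz, hφ.bc_eq_zero_iff]
    exact ⟨_, rfl⟩
  have hlin : ∀ (T : P →ₗ[k] P) (T' : P ⧸ I →ₗ[k] P ⧸ I),
      (∀ p, mkLin k I (T p) = T' (mkLin k I p)) → (∀ z ∈ Z', T.lTensor A' z ∈ Z') →
      ∀ x ∈ thickening φ Z, q' (T.lTensor A' x) = T'.lTensor A' (q' x) := by
    intro T T' hT hTZ x hx
    obtain ⟨z, hz, y, rfl⟩ := hdec x hx
    rw [hval z hz, map_add, ← kerIncl_lTensor, hval _ (hTZ z hz), ← kerIncl_lTensor]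
    congr 1
    rw [← LinearMap.comp_apply, ← LinearMap.lTensor_comp, ← LinearMap.comp_apply,
      ← LinearMap.lTensor_comp]
    congr 2
    exact LinearMap.ext hT
  obtain ⟨r, hr⟩ := exists_kernel_reduction hφ hq
  let g : (thickObj φ hZ).carrier →ₗ[k] kernel φ ⊗[k] (P ⧸ I) :=
    { toFun := fun x => r ⟨thickObj.val x, thickObj.val_mem x⟩
      map_add' := fun x y => map_add r ⟨thickObj.val x, thickObj.val_mem x⟩
        ⟨thickObj.val y, thickObj.val_mem y⟩
      map_smul' := fun c x => map_smul r c ⟨thickObj.val x, thickObj.val_mem x⟩ }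
  have hg : ∀ x, kerIncl φ _ (g x) = q' (thickObj.val x) := fun x => hr _
  obtain ⟨Θ, hΘ⟩ := exists_quotEval_eq (hI := hI) g
    (fun p x => kerIncl_injective (by
      rw [hg, kerIncl_lTensor, hg, thickObj.val_smul, tmul_mul_eq_lTensor]
      exact hlin _ _ (fun _ => rfl)
        (fun z hz => by rw [← tmul_mul_eq_lTensor]; exact Ideal.mul_mem_left _ _ hz) _
        (thickObj.val_mem x)))
    (fun a x => kerIncl_injective (by
      rw [hg, kerIncl_lTensor, hg, thickObj.val_ρ, actOn_eq_lTensor]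
      exact hlin _ _ (fun _ => rfl)
        (fun z hz => by rw [← actOn_eq_lTensor]; exact hZ'.stable a _ hz) _
        (thickObj.val_mem x)))
  have key : IsThickClass ((Linear.leftComp k (quotObj k I hI)
      (kerι (thickπ hI φ hZ))).lTensor (kernel φ) Θ) :=
    .of_kerIncl_quotEval hφ hq hfib fun x => by
      rw [quotEval_leftComp, hΘ, hg]
      rfl
  rw [obstruction, (thickClass_spec hφ hI hZ).unique hφ key]
  exact (Module.Flat.lTensor_exact (kernel φ)
    (connecting_exact (thickπ_surjective hφ hZ) (quotObj k I hI)) _).2 ⟨Θ, rfl⟩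

/-- The canonical class extends to `Θ` on `Z̃`, and the lift is `ker Θ`. Its flatness and closed
fibre are obtained by correcting an auxiliary `q'` to an `A'`-linear `q` that agrees with `Θ` on
`Z̃` and is therefore a trivialization of `ker Θ`. -/
theorem exists_lift_of_obstruction_eq_zero (hφ : IsSmallExtension φ) (hI : I.IsGStable G)
    (hZ : IsDeformation G I A Z) (h : obstruction hφ hI hZ = 0) :
    ∃ Z' : Ideal (A' ⊗[k] P), IsDeformation G I A' Z' ∧ Z'.map (baseMap P φ) = Z := by
  obtain ⟨Θ, hΘ⟩ := (Module.Flat.lTensor_exact (kernel φ)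
    (connecting_exact (thickπ_surjective hφ hZ) (quotObj k I hI)) _).1 h
  have hker : ∀ x : (EqMod.ker (thickπ hI φ hZ)).carrier,
      quotEval Θ x.1 = quotEval (thickClass hφ hI hZ) x := fun x => by
    rw [← hΘ, quotEval_leftComp]
    rfl
  obtain ⟨q', hq, hfib⟩ := exists_trivialization_lift hφ hZ.flat hZ.fibre
  have hq0 : ∀ x ∈ thickening φ Z, bc φ _ (q' x) = 0 := fun x hx => (hq x).2 hx
  obtain ⟨Λ, hΛ⟩ := exists_isThickClass_of_lift hφ hq0 hfib hI hZ
  obtain rfl : Λ = thickClass hφ hI hZ :=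
    (IsThickClass.of_kerIncl_quotEval hφ hq0 hfib hΛ).unique hφ (thickClass_spec hφ hI hZ)
  obtain ⟨r, hr⟩ := exists_kernel_reduction hφ hq0
  -- `D = q' - Θ` vanishes on the kernel of the reduction `F : Z̃ → P`, since both terms restrict to
  -- the canonical class there. Hence `D` factors through `F`, and `τ` is an extension of the factor
  -- to all of `P`.
  let D : (thickObj φ hZ).carrier →ₗ[k] kernel φ ⊗[k] (P ⧸ I) :=
    { toFun := fun x => r ⟨thickObj.val x, thickObj.val_mem x⟩ - quotEvalLin Θ x
      map_add' := fun x y => by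
        rw [map_add]
        refine (congrArg (· - (quotEvalLin Θ x + quotEvalLin Θ y)) (map_add r
          ⟨thickObj.val x, thickObj.val_mem x⟩ ⟨thickObj.val y, thickObj.val_mem y⟩)).trans ?_
        abel
      map_smul' := fun c x => by
        rw [map_smul, RingHom.id_apply, smul_sub]
        exact congrArg (· - _) (map_smul r c ⟨thickObj.val x, thickObj.val_mem x⟩) }
  have hD : ∀ x, kerIncl φ _ (D x) = q' (thickObj.val x) - kerIncl φ _ (quotEval Θ x) :=
    fun x => (map_sub (kerIncl φ _) _ _).trans (congrArg (· - _) (hr _))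
  let F : (thickObj φ hZ).carrier →ₗ[k] P :=
    { toFun := fun x => A'.fib P (thickObj.val x)
      map_add' := fun _ _ => map_add (A'.fib P) _ _
      map_smul' := fun _ _ => map_smul (A'.fib P) _ _ }
  obtain ⟨τ, hτ⟩ := LinearMap.exists_comp_eq_of_ker_le (X := kernel φ ⊗[k] (P ⧸ I)) F D
    fun x hx => by
      apply kerIncl_injective
      have hx' : (thickπ hI φ hZ).toLin x = 0 := Subtype.ext hx
      have h1 : kerIncl φ _ (quotEval Θ x) = q' (thickObj.val x) :=
        (congrArg _ (hker ⟨x, hx'⟩)).trans (hΛ ⟨x, hx'⟩)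
      rw [hD, h1, map_zero]
      exact sub_self _
  -- The correction is `A'`-linear although `τ` is only `k`-linear, because `A'` acts on `J ⊗ P/I`
  -- through `k`.
  let q : A' ⊗[k] P →ₗ[A'] A' ⊗[k] (P ⧸ I) := q' -
    { toFun := fun x => kerIncl φ _ (τ (A'.fib P x))
      map_add' := fun x y => by simp
      map_smul' := fun a x => by
        rw [fib_smul, map_smul, map_smul, RingHom.id_apply, hφ.smul_kerIncl] }
  have hqx : ∀ x, q x = q' x - kerIncl φ _ (τ (A'.fib P x)) := fun x => rfl
  have hqmk : ∀ x : (thickObj φ hZ).carrier,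
      q (thickObj.val x) = kerIncl φ _ (quotEval Θ x) := fun x => by
    rw [hqx, show A'.fib P (thickObj.val x) = F x from rfl, hτ, hD, sub_sub_cancel]
  have hqmem : ∀ x, q x = 0 → x ∈ thickening φ Z := fun x hx => by
    rw [hqx, sub_eq_zero] at hx
    rw [← hq, hx, hφ.bc_eq_zero_iff]
    exact ⟨_, rfl⟩
  have hq_iff : ∀ x, q x = 0 ↔ ∃ y : (thickObj φ hZ).carrier,
      thickObj.val y = x ∧ quotEval Θ y = 0 := fun x => by
    constructor
    · intro hx
      refine ⟨thickObj.mk hZ x (hqmem x hx), rfl, kerIncl_injective ?_⟩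
      rw [← hqmk, map_zero]
      exact hx
    · rintro ⟨y, rfl, hy⟩
      rw [hqmk, hy, map_zero]
  -- Closure under `A'` comes from linearity of `q`, closure under `P` from `P`-linearity of `Θ`,
  -- with which `q` agrees on `Z̃`.
  let Z' : Ideal (A' ⊗[k] P) :=
    { carrier := {x | q x = 0}
      add_mem' := fun {x y} hx hy => (map_add q x y).trans (by rw [hx, hy, add_zero])
      zero_mem' := map_zero q
      smul_mem' := fun c x hx => by
        change q (c * x) = 0
        induction c with
        | zero => rw [zero_mul, map_zero]
        | tmul a p =>
          have : a ⊗ₜ[k] p * x = a • ((1 : A') ⊗ₜ[k] p * x) := by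
            rw [← smul_mul_assoc, TensorProduct.smul_tmul', smul_eq_mul, mul_one]
          obtain ⟨y, rfl, hy⟩ := (hq_iff x).1 hx
          rw [this, map_smul, ← thickObj.val_smul, hqmk, quotEval_smul, hy, map_zero, map_zero,
            smul_zero]
        | add c d hc hd => rw [add_mul, map_add, hc, hd, add_zero] }
  have hZq : IsTrivialization Z' q :=
    { ker := fun _ => Iff.rfl
      fib := fun x => by
        rw [hqx, map_sub, hφ.fib_kerIncl, sub_zero, hfib] }
  refine ⟨Z', ⟨fun g x hx => ?_, hZq.flat, hZq.fibre⟩, le_antisymm ?_ fun z hz => ?_⟩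
  · obtain ⟨y, rfl, hy⟩ := (hq_iff x).1 hx
    change q _ = 0
    rw [← thickObj.val_ρ, hqmk, quotEval_ρ, hy, map_zero, map_zero]
  · exact Ideal.map_le_iff_le_comap.2 hqmem
  -- A preimage `x ∈ Z̃` of `z` is moved into `Z'` by subtracting an element of `J ⊗ P` with the
  -- same image in `J ⊗ P/I`.
  · obtain ⟨x, rfl⟩ := hφ.bc_surjective z
    obtain ⟨y, hy⟩ := (mkLin k I).lTensor_surjective (kernel φ) Ideal.Quotient.mk_surjective
      (quotEval Θ (thickObj.mk hZ x (mem_thickening.2 hz)))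
    have hmem : x - kerIncl φ P y ∈ Z' := by
      change q _ = 0
      have h1 := hqmk (thickObj.mk hZ x (mem_thickening.2 hz))
      have h2 : q (kerIncl φ P y) = kerIncl φ _ ((mkLin k I).lTensor _ y) :=
        hφ.apply_kerIncl q _ hZq.fib y
      rw [map_sub, h2, hy, ← h1]
      apply sub_self
    have := Ideal.mem_map_of_mem (baseMap P φ) hmem
    rwa [baseMap_eq_bc, map_sub, hφ.bc_eq_zero_iff.2 ⟨y, rfl⟩, sub_zero] at this

theorem obstruction_eq_zero_iff (hφ : IsSmallExtension φ) (hI : I.IsGStable G)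
    (hZ : IsDeformation G I A Z) : obstruction hφ hI hZ = 0 ↔
      ∃ Z' : Ideal (A' ⊗[k] P), IsDeformation G I A' Z' ∧ Z'.map (baseMap P φ) = Z :=
  ⟨exists_lift_of_obstruction_eq_zero hφ hI hZ,
    fun ⟨_, h, h'⟩ => obstruction_eq_zero_of_lift hφ hI hZ h h'⟩

/-! ### Compatibility with morphisms of small extensions. -/

section naturality

variable {B' B : Art k} {ψ : B' ⟶ B} {α : A' ⟶ B'} {β : A ⟶ B}

theorem bc_mem_thickening (h : φ ≫ β = α ≫ ψ) {x : A' ⊗[k] P} (hx : x ∈ thickening φ Z) :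
    bc α P x ∈ thickening ψ (Z.map (baseMap P β)) := by
  have key : bc ψ P (bc α P x) = bc β P (bc φ P x) := by
    clear hx
    induction x with
    | zero => simp
    | tmul a p =>
      have : ψ.alg (α.alg a) = β.alg (φ.alg a) :=
        (DFunLike.congr_fun (congrArg Hom.alg h) a).symm
      simp [this]
    | add x y hx hy => rw [map_add, map_add, hx, hy, map_add, map_add]
  rw [mem_thickening, key, ← baseMap_eq_bc (φ := β)]
  exact Ideal.mem_map_of_mem _ (mem_thickening.1 hx)

/-- The map of preimages of a deformation induced by a morphism of small extensions. -/
noncomputable def thickMap (hZ : IsDeformation G I A Z) (h : φ ≫ β = α ≫ ψ) :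
    thickObj φ hZ ⟶ thickObj ψ (hZ.map β) :=
  EqMod.mkHom (M := thickObj φ hZ) (N := thickObj ψ (hZ.map β))
    { toFun := fun x => thickObj.mk (hZ.map β) (bc α P (thickObj.val x))
        (bc_mem_thickening h (thickObj.val_mem x))
      map_add' := fun x y => Subtype.ext (map_add (bc α P) _ _)
      map_smul' := fun p x => Subtype.ext (by
        change bc α P ((1 : A') ⊗ₜ[k] p * thickObj.val x) =
          (1 : B') ⊗ₜ[k] p * bc α P (thickObj.val x)
        rw [tmul_mul_eq_lTensor, tmul_mul_eq_lTensor, bc_lTensor]) }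
    (fun g x => Subtype.ext (by
      change bc α P (actOn A' g (thickObj.val x)) = actOn B' g (bc α P (thickObj.val x))
      rw [actOn_eq_lTensor, actOn_eq_lTensor, bc_lTensor]))

theorem thickMap_thickπ (hI : I.IsGStable G) (hZ : IsDeformation G I A Z) (h : φ ≫ β = α ≫ ψ) :
    thickMap hZ h ≫ thickπ hI ψ (hZ.map β) = thickπ hI φ hZ := by
  refine EqMod.hom_ext fun x => Subtype.ext ?_
  change B'.fib P (bc α P (thickObj.val x)) = A'.fib P (thickObj.val x)
  rw [fib_bc]

theorem bc_kerIncl (h : φ ≫ β = α ≫ ψ) {L : Type u} [AddCommGroup L] [Module k L]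
    (y : kernel φ ⊗[k] L) :
    bc α L (kerIncl φ L y) = kerIncl ψ L ((kernelMap φ ψ α β h).rTensor L y) := by
  induction y with
  | zero => simp
  | tmul j l => simp [kernelMap]
  | add x y hx hy => rw [map_add, map_add, hx, hy, map_add, map_add]

theorem bc_mem_maxSmulThickening (h : φ ≫ β = α ≫ ψ) {w : A' ⊗[k] P}
    (hw : w ∈ maxSmulThickening φ Z) :
    bc α P w ∈ maxSmulThickening ψ (Z.map (baseMap P β)) := by
  induction hw using Submodule.smul_induction_on' with
  | smul a ha z hz =>
    rw [bc_smul]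
    refine Submodule.smul_mem_smul ?_ (bc_mem_thickening h hz)
    rwa [mem_maximalIdeal_iff, aug_apply, ← mem_maximalIdeal_iff]
  | add z _ z' _ h h' =>
    rw [map_add]
    exact Submodule.add_mem _ h h'

/-- `thickMap` lies over the identity of `I`, so it suffices to compare canonical classes on the
source kernel. Base change respects both summands `J ⊗ P` and `𝔪 Z̃`, on which the two classes are
prescribed. -/
theorem obstruction_natural (hφ : IsSmallExtension φ) (hψ : IsSmallExtension ψ)
    (hI : I.IsGStable G) (hZ : IsDeformation G I A Z) (h : φ ≫ β = α ≫ ψ) :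
    obstruction hψ hI (hZ.map β) =
      (kernelMap φ ψ α β h).rTensor _ (obstruction hφ hI hZ) := by
  rw [← connecting_kerMap_lTensor hψ (thickπ_surjective hφ hZ) (thickMap hZ h)
    (thickMap_thickπ hI hZ h), obstruction, ← LinearMap.comp_apply (LinearMap.rTensor _ _),
    LinearMap.rTensor_comp_lTensor, ← LinearMap.lTensor_comp_rTensor, LinearMap.comp_apply]
  congr 1
  refine thickClass_ext hφ (fun x y hx => ?_) fun x hx => ?_
  · rw [quotEval_leftComp, quotEval_rTensor, (thickClass_spec hφ hI hZ).kerIncl x y hx,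
      (thickClass_spec hψ hI (hZ.map β)).kerIncl _ ((kernelMap φ ψ α β h).rTensor P y),
      ← LinearMap.comp_apply, ← LinearMap.comp_apply, LinearMap.rTensor_comp_lTensor,
      LinearMap.lTensor_comp_rTensor]
    rw [← bc_kerIncl, ← hx]
    rfl
  · rw [quotEval_leftComp, quotEval_rTensor, (thickClass_spec hφ hI hZ).smul x hx,
      (thickClass_spec hψ hI (hZ.map β)).smul ((kerMap _ (thickMap_thickπ hI hZ h)).toLin x)
        (bc_mem_maxSmulThickening h hx), map_zero]

end naturality

end thickClass

/-! ### Existence of presentations over `A` and of their lifts. -/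

section semilinear

theorem TensorProduct.rTensor_algHom_smul {k R R' N : Type*} [Field k] [CommRing R] [Algebra k R]
    [CommRing R'] [Algebra k R'] [AddCommGroup N] [Module k N] (u : R →ₐ[k] R') (c : R)
    (x : R ⊗[k] N) : u.toLinearMap.rTensor N (c • x) = u c • u.toLinearMap.rTensor N x := by
  induction x with
  | zero => simp
  | tmul b n => simp [TensorProduct.smul_tmul']
  | add x y hx hy => rw [smul_add, map_add, hx, hy, map_add, smul_add]

theorem TensorProduct.semilinear_ext {k R R' N M M' : Type*} [Field k] [CommRing R] [Algebra k R]
    [CommRing R'] [Algebra k R'] [AddCommGroup N] [Module k N] [AddCommGroup M] [Module R M]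
    [AddCommGroup M'] [Module R' M'] (u : R →ₐ[k] R') (S : M →+ M')
    (hS : ∀ (c : R) x, S (c • x) = u c • S x) (f : R ⊗[k] N →ₗ[R] M)
    (f' : R' ⊗[k] N →ₗ[R'] M') (h : ∀ n, S (f (1 ⊗ₜ n)) = f' (1 ⊗ₜ n)) (x : R ⊗[k] N) :
    S (f x) = f' (u.toLinearMap.rTensor N x) := by
  induction x with
  | zero => simp
  | tmul b n =>
    have h1 : b ⊗ₜ[k] n = b • (1 : R) ⊗ₜ[k] n := by
      rw [TensorProduct.smul_tmul', smul_eq_mul, mul_one]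
    have h2 : (1 : R') ⊗ₜ[k] n = u.toLinearMap.rTensor N ((1 : R) ⊗ₜ n) := by simp
    rw [h1, map_smul, hS, h, h2, ← map_smul, ← TensorProduct.rTensor_algHom_smul]
  | add x y hx hy => simp only [map_add, hx, hy]

theorem LinearMap.liftBaseChange_mem {k R N M : Type*} [Field k] [CommRing R] [Algebra k R]
    [AddCommGroup N] [Module k N] [AddCommGroup M] [Module k M] [Module R M] [IsScalarTower k R M]
    (f : N →ₗ[k] M) (S : Submodule R M) (h : ∀ n, f n ∈ S) (x : R ⊗[k] N) :
    f.liftBaseChange R x ∈ S := by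
  induction x with
  | zero => simp
  | tmul b n =>
    rw [LinearMap.liftBaseChange_tmul]
    exact S.smul_mem _ (h n)
  | add x y hx hy =>
    rw [map_add]
    exact S.add_mem hx hy

end semilinear

namespace EqPresentation

section freeAct

variable {k : Type u} {G : Type v} {P : Type u} [Field k] [Group G] [CommRing P] [Algebra k P]
  [MulSemiringAction G P] [SMulCommClass G k P] {A : Art k} {N : Type u} [AddCommGroup N]
  [Module k N] {σ : Representation k G N}

theorem freeAct_smul (g : G) (c : A ⊗[k] P) (x : (A ⊗[k] P) ⊗[k] N) :
    freeAct P A σ g (c • x) = actOn A g c • freeAct P A σ g x := by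
  induction x with
  | zero => simp
  | tmul b n => simp [freeAct, TensorProduct.smul_tmul']
  | add x y hx hy => rw [smul_add, map_add, hx, hy, map_add, smul_add]

theorem liftBaseChange_freeAct {M : Type u} [AddCommGroup M] [Module k M] [Module (A ⊗[k] P) M]
    [IsScalarTower k (A ⊗[k] P) M] (g : G) (T : M →+ M)
    (hT : ∀ (c : A ⊗[k] P) x, T (c • x) = actOn A g c • T x) (f : N →ₗ[k] M)
    (hf : ∀ n, f (σ g n) = T (f n)) (x : (A ⊗[k] P) ⊗[k] N) :
    f.liftBaseChange (A ⊗[k] P) (freeAct P A σ g x) = T (f.liftBaseChange (A ⊗[k] P) x) := by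
  induction x with
  | zero => simp
  | tmul b n => simp [freeAct, hf, hT]
  | add x y hx hy => simp only [map_add, hx, hy]

variable (A N) in
/-- The reduction `P_A ⊗ N → P ⊗ N`. -/
noncomputable abbrev red (P : Type u) [CommRing P] [Algebra k P] :
    (A ⊗[k] P) ⊗[k] N →ₗ[k] P ⊗[k] N :=
  (fibreMap P A).toLinearMap.rTensor N

theorem red_surjective : Function.Surjective (red A N P) :=
  LinearMap.rTensor_surjective _ fibreMap_surjective

theorem red_eq_zero_iff {x : (A ⊗[k] P) ⊗[k] N} : red A N P x = 0 ↔
    x ∈ IsLocalRing.maximalIdeal A • (⊤ : Submodule A ((A ⊗[k] P) ⊗[k] N)) := by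
  constructor
  · have key : ∀ x, x - (TensorProduct.mk k A P 1).rTensor N (red A N P x) ∈
        IsLocalRing.maximalIdeal A • (⊤ : Submodule A ((A ⊗[k] P) ⊗[k] N)) := by
      intro x
      induction x with
      | zero => simp
      | tmul c n =>
        let T : A ⊗[k] P →ₗ[A] (A ⊗[k] P) ⊗[k] N :=
          (TensorProduct.AlgebraTensorModule.mk k A (A ⊗[k] P) N).flip n
        have h1 : c ⊗ₜ n - (TensorProduct.mk k A P 1).rTensor N (red A N P (c ⊗ₜ n)) =
            T (c - 1 ⊗ₜ A.fib P c) := by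
          rw [map_sub]
          simp [T, fibreMap_eq_fib]
        rw [h1]
        have h2 := Submodule.mem_map_of_mem (f := T) (sub_fib_mem c)
        rw [Submodule.map_smul''] at h2
        exact Submodule.smul_mono le_rfl le_top h2
      | add x y hx hy =>
        rw [map_add, map_add, add_sub_add_comm]
        exact Submodule.add_mem _ hx hy
    intro h
    simpa [h] using key x
  · intro h
    induction h using Submodule.smul_induction_on' with
    | smul a ha x _ =>
      have : a • x = (a ⊗ₜ[k] (1 : P)) • x := by
        rw [← algebraMap_smul (A ⊗[k] P) a x]
        rfl
      rw [this, red, TensorProduct.rTensor_algHom_smul, fibreMap_eq_fib, fib_tmul,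
        mem_maximalIdeal_iff.1 ha, zero_smul, zero_smul]
    | add x _ y _ hx hy => rw [map_add, hx, hy, add_zero]

theorem freeAct_one_tmul (g : G) (n : N) : freeAct P A σ g (1 ⊗ₜ n) = 1 ⊗ₜ σ g n := by
  simp [freeAct]

theorem rTensor_freeAct {A' : Art k} (φ : A' ⟶ A) (g : G) (x : (A' ⊗[k] P) ⊗[k] N) : (baseMap P φ).toLinearMap.rTensor N (freeAct P A' σ g x) =
      freeAct P A σ g ((baseMap P φ).toLinearMap.rTensor N x) := by
  induction x with
  | zero => simp
  | tmul c n => simp [freeAct, actOn_baseMap]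
  | add x y hx hy => simp only [map_add, hx, hy]

end freeAct

variable {k : Type u} {G : Type v} {P : Type u} [Field k] [Group G]
  [AffineAlgebraicGroup k G] [CommRing P] [Algebra k P] [MulSemiringAction G P]
  [SMulCommClass G k P] [IsAffineGScheme k G P]
  {I : Ideal P} {hI : I.IsGStable G} {A' A : Art k} {φ : A' ⟶ A} {Z : Ideal (A ⊗[k] P)}

/-- `P_A` as a representation of `G`. -/
noncomputable def famRep (G : Type v) (P : Type u) [Group G] [AffineAlgebraicGroup k G]
    [CommRing P] [Algebra k P] [MulSemiringAction G P] [SMulCommClass G k P]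
    [IsAffineGScheme k G P] (A : Art k) : Representation k G (A ⊗[k] P) := (famObj G P A).ρ

theorem famRep_rational : (famRep G P A).IsRational := (famObj G P A).rational

/-- `P_A ⊗ N` as a representation of `G`. -/
noncomputable def freeRep (P : Type u) [CommRing P] [Algebra k P] [MulSemiringAction G P]
    [SMulCommClass G k P] [IsAffineGScheme k G P] (A : Art k) {N : Type u} [AddCommGroup N]
    [Module k N] (σ : Representation k G N) : Representation k G ((A ⊗[k] P) ⊗[k] N) :=
  (famRep G P A).tprod σ

theorem freeRep_rational {N : Type u} [AddCommGroup N] [Module k N] {σ : Representation k G N}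
    (hσ : σ.IsRational) : (freeRep P A σ).IsRational :=
  famRep_rational.tprod hσ

theorem red_freeAct {N : Type u} [AddCommGroup N] [Module k N] {σ : Representation k G N}
    (hσ : σ.IsRational) (g : G) (x : (A ⊗[k] P) ⊗[k] N) :
    red A N P (freeAct P A σ g x) = (freeObj P σ hσ).ρ g (red A N P x) := by
  change _ = ((algebraRep k G P).tprod σ) g (red A N P x)
  induction x with
  | zero => simp
  | tmul c n => simp [freeAct, fibreMap_eq_fib, actOn_eq_lTensor, fib_lTensor]
  | add x y hx hy => simp only [map_add, hx, hy]

theorem red_bc {N : Type u} [AddCommGroup N] [Module k N] (x : (A' ⊗[k] P) ⊗[k] N) :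
    red A N P ((baseMap P φ).toLinearMap.rTensor N x) = red A' N P x := by
  induction x with
  | zero => simp
  | tmul c n => simp [fibreMap_eq_fib, baseMap_eq_bc, fib_bc]
  | add x y hx hy => simp only [map_add, hx, hy]

variable (R₀ : EqPresentation k I hI)

/-- The map `P ⊗ N₁ → P` of a presentation. -/
noncomputable def uLin : P ⊗[k] R₀.N₁ →ₗ[P] P := I.subtype ∘ₗ R₀.u₀.toLin

/-- The map `P ⊗ N₂ → P ⊗ N₁` of a presentation. -/
noncomputable def vLin : P ⊗[k] R₀.N₂ →ₗ[P] P ⊗[k] R₀.N₁ := R₀.v₀.toLin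

theorem uLin_eq_zero_iff {x : P ⊗[k] R₀.N₁} : R₀.uLin x = 0 ↔ ∃ y, R₀.vLin y = x :=
  Subtype.ext_iff.symm.trans (R₀.exact x)

theorem exists_uLin_eq {p : P} (hp : p ∈ I) : ∃ x, R₀.uLin x = p := by
  obtain ⟨x, hx⟩ := R₀.surjective ⟨p, hp⟩
  exact ⟨x, congrArg Subtype.val hx⟩

theorem uLin_equivariant (g : G) (n : R₀.N₁) :
    R₀.uLin (1 ⊗ₜ R₀.σ₁ g n) = algebraRep k G P g (R₀.uLin (1 ⊗ₜ n)) := by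
  refine Eq.trans ?_ (congrArg Subtype.val (R₀.u₀.comm g (freeMk R₀.rational₁ 1 n)))
  rw [freeObj_ρ_mk, smul_one]
  rfl

theorem vLin_equivariant (g : G) (n : R₀.N₂) :
    R₀.vLin (1 ⊗ₜ R₀.σ₂ g n) = (freeObj P R₀.σ₁ R₀.rational₁).ρ g (R₀.vLin (1 ⊗ₜ n)) := by
  refine Eq.trans ?_ (R₀.v₀.comm g (freeMk R₀.rational₂ 1 n))
  rw [freeObj_ρ_mk, smul_one]
  rfl

/-- Base change to `A` is surjective and equivariant, so the restrictions of `f` and `h` to `N₁` and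
`N₂` lift equivariantly and then extend by `P_{A'}`-linearity. -/
theorem exists_isLift [IsReductiveGroup k G] (hφ : IsSmallExtension φ)
    {f : (A ⊗[k] P) ⊗[k] R₀.N₁ →ₗ[A ⊗[k] P] A ⊗[k] P}
    {h : (A ⊗[k] P) ⊗[k] R₀.N₂ →ₗ[A ⊗[k] P] (A ⊗[k] P) ⊗[k] R₀.N₁}
    (hp : R₀.IsFamilyPresentation A Z f h) : ∃ f' h', R₀.IsLift φ f h f' h' := by
  obtain ⟨f₀, hf₀, -, hf₀'⟩ := IsReductiveGroup.exists_lift (M := A' ⊗[k] P) (L := A ⊗[k] P)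
    (ρ := famRep G P A') (τ := famRep G P A) R₀.rational₁ famRep_rational
    (baseMap P φ).toLinearMap (fun a x => (actOn_baseMap φ a x).symm) ⊤
    (f.restrictScalars k ∘ₗ TensorProduct.mk k _ _ 1)
    (fun a n => by
      refine Eq.trans ?_ (hp.equivariant₁ a (1 ⊗ₜ n))
      rw [freeAct_one_tmul]
      rfl)
    (fun n => by
      obtain ⟨x, hx⟩ := hφ.bc_surjective (f (1 ⊗ₜ n))
      exact ⟨x, Submodule.mem_top, (baseMap_eq_bc x).trans hx⟩)
  obtain ⟨h₀, hh₀, -, hh₀'⟩ := IsReductiveGroup.exists_lift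
    (ρ := freeRep P A' R₀.σ₁) (τ := freeRep P A R₀.σ₁) R₀.rational₂ (freeRep_rational R₀.rational₁)
    ((baseMap P φ).toLinearMap.rTensor R₀.N₁) (rTensor_freeAct φ) ⊤
    (h.restrictScalars k ∘ₗ TensorProduct.mk k _ _ 1)
    (fun a n => by
      refine Eq.trans ?_ (hp.equivariant₂ a (1 ⊗ₜ n))
      rw [freeAct_one_tmul]
      rfl)
    (fun n => by
      have hs : Function.Surjective (baseMap P φ).toLinearMap := fun x => by
        obtain ⟨x, rfl⟩ := hφ.bc_surjective x
        exact ⟨x, baseMap_eq_bc x⟩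
      obtain ⟨x, hx⟩ := LinearMap.rTensor_surjective R₀.N₁ hs (h (1 ⊗ₜ n))
      exact ⟨x, Submodule.mem_top, hx⟩)
  refine ⟨f₀.liftBaseChange _, h₀.liftBaseChange _, fun g => ?_, fun g => ?_, ?_, ?_⟩
  · exact liftBaseChange_freeAct g (actOn A' g).toLinearMap.toAddMonoidHom
      (fun c x => map_mul (actOn A' g) c x) f₀ (hf₀ g)
  · exact liftBaseChange_freeAct g (freeAct P A' R₀.σ₁ g).toAddMonoidHom (freeAct_smul g) h₀ (hh₀ g)
  · refine TensorProduct.semilinear_ext (baseMap P φ) (baseMap P φ).toLinearMap.toAddMonoidHom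
      (fun c x => map_mul (baseMap P φ) c x) _ f fun n => ?_
    rw [LinearMap.liftBaseChange_tmul, one_smul]
    exact hf₀' n
  · refine TensorProduct.semilinear_ext (baseMap P φ)
      ((baseMap P φ).toLinearMap.rTensor R₀.N₁).toAddMonoidHom
      (fun c x => TensorProduct.rTensor_algHom_smul _ c x) _ h fun n => ?_
    rw [LinearMap.liftBaseChange_tmul, one_smul]
    exact hh₀' n

/-- A trivialization splits over `A`, its target being free, so `Z` is a direct summand of the free
module `P_A`. -/
theorem flat_of_isDeformation (hflat : Module.Flat A ((A ⊗[k] P) ⧸ Z))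
    (hZ : Z.map (fibreMap P A) = I) : Module.Flat A (Z.restrictScalars A) := by
  obtain ⟨q, hq⟩ := exists_isTrivialization hflat hZ
  obtain ⟨s, hs⟩ := Module.projective_lifting_property q LinearMap.id hq.surjective
  let T : A ⊗[k] P →ₗ[A] A ⊗[k] P := LinearMap.id - s ∘ₗ q
  have hmem : ∀ x, T x ∈ Z.restrictScalars A := fun x => by
    refine (hq.ker _).1 ?_
    have := LinearMap.congr_fun hs (q x)
    simp only [LinearMap.comp_apply, LinearMap.id_apply] at this
    simp [T, this]
  refine Module.Flat.of_retract (Z.restrictScalars A).subtype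
    (T.codRestrict (Z.restrictScalars A) hmem) ?_
  ext x
  have := (hq.ker x.1).2 x.2
  simp [T, this]

/-- Reductivity lifts `u₀` to an equivariant map `N₁ → Z` and then `v₀` to an equivariant map `N₂ →
ker f`. That `f` has image `Z` and `h` has image `ker f` follows from the closed fibre by Nakayama,
using flatness of `P_A/Z` and of `Z` respectively. -/
theorem exists_isFamilyPresentation [IsReductiveGroup k G] (hZ : IsDeformation G I A Z) :
    ∃ f h, R₀.IsFamilyPresentation A Z f h := by
  have hflat' : Module.Flat A ((A ⊗[k] P) ⧸ Z.restrictScalars A) :=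
    have := hZ.flat
    Module.Flat.of_linearEquiv (Submodule.Quotient.restrictScalarsEquiv A Z)
  have hZm : ∀ z ∈ Z, A.fib P z = 0 → z ∈ IsLocalRing.maximalIdeal A • Z.restrictScalars A :=
    fun z hz h0 => Module.Flat.mem_smul_of_mem _ _ hz (fib_eq_zero_iff.1 h0)
  obtain ⟨f₀, hf₀, hf₀Z, hf₀'⟩ := IsReductiveGroup.exists_lift (M := A ⊗[k] P)
    (ρ := famRep G P A) (τ := algebraRep k G P) R₀.rational₁ famRep_rational
    (A.fib P) (fun a x => (congrArg _ (actOn_eq_lTensor A a x)).trans (fib_lTensor _ _))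
    ⟨Z.restrictScalars k, fun g x hx => hZ.stable g x hx⟩
    (R₀.uLin.restrictScalars k ∘ₗ TensorProduct.mk k _ _ 1) (R₀.uLin_equivariant)
    (fun n => exists_mem_fib_eq hZ.fibre (R₀.u₀.toLin (freeMk R₀.rational₁ 1 n)).2)
  let f := f₀.liftBaseChange (A ⊗[k] P)
  have hfZ : ∀ x, f x ∈ Z := f₀.liftBaseChange_mem Z hf₀Z
  have hfib₁ : ∀ x, fibreMap P A (f x) = R₀.uLin (red A R₀.N₁ P x) :=
    TensorProduct.semilinear_ext (fibreMap P A) (fibreMap P A).toLinearMap.toAddMonoidHom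
      (fun c x => map_mul (fibreMap P A) c x) f R₀.uLin fun n => by
        simp only [f, LinearMap.liftBaseChange_tmul, one_smul]
        exact (fibreMap_eq_fib _).trans (hf₀' n)
  have hfA : LinearMap.range (f.restrictScalars A) = Z.restrictScalars A := by
    refine le_antisymm ?_ ?_
    · rintro _ ⟨x, rfl⟩
      exact hfZ x
    · refine Submodule.le_of_le_sup_smul_of_isNilpotent A.isNilpotent_maximalIdeal fun z hz => ?_
      obtain ⟨y, hy⟩ := R₀.exists_uLin_eq (fib_mem hZ.fibre hz)
      obtain ⟨x, rfl⟩ := red_surjective (A := A) y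
      refine Submodule.mem_sup.2 ⟨f x, ⟨x, rfl⟩, z - f x, hZm _ (Z.sub_mem hz (hfZ x)) ?_, by abel⟩
      rw [map_sub, ← hy, ← hfib₁, fibreMap_eq_fib, sub_self]
  -- Relations lift: for any lift `x` of `y`, `f x` lies in `Z ∩ 𝔪 P_A = 𝔪 Z`, which is the image
  -- under `f` of `𝔪 (P_A ⊗ N₁)`, so `x` can be corrected without changing its reduction.
  have hker : ∀ y, R₀.uLin y = 0 → ∃ x, f x = 0 ∧ red A R₀.N₁ P x = y := fun y hy => by
    obtain ⟨x, rfl⟩ := red_surjective (A := A) y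
    rw [← hfib₁, fibreMap_eq_fib] at hy
    have h1 := hZm _ (hfZ x) hy
    rw [← hfA, LinearMap.range_eq_map, ← Submodule.map_smul''] at h1
    obtain ⟨w, hw, hwx⟩ := h1
    refine ⟨x - w, ?_, ?_⟩
    · rw [map_sub, sub_eq_zero]
      exact hwx.symm
    · rw [map_sub, red_eq_zero_iff.2 hw, sub_zero]
  have heq₁ : ∀ (g : G) x, f (freeAct P A R₀.σ₁ g x) = actOn A g (f x) := fun g =>
    liftBaseChange_freeAct g (actOn A g).toLinearMap.toAddMonoidHom
      (fun c x => map_mul (actOn A g) c x) f₀ (hf₀ g)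
  obtain ⟨h₀, hh₀, hh₀K, hh₀'⟩ := IsReductiveGroup.exists_lift
    (L := P ⊗[k] R₀.N₁) (ρ := freeRep P A R₀.σ₁) (τ := (freeObj P R₀.σ₁ R₀.rational₁).ρ)
    R₀.rational₂ (freeRep_rational R₀.rational₁) (red A R₀.N₁ P)
    (fun a x => red_freeAct R₀.rational₁ a x)
    ⟨(LinearMap.ker f).restrictScalars k, fun g x hx => by
      change f (freeAct P A R₀.σ₁ g x) = 0
      rw [heq₁, show f x = 0 from hx, map_zero]⟩
    (R₀.vLin.restrictScalars k ∘ₗ TensorProduct.mk k _ _ 1) (R₀.vLin_equivariant)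
    (fun n => hker _ (R₀.uLin_eq_zero_iff.2 ⟨_, rfl⟩))
  let h := h₀.liftBaseChange (A ⊗[k] P)
  have hfh : ∀ x, f (h x) = 0 := h₀.liftBaseChange_mem (LinearMap.ker f) hh₀K
  have hfib₂ : ∀ x, red A R₀.N₁ P (h x) = R₀.vLin (red A R₀.N₂ P x) :=
    TensorProduct.semilinear_ext (fibreMap P A) (red A R₀.N₁ P).toAddMonoidHom
      (fun c x => TensorProduct.rTensor_algHom_smul _ c x) h R₀.vLin fun n => by
        simp only [h, LinearMap.liftBaseChange_tmul, one_smul]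
        exact hh₀' n
  have hflatK : Module.Flat A (((A ⊗[k] P) ⊗[k] R₀.N₁) ⧸ LinearMap.ker (f.restrictScalars A)) := by
    have := flat_of_isDeformation hZ.flat hZ.fibre
    rw [← hfA] at this
    exact Module.Flat.of_linearEquiv (f.restrictScalars A).quotKerEquivRange
  refine ⟨f, h, heq₁, fun g => ?_, Submodule.ext fun z => ?_, fun x => ⟨fun hx => ?_, ?_⟩,
    hfib₁, hfib₂⟩
  · exact liftBaseChange_freeAct g (freeAct P A R₀.σ₁ g).toAddMonoidHom (freeAct_smul g) h₀ (hh₀ g)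
  · exact SetLike.ext_iff.1 hfA z
  · have hle : LinearMap.ker (f.restrictScalars A) ≤ LinearMap.range (h.restrictScalars A) := by
      refine Submodule.le_of_le_sup_smul_of_isNilpotent A.isNilpotent_maximalIdeal fun x hx => ?_
      have hx : f x = 0 := hx
      obtain ⟨y, hy⟩ := R₀.uLin_eq_zero_iff.1 (by rw [← hfib₁, hx, map_zero])
      obtain ⟨y, rfl⟩ := red_surjective (A := A) y
      refine Submodule.mem_sup.2 ⟨h y, ⟨y, rfl⟩, x - h y, ?_, by abel⟩
      refine Module.Flat.mem_smul_of_mem _ _ ?_ (red_eq_zero_iff.1 ?_)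
      · change f (x - h y) = 0
        rw [map_sub, hx, hfh, sub_self]
      · rw [map_sub, hfib₂, hy, sub_self]
    exact hle hx
  · rintro ⟨y, rfl⟩
    exact hfh y

/-! ### The canonical class computed from lifts of a presentation. -/

section cocycle

variable {f : (A ⊗[k] P) ⊗[k] R₀.N₁ →ₗ[A ⊗[k] P] A ⊗[k] P}
  {h : (A ⊗[k] P) ⊗[k] R₀.N₂ →ₗ[A ⊗[k] P] (A ⊗[k] P) ⊗[k] R₀.N₁}
  {f' : (A' ⊗[k] P) ⊗[k] R₀.N₁ →ₗ[A' ⊗[k] P] A' ⊗[k] P}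
  {h' : (A' ⊗[k] P) ⊗[k] R₀.N₂ →ₗ[A' ⊗[k] P] (A' ⊗[k] P) ⊗[k] R₀.N₁}

theorem lift_mem_thickening (hp : R₀.IsFamilyPresentation A Z f h) (hl : R₀.IsLift φ f h f' h')
    (x : (A' ⊗[k] P) ⊗[k] R₀.N₁) : f' x ∈ thickening φ Z := by
  rw [Ideal.mem_comap, hl.lift₁, ← hp.range_eq]
  exact ⟨_, rfl⟩

/-- The morphism `P ⊗ N₁ → Z'` to the preimage `Z'` of `Z` defined by a lift of a presentation. -/
noncomputable def liftHom (hZ : IsDeformation G I A Z) (hp : R₀.IsFamilyPresentation A Z f h)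
    (hl : R₀.IsLift φ f h f' h') : freeObj P R₀.σ₁ R₀.rational₁ ⟶ thickObj φ hZ :=
  freeHom R₀.rational₁ (M := thickObj φ hZ)
    { toFun := fun n => thickObj.mk hZ (f' (1 ⊗ₜ n)) (R₀.lift_mem_thickening hp hl _)
      map_add' := fun x y => Subtype.ext (by
        change f' _ = f' _ + f' _
        rw [TensorProduct.tmul_add, map_add])
      map_smul' := fun c x => Subtype.ext (by
        change f' _ = c • f' _
        rw [TensorProduct.tmul_smul]
        exact (f'.restrictScalars k).map_smul _ _) }
    (fun g n => Subtype.ext (by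
      change f' (1 ⊗ₜ R₀.σ₁ g n) = actOn A' g (f' (1 ⊗ₜ n))
      rw [← hl.equivariant₁, freeAct_one_tmul]))

theorem val_liftHom (hZ : IsDeformation G I A Z) (hp : R₀.IsFamilyPresentation A Z f h)
    (hl : R₀.IsLift φ f h f' h') (p : P) (n : R₀.N₁) :
    thickObj.val ((R₀.liftHom hZ hp hl).toLin (freeMk R₀.rational₁ p n)) =
      (1 : A') ⊗ₜ[k] p * f' (1 ⊗ₜ n) :=
  congrArg thickObj.val (freeHom_mk R₀.rational₁ _ _ p n)

theorem liftHom_thickπ (hZ : IsDeformation G I A Z) (hp : R₀.IsFamilyPresentation A Z f h)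
    (hl : R₀.IsLift φ f h f' h') : R₀.liftHom hZ hp hl ≫ thickπ hI φ hZ = R₀.u₀ := by
  refine freeObj_hom_ext fun n => Subtype.ext ?_
  change A'.fib P (thickObj.val ((R₀.liftHom hZ hp hl).toLin (freeMk R₀.rational₁ 1 n))) =
    R₀.uLin (1 ⊗ₜ n)
  rw [val_liftHom, ← Algebra.TensorProduct.one_def, one_mul, ← fib_bc (φ := φ), ← baseMap_eq_bc,
    hl.lift₁, ← fibreMap_eq_fib]
  refine (hp.fibre₁ _).trans ?_
  change R₀.uLin (red A R₀.N₁ P _) = _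
  rw [red_bc]
  simp

/-- On `(a ⊗ p) ⊗ n` the two terms differ only by replacing `a` with its augmentation, hence by an
element of `𝔪_{A'}` times an element of `Z̃`. So `f'` may replace the `P`-linear `liftHom` wherever
`𝔪_{A'} Z̃` is ignored. -/
theorem sub_val_liftHom_mem (hZ : IsDeformation G I A Z) (hp : R₀.IsFamilyPresentation A Z f h)
    (hl : R₀.IsLift φ f h f' h') (c : (A' ⊗[k] P) ⊗[k] R₀.N₁) :
    thickObj.val ((R₀.liftHom hZ hp hl).toLin (red A' R₀.N₁ P c)) - f' c ∈
      maxSmulThickening φ Z := by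
  let F : P ⊗[k] R₀.N₁ →+ A' ⊗[k] P :=
    { toFun := fun x => thickObj.val ((R₀.liftHom hZ hp hl).toLin x)
      map_zero' := congrArg thickObj.val (map_zero (R₀.liftHom hZ hp hl).toLin)
      map_add' := fun x y => congrArg thickObj.val (map_add (R₀.liftHom hZ hp hl).toLin x y) }
  have hF : ∀ p n, F (p ⊗ₜ n) = (1 : A') ⊗ₜ[k] p * f' (1 ⊗ₜ n) := R₀.val_liftHom hZ hp hl
  change F (red A' R₀.N₁ P c) - f' c ∈ _
  induction c with
  | zero => simp
  | add x y hx hy =>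
    rw [map_add, map_add, map_add, add_sub_add_comm]
    exact Submodule.add_mem _ hx hy
  | tmul c n =>
    induction c with
    | zero => simp
    | add x y hx hy =>
      rw [TensorProduct.add_tmul, map_add, map_add, map_add, add_sub_add_comm]
      exact Submodule.add_mem _ hx hy
    | tmul a p =>
      have h1 : F (red A' R₀.N₁ P ((a ⊗ₜ p) ⊗ₜ n)) - f' ((a ⊗ₜ p) ⊗ₜ n) =
          -((a - algebraMap k A' (A'.aug a)) • ((1 : A') ⊗ₜ[k] p * f' (1 ⊗ₜ n))) := by
        have h2 : (a ⊗ₜ[k] p) ⊗ₜ[k] n = (a ⊗ₜ[k] p) • ((1 : A' ⊗[k] P) ⊗ₜ[k] n) := by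
          rw [TensorProduct.smul_tmul', smul_eq_mul, mul_one]
        have h3 : a ⊗ₜ[k] p = a • ((1 : A') ⊗ₜ[k] p) := by
          rw [TensorProduct.smul_tmul', smul_eq_mul, mul_one]
        rw [LinearMap.rTensor_tmul, AlgHom.toLinearMap_apply, fibreMap_eq_fib, fib_tmul, hF, h2,
          map_smul, h3, smul_eq_mul, smul_mul_assoc, TensorProduct.tmul_smul, smul_mul_assoc,
          sub_smul, algebraMap_smul, neg_sub]
      rw [h1]
      exact Submodule.neg_mem _ (Submodule.smul_mem_smul (sub_aug_mem a)
        (Ideal.mul_mem_left _ _ (R₀.lift_mem_thickening hp hl _)))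

theorem exists_kerIncl_eq (hφ : IsSmallExtension φ) (hp : R₀.IsFamilyPresentation A Z f h)
    (hl : R₀.IsLift φ f h f' h') (x : (A' ⊗[k] P) ⊗[k] R₀.N₂) :
    ∃ y, kerIncl φ P y = f' (h' x) := by
  rw [← hφ.bc_eq_zero_iff, ← baseMap_eq_bc, hl.lift₁, hl.lift₂]
  exact (hp.exact _).2 ⟨_, rfl⟩

/-- The obstruction cocycle of a lift of a presentation. -/
noncomputable def cocycle (hφ : IsSmallExtension φ) (hZ : IsDeformation G I A Z)
    (hp : R₀.IsFamilyPresentation A Z f h) (hl : R₀.IsLift φ f h f' h') :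
    kernel φ ⊗[k] (R₀.relObj ⟶ quotObj k I hI) :=
  (Linear.leftComp k (quotObj k I hI)
    (kerMap (R₀.liftHom hZ hp hl) (R₀.liftHom_thickπ hZ hp hl))).lTensor (kernel φ)
      (thickClass hφ hI hZ)

/-- In `Z̃`, the relation of `n` becomes `f' (h' (1 ⊗ n))` up to `𝔪_{A'} Z̃`. The canonical class
kills the error and projects the rest, which lies in `J ⊗ P`. -/
theorem quotEval_cocycle (hφ : IsSmallExtension φ) (hZ : IsDeformation G I A Z)
    (hp : R₀.IsFamilyPresentation A Z f h) (hl : R₀.IsLift φ f h f' h') (n : R₀.N₂)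
    (y : kernel φ ⊗[k] P) (hy : kerIncl φ P y = f' (h' (1 ⊗ₜ n))) :
    quotEval (R₀.cocycle hφ hZ hp hl) (R₀.rel n) = (mkLin k I).lTensor _ y := by
  let x := (kerMap (R₀.liftHom hZ hp hl) (R₀.liftHom_thickπ hZ hp hl)).toLin (R₀.rel n)
  have hred : red A' R₀.N₁ P (h' (1 ⊗ₜ n)) = R₀.vLin (1 ⊗ₜ n) := by
    rw [← red_bc (φ := φ), hl.lift₂]
    refine (hp.fibre₂ _).trans ?_
    change R₀.vLin (red A R₀.N₂ P _) = _
    rw [red_bc]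
    simp
  have hx : thickπ.val x - kerIncl φ P y ∈ maxSmulThickening φ Z := by
    have := R₀.sub_val_liftHom_mem hZ hp hl (h' (1 ⊗ₜ n))
    rw [hred, ← hy] at this
    exact this
  have hsum : x = thickπ.mk hI hZ _ (kerIncl_mem_thickening hφ y) (hφ.fib_kerIncl y) +
      thickπ.mk hI hZ _ (maxSmulThickening_le hx) (fib_eq_zero_of_mem_maxSmulThickening hx) :=
    thickπ.val_injective (add_sub_cancel _ _).symm
  refine (quotEval_leftComp _ _ _).trans ?_
  change quotEval _ x = _
  rw [hsum, quotEval_add, (thickClass_spec hφ hI hZ).kerIncl _ y rfl]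
  exact (congrArg _ ((thickClass_spec hφ hI hZ).smul
    (thickπ.mk hI hZ _ (maxSmulThickening_le hx) (fib_eq_zero_of_mem_maxSmulThickening hx))
    hx)).trans (add_zero _)

/-- The condition prescribes the values of `η` on relations generating `K`, so at most one `η` meets
it; the pulled-back canonical class does. -/
theorem isObstructionCocycle_iff (hφ : IsSmallExtension φ) (hZ : IsDeformation G I A Z)
    (hp : R₀.IsFamilyPresentation A Z f h) (hl : R₀.IsLift φ f h f' h')
    (η : kernel φ ⊗[k] (R₀.relObj ⟶ quotObj k I hI)) :
    R₀.IsObstructionCocycle φ f' h' η ↔ η = R₀.cocycle hφ hZ hp hl := by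
  constructor
  · intro hη
    refine quotEval_injective fun x => ?_
    have hx : x ∈ Submodule.span P (Set.range R₀.rel) := by
      rw [R₀.span_rel]
      exact Submodule.mem_top
    induction hx using Submodule.span_induction with
    | mem x hx =>
      obtain ⟨n, rfl⟩ := hx
      obtain ⟨y, hy, hy'⟩ := hη n
      rw [R₀.quotEval_cocycle hφ hZ hp hl n y hy]
      exact hy'.symm
    | zero => exact (tensorEval_zero _).trans (tensorEval_zero _).symm
    | add x y _ _ hx hy => rw [quotEval_add, quotEval_add, hx, hy]
    | smul p x _ hx => rw [quotEval_smul, quotEval_smul, hx]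
  · rintro rfl n
    obtain ⟨y, hy⟩ := R₀.exists_kerIncl_eq hφ hp hl (1 ⊗ₜ n)
    exact ⟨y, hy, (R₀.quotEval_cocycle hφ hZ hp hl n y hy).symm⟩

end cocycle

theorem isObstructionClass_obstruction [IsReductiveGroup k G] (hφ : IsSmallExtension φ)
    (hZ : IsDeformation G I A Z) : R₀.IsObstructionClass φ Z (obstruction hφ hI hZ) where
  exists_presentation := R₀.exists_isFamilyPresentation hZ
  exists_lift _ _ hp := R₀.exists_isLift hφ hp
  class_eq _ _ _ _ hp hl := ⟨R₀.cocycle hφ hZ hp hl, R₀.isObstructionCocycle_iff hφ hZ hp hl,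
    connecting_kerMap_lTensor hφ R₀.surjective _ (R₀.liftHom_thickπ hZ hp hl)⟩

end EqPresentation

theorem proposition3p8 {k : Type u} {G : Type v} {P : Type u}
    [Field k] [IsAlgClosed k] [CharZero k]
    [Group G] [AffineAlgebraicGroup k G] [IsReductiveGroup k G]
    [CommRing P] [Algebra k P] [Algebra.FiniteType k P]
    [MulSemiringAction G P] [SMulCommClass G k P] [IsAffineGScheme k G P]
    (I : Ideal P) (hI : I.IsGStable G) (hX : HasFiniteMultiplicities k I hI) :
    Nonempty (EqPresentation k I hI) ∧
    ∃ T : ObstructionTheory (deformationFunctor k G I)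
        (Abelian.Ext (idealObj k I hI) (quotObj k I hI) 1),
      ∀ (R₀ : EqPresentation k I hI) {A' A : Art k} (φ : A' ⟶ A)
        (hφ : Art.IsSmallExtension φ) (z : (deformationFunctor k G I).obj A),
        R₀.IsObstructionClass φ z.1 (T.ob φ hφ z) := by
  have := Algebra.FiniteType.isNoetherianRing k P
  obtain ⟨R₀⟩ := exists_eqPresentation (k := k) I hI
  exact ⟨⟨R₀⟩,
    { finite := R₀.ext_finite hX
      ob := fun φ hφ z => obstruction hφ hI z.2
      exact := fun φ hφ z => (obstruction_eq_zero_iff hφ hI z.2).trans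
        ⟨fun ⟨Z', h, h'⟩ => ⟨⟨Z', h⟩, Subtype.ext h'⟩,
          fun ⟨z', h⟩ => ⟨z'.1, z'.2, congrArg Subtype.val h⟩⟩
      natural := fun φ hφ ψ hψ α β h z => obstruction_natural hφ hψ hI z.2 h },
    fun R₀ _ _ φ hφ z => R₀.isObstructionClass_obstruction hφ z.2⟩
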